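/- Let $\mathbb{T}^\infty$ be the countably infinite product of unit circles with its normalized Haar measure $m_\infty$, and let $\mathbb{D}_1^\infty=\{\zeta\in\ell^1:\ |\zeta_n|<1 \text{ for all } n\ge 1\}$, an open subset of the Banach space $\ell^1$. A function on $\mathbb{D}_1^\infty$ is called holomorphic if it is locally bounded and holomorphic along complex lines. For $F:\mathbb{D}_1^\infty\to\mathbb{C}$ and $0<r<1$ put $F_{[r]}(w)=F(rw_1,r^2w_2,\ldots,r^nw_n,\ldots)$, $w\in\mathbb{T}^\infty$. Let $L^0(\mathbb{T}^\infty)$ be the algebra of (a.e.-classes of) complex measurable functions $f$ on $\mathbb{T}^\infty$ with $\|f\|_0=\int_{\mathbb{T}^\infty}\log(1+|f|)\,dm_\infty<\infty$, with the metric $d_0(f,g)=\|f-g\|_0$, and let $N_*(\mathbb{T}^\infty)$ be the closure in $L^0(\mathbb{T}^\infty)$ of the set $\mathcal{P}_\infty$ of analytic polynomials (each depending on finitely many of the variables). Let $N_*(\mathbb{D}_1^\infty)$ be the class of holomorphic functions $F$ on $\mathbb{D}_1^\infty$ such that $\sup_{0<r<1}\int_{\mathbb{T}^\infty}\log^+|F_{[r]}|\,dm_\infty<\infty$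 and the family $\{\log^+|F_{[r]}|\}_{0<r<1}$ is uniformly integrable, with $d_0(F,G)=\|F-G\|_0$, where $\|F\|_0=\sup_{0<r<1}\int_{\mathbb{T}^\infty}\log(1+|F_{[r]}|)\,dm_\infty$. **Theorem (Generalized Fatou's theorem).** For every $\zeta\in\mathbb{D}_1^\infty$ the point evaluation $q\mapsto q(\zeta)$ on $\mathcal{P}_\infty$ extends (uniquely) to a continuous function $E_\zeta$ on $N_*(\mathbb{T}^\infty)$; for $f\in N_*(\mathbb{T}^\infty)$ put $\tilde f(\zeta)=E_\zeta f$, $\zeta\in\mathbb{D}_1^\infty$. The classes $N_*(\mathbb{D}_1^\infty)$ and $N_*(\mathbb{T}^\infty)$ are algebras under the pointwise (respectively a.e. pointwise) operations. For every $F\in N_*(\mathbb{D}_1^\infty)$ the limit $F^*(w)=\lim_{r\to1^-}F_{[r]}(w)$ exists for almost every $w\in\mathbb{T}^\infty$, and the map $$\Lambda:\ N_*(\mathbb{D}_1^\infty)\to N_*(\mathbb{T}^\infty),\qquad F\mapsto F^*,$$ is an algebra isomorphism onto $N_*(\mathbb{T}^\infty)$ with $\|F-G\|_0=\|F^*-G^*\|_0$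 for all $F,G\in N_*(\mathbb{D}_1^\infty)$. Its inverse is $f\mapsto\tilde f$. -/

import Mathlib

open MeasureTheory Filter Topology Set
open scoped ENNReal

namespace SmirnovClass

noncomputable section

/-! ### The infinite torus and its Haar measure -/

instance circleMeasurableSpace : MeasurableSpace Circle := borel Circle

instance circleBorelSpace : BorelSpace Circle := ⟨rfl⟩

/-- The normalized arc length measure `dθ / 2π` on the unit circle. -/
def circleMeasure : Measure Circle :=
  (ENNReal.ofReal (2 * Real.pi))⁻¹ •
    (volume.restrict (Ioc (0 : ℝ) (2 * Real.pi))).map (fun θ : ℝ => Circle.exp θ)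

instance circleMeasure_isProbabilityMeasure : IsProbabilityMeasure circleMeasure := by
  constructor
  have hm : Measurable (fun θ : ℝ => Circle.exp θ) := Circle.exp.continuous.measurable
  rw [circleMeasure, Measure.smul_apply, Measure.map_apply hm MeasurableSet.univ]
  simp only [preimage_univ, Measure.restrict_apply_univ, Real.volume_Ioc, sub_zero, smul_eq_mul]
  exact ENNReal.inv_mul_cancel (by simp [Real.pi_pos]) ENNReal.ofReal_ne_top

/-- The infinite torus, with the product topology and the product (Borel) sigma-algebra. The
coordinates are numbered from `0`: the coordinate `n` here is the coordinate `n + 1` in the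
usual numbering from `1`. -/
abbrev Torus : Type := ℕ → Circle

/-- The product measure `dθ₁/2π × dθ₂/2π × ⋯`, which is the normalized Haar measure. -/
def torusMeasure : Measure Torus := Measure.infinitePi (fun _ : ℕ => circleMeasure)

instance torusMeasure_isProbabilityMeasure : IsProbabilityMeasure torusMeasure := by
  unfold torusMeasure; infer_instance

/-! ### The functional `‖f‖₀ = ∫ log (1 + |f|)` and the space `L⁰` of the torus -/

/-- `‖f‖₀ = ∫ log (1 + |f|)`, with values in `[0, ∞]`. -/
def logNorm (f : Torus → ℂ) : ℝ≥0∞ :=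
  ∫⁻ w, ENNReal.ofReal (Real.log (1 + ‖f w‖)) ∂torusMeasure

lemma logNorm_congr {f g : Torus → ℂ} (h : f =ᵐ[torusMeasure] g) : logNorm f = logNorm g := by
  refine lintegral_congr_ae ?_
  filter_upwards [h] with w hw
  rw [hw]

lemma log_one_add_norm_add_le (a b : ℂ) :
    Real.log (1 + ‖a + b‖) ≤ Real.log (1 + ‖a‖) + Real.log (1 + ‖b‖) := by
  rw [← Real.log_mul (by positivity) (by positivity)]
  refine Real.log_le_log (by positivity) ?_
  nlinarith [norm_add_le a b, mul_nonneg (norm_nonneg a) (norm_nonneg b)]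

lemma log_one_add_norm_mul_le (a b : ℂ) :
    Real.log (1 + ‖a * b‖) ≤ Real.log (1 + ‖a‖) + Real.log (1 + ‖b‖) := by
  rw [← Real.log_mul (by positivity) (by positivity)]
  refine Real.log_le_log (by positivity) ?_
  rw [norm_mul]
  nlinarith [norm_nonneg a, norm_nonneg b]

lemma log_one_add_norm_nonneg (a : ℂ) : 0 ≤ Real.log (1 + ‖a‖) :=
  Real.log_nonneg (by linarith [norm_nonneg a])

lemma measurable_log_one_add_norm :
    Measurable (fun a : ℂ => ENNReal.ofReal (Real.log (1 + ‖a‖))) := by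
  fun_prop

lemma logNorm_le_add {f g h : Torus → ℂ} (hf : AEStronglyMeasurable f torusMeasure)
    (H : ∀ᵐ w ∂torusMeasure,
      Real.log (1 + ‖h w‖) ≤ Real.log (1 + ‖f w‖) + Real.log (1 + ‖g w‖)) :
    logNorm h ≤ logNorm f + logNorm g := by
  have hm : AEMeasurable (fun w => ENNReal.ofReal (Real.log (1 + ‖f w‖))) torusMeasure :=
    measurable_log_one_add_norm.comp_aemeasurable hf.aemeasurable
  unfold logNorm
  rw [← lintegral_add_left' hm]
  refine lintegral_mono_ae ?_
  filter_upwards [H] with w hw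
  rw [← ENNReal.ofReal_add (log_one_add_norm_nonneg _) (log_one_add_norm_nonneg _)]
  exact ENNReal.ofReal_le_ofReal hw

lemma logNorm_lt_top_of_bound {f : Torus → ℂ} {C : ℝ}
    (h : ∀ᵐ w ∂torusMeasure, ‖f w‖ ≤ C) : logNorm f < ∞ := by
  have h1 : logNorm f ≤ ∫⁻ _ : Torus, ENNReal.ofReal (Real.log (1 + C)) ∂torusMeasure := by
    refine lintegral_mono_ae ?_
    filter_upwards [h] with w hw
    exact ENNReal.ofReal_le_ofReal (Real.log_le_log (by positivity) (by linarith))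
  refine h1.trans_lt ?_
  simp

/-- Classes, modulo equality almost everywhere, of complex measurable functions on the torus. -/
abbrev MeasFun : Type := Torus →ₘ[torusMeasure] ℂ

/-- The pointwise almost everywhere ring structure. -/
instance measFunCommRing : CommRing MeasFun :=
  { (inferInstance : AddCommGroup MeasFun), (inferInstance : CommMonoid MeasFun) with
    left_distrib := fun f g h => by
      induction f, g, h using AEEqFun.induction_on₃ with
      | _ f hf g hg h hh => exact congrArg _ (Subtype.ext (mul_add f g h))
    right_distrib := fun f g h => by
      induction f, g, h using AEEqFun.induction_on₃ with
      | _ f hf g hg h hh => exact congrArg _ (Subtype.ext (add_mul f g h))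
    zero_mul := fun f => by
      induction f using AEEqFun.induction_on with
      | _ f hf => exact congrArg _ (Subtype.ext (zero_mul f))
    mul_zero := fun f => by
      induction f using AEEqFun.induction_on with
      | _ f hf => exact congrArg _ (Subtype.ext (mul_zero f)) }

instance measFunAlgebra : Algebra ℂ MeasFun :=
  Algebra.ofModule
    (fun c f g => by
      induction f, g using AEEqFun.induction_on₂ with
      | _ f hf g hg => exact congrArg _ (Subtype.ext (smul_mul_assoc c f g)))
    (fun c f g => by
      induction f, g using AEEqFun.induction_on₂ with
      | _ f hf g hg => exact congrArg _ (Subtype.ext (mul_smul_comm c f g)))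

/-- `L⁰` of the torus: the classes with `‖f‖₀ < ∞`. -/
def L0 : Subalgebra ℂ MeasFun where
  carrier := {f | logNorm f < ∞}
  mul_mem' := fun {f g} hf hg => by
    refine (logNorm_le_add f.aestronglyMeasurable ?_).trans_lt (ENNReal.add_lt_top.2 ⟨hf, hg⟩)
    filter_upwards [AEEqFun.coeFn_mul f g] with w hw
    rw [hw]
    exact log_one_add_norm_mul_le _ _
  add_mem' := fun {f g} hf hg => by
    refine (logNorm_le_add f.aestronglyMeasurable ?_).trans_lt (ENNReal.add_lt_top.2 ⟨hf, hg⟩)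
    filter_upwards [AEEqFun.coeFn_add f g] with w hw
    rw [hw]
    exact log_one_add_norm_add_le _ _
  algebraMap_mem' := fun c => by
    refine logNorm_lt_top_of_bound (C := ‖c‖) ?_
    rw [Algebra.algebraMap_eq_smul_one]
    filter_upwards [AEEqFun.coeFn_smul c (1 : MeasFun),
      AEEqFun.coeFn_one (μ := torusMeasure) (α := Torus) (β := ℂ)] with w h1 h2
    rw [h1, Pi.smul_apply, h2]
    simp

/-- The metric `d₀(f, g) = ‖f - g‖₀` on `L⁰`. -/
instance L0MetricSpace : MetricSpace L0 :=
  letI : EMetricSpace L0 :=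
    { edist := fun f g => logNorm ((f - g : L0) : MeasFun)
      edist_self := fun f => by
        have h : ((f - f : L0) : MeasFun) =ᵐ[torusMeasure] (0 : Torus → ℂ) := by
          rw [sub_self]; exact AEEqFun.coeFn_zero
        rw [logNorm_congr h]
        simp [logNorm]
      edist_comm := fun f g => by
        refine lintegral_congr_ae ?_
        have h : ((f - g : L0) : MeasFun) = -((g - f : L0) : MeasFun) := by
          push_cast; ring
        rw [h]
        filter_upwards [AEEqFun.coeFn_neg ((g - f : L0) : MeasFun)] with w hw
        rw [hw, Pi.neg_apply, norm_neg]
      edist_triangle := fun f g h => by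
        refine logNorm_le_add (AEEqFun.aestronglyMeasurable _) ?_
        have e : ((f - h : L0) : MeasFun) = ((f - g : L0) : MeasFun) + ((g - h : L0) : MeasFun) := by
          push_cast; ring
        rw [e]
        filter_upwards [AEEqFun.coeFn_add ((f - g : L0) : MeasFun) ((g - h : L0) : MeasFun)]
          with w hw
        rw [hw]
        exact log_one_add_norm_add_le _ _
      eq_of_edist_eq_zero := fun {f g} h => by
        have hm : AEMeasurable ((f - g : L0) : MeasFun) torusMeasure :=
          (AEEqFun.aestronglyMeasurable _).aemeasurable
        have h0 := (lintegral_eq_zero_iff' (measurable_log_one_add_norm.comp_aemeasurable hm)).1 h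
        have h1 : ((f - g : L0) : MeasFun) = 0 := by
          refine AEEqFun.ext ?_
          filter_upwards [h0, AEEqFun.coeFn_zero (μ := torusMeasure) (α := Torus) (β := ℂ)]
            with w hw hz
          rw [hz]
          have h2 : Real.log (1 + ‖((f - g : L0) : MeasFun) w‖) ≤ 0 := by
            simpa using hw
          have h3 := (Real.log_nonpos_iff (by positivity)).1 h2
          exact norm_le_zero_iff.1 (by linarith)
        exact sub_eq_zero.1 (Subtype.ext h1) }
  EMetricSpace.toMetricSpace fun f g => (f - g : L0).2.ne

lemma L0_edist_eq (f g : L0) : edist f g = logNorm ((f - g : L0) : MeasFun) := rfl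

/-! ### Polynomials and the Smirnov class of the torus -/

lemma continuous_polyFun (q : MvPolynomial ℕ ℂ) :
    Continuous (fun w : Torus => MvPolynomial.eval (fun n => (w n : ℂ)) q) :=
  (MvPolynomial.continuous_eval q).comp (by fun_prop)

/-- An analytic polynomial in finitely many of the variables `ζ₁, ζ₂, …`, as an element of `L⁰`
of the torus. -/
def polyTorus (q : MvPolynomial ℕ ℂ) : L0 :=
  ⟨AEEqFun.mk (fun w : Torus => MvPolynomial.eval (fun n => (w n : ℂ)) q)
      (continuous_polyFun q).aestronglyMeasurable, by
    obtain ⟨C, hC⟩ := isCompact_univ.exists_bound_of_continuousOn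
      (continuous_polyFun q).continuousOn
    refine logNorm_lt_top_of_bound (C := C) ?_
    filter_upwards [AEEqFun.coeFn_mk _ (continuous_polyFun q).aestronglyMeasurable] with w hw
    rw [hw]
    exact hC w (mem_univ w)⟩

/-- The Smirnov class of the infinite torus: the closure of the polynomials in `L⁰`. -/
def smirnovTorus : Set L0 := closure (range polyTorus)

/-! ### Holomorphic functions on `ℓ¹ ∩ 𝔻^∞` -/

/-- The Banach space `ℓ¹` of summable complex sequences. -/
abbrev Ell1 : Type := lp (fun _ : ℕ => ℂ) 1

/-- The domain `ℓ¹ ∩ 𝔻^∞` of `ℓ¹`. -/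
def polydisc : Set Ell1 := {ζ | ∀ n, ‖ζ n‖ < 1}

/-- Holomorphy of a function on a subset `V` (an open one, in the applications) of a complex
normed space: the function is locally bounded, and holomorphic along complex lines.
`Function.extend Subtype.val F 0` is the function that equals `F` on `V` and `0` off `V`; only
its values on `V` matter. -/
def IsHolomorphic {E : Type*} [NormedAddCommGroup E] [NormedSpace ℂ E] {V : Set E}
    (F : V → ℂ) : Prop :=
  (∀ x : V, ∃ U ∈ 𝓝 x, ∃ C : ℝ, ∀ y ∈ U, ‖F y‖ ≤ C) ∧
  ∀ (x₀ : V) (x : E),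
    DifferentiableOn ℂ (fun z : ℂ => Function.extend Subtype.val F 0 ((x₀ : E) + z • x))
      {z : ℂ | (x₀ : E) + z • x ∈ V}

lemma norm_radial (r : Ioo (0 : ℝ) 1) (w : Torus) (n : ℕ) :
    ‖((r : ℝ) : ℂ) ^ (n + 1) * (w n : ℂ)‖ = (r : ℝ) ^ (n + 1) := by
  rw [norm_mul, norm_pow, Complex.norm_real, Real.norm_of_nonneg r.2.1.le, Circle.norm_coe,
    mul_one]

/-- The point `(r w₁, r² w₂, …, rⁿ wₙ, …)` of `ℓ¹ ∩ 𝔻^∞`. -/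
def radialPoint (r : Ioo (0 : ℝ) 1) (w : Torus) : polydisc :=
  ⟨⟨fun n => ((r : ℝ) : ℂ) ^ (n + 1) * (w n : ℂ), by
      refine memℓp_gen ?_
      simp only [norm_radial, ENNReal.toReal_one, Real.rpow_one]
      exact (summable_nat_add_iff 1).2 (summable_geometric_of_lt_one r.2.1.le r.2.2)⟩, by
    intro n
    change ‖((r : ℝ) : ℂ) ^ (n + 1) * (w n : ℂ)‖ < 1
    rw [norm_radial]
    exact pow_lt_one₀ r.2.1.le r.2.2 (Nat.succ_ne_zero n)⟩

/-- The function `F_[r](w) = F(r w₁, r² w₂, …, rⁿ wₙ, …)` on the torus. -/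
def dilate (F : polydisc → ℂ) (r : Ioo (0 : ℝ) 1) (w : Torus) : ℂ := F (radialPoint r w)

/-- The Nevanlinna class of `ℓ¹ ∩ 𝔻^∞`: the holomorphic functions `F` with
`sup_{0<r<1} ∫ log⁺ |F_[r]| < ∞`. -/
def nevanlinnaDisc : Set (polydisc → ℂ) :=
  {F | IsHolomorphic F ∧
    (⨆ r : Ioo (0 : ℝ) 1, ∫⁻ w, ENNReal.ofReal (Real.posLog ‖dilate F r w‖) ∂torusMeasure) < ∞}

/-- The Smirnov class of `ℓ¹ ∩ 𝔻^∞`: the functions of the Nevanlinna class for which the family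
`log⁺ |F_[r]|`, `0 < r < 1`, is uniformly integrable. -/
def smirnovDisc : Set (polydisc → ℂ) :=
  {F | F ∈ nevanlinnaDisc ∧
    UniformIntegrable (fun (r : Ioo (0 : ℝ) 1) (w : Torus) => Real.posLog ‖dilate F r w‖) 1
      torusMeasure}

/-- `‖F‖₀ = sup_{0<r<1} ∫ log (1 + |F_[r]|)`, with values in `[0, ∞]`. -/
def discNorm (F : polydisc → ℂ) : ℝ≥0∞ := ⨆ r : Ioo (0 : ℝ) 1, logNorm (dilate F r)

/-- `f` is the boundary value `F^*` of `F`: for almost every `w` the limit of `F_[r](w)`, as `r`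
tends to `1` in `(0, 1)`, exists and is `f(w)`. -/
def IsBoundaryValue (F : polydisc → ℂ) (f : Torus → ℂ) : Prop :=
  ∀ᵐ w ∂torusMeasure, Tendsto (fun r : Ioo (0 : ℝ) 1 => dilate F r w)
    (comap (fun r : Ioo (0 : ℝ) 1 => (r : ℝ)) (𝓝 1)) (𝓝 (f w))

/-! ### Point evaluations -/

/-- The value `q(ζ)` of a polynomial at a point of `ℓ¹ ∩ 𝔻^∞`. -/
def polyEval (ζ : polydisc) (q : MvPolynomial ℕ ℂ) : ℂ :=
  MvPolynomial.eval (fun n => (ζ : Ell1) n) q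

/-- The extension by continuity `E_ζ` of the point evaluation `q ↦ q(ζ)`: its value at `f` is the
limit of `q(ζ)` as the polynomial `q` tends to `f` in `L⁰`. -/
def pointEval (ζ : polydisc) (f : L0) : ℂ := limUnder (comap polyTorus (𝓝 f)) (polyEval ζ)

/-- The function `f̃(ζ) = E_ζ f` on `ℓ¹ ∩ 𝔻^∞`. -/
def tilde (f : L0) : polydisc → ℂ := fun ζ => pointEval ζ f

end

end SmirnovClass

open SmirnovClass

/-!
# Fatou's theorem for the Smirnov class in infinitely many variables

The circle acts on the torus by `w ↦ (u w₁, u² w₂, …)` (`weighted`), and the dilation `F_[r]` of a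
polynomial `F` is its Poisson integral at `r` along the orbits of this action. Each orbit carries the
function `z ↦ F (z w₁, z² w₂, …)` of one variable; the one-variable theory is applied on the orbits
and integrated over the torus, whose measure is invariant under the action (`lintegral_rotation`).

*From the torus to the disc.* As `log (1 + |q|)` is subharmonic in each variable, `log (1 + |q(ζ)|)`
is at most `‖q‖₀` times the product of the Harnack constants `(1 + |ζₙ|) / (1 - |ζₙ|)`, which
converges and is locally bounded since `ζ ∈ ℓ¹` (`exists_logSize_le`). So the point evaluations
extend continuously to the closure of the polynomials, and `f̃` is a locally uniform limit of
polynomials (`isHolomorphic_tilde`). Subharmonicity on the orbits gives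
`‖(f̃)_[r]‖₀ ≤ ‖f‖₀` (`logNorm_dilate_tilde_le`), whence the uniform integrability of
`log⁺ |(f̃)_[r]|`. For the boundary values, `log (1 + |f̃ - q|)` is dominated on almost every orbit by
the Poisson integral of `log (1 + |f - q|)`, and Poisson integrals of integrable functions have
radial limits almost everywhere (`ae_tendsto_integral_poisson`); letting the polynomial `q` tend to
`f` yields `isBoundaryValue_tilde`. Fatou's lemma then gives the isometry `discNorm_tilde`.

*From the disc to the torus.* For holomorphic `F` the dilations `F_[r]` extend to functions that are
continuous on the compact polydisc and holomorphic in each variable (`IsDiscAlgebra`). Their Fourier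
coefficients vanish at the exponents with a negative coordinate, so they are `L²` limits of analytic
polynomials and belong to the Smirnov class of the torus (`IsDiscAlgebra.toL0_mem`). It remains to
see that the dilations of a function of the Smirnov class converge in `L⁰` as `r → 1`. The key is an
energy inequality on the sphere (`integral_poisson_stereo_le`): the variance under the Poisson
kernel of the stereographic image of a holomorphic function is at most the defect of
subharmonicity of `log (1 + |F|²)`. Integrated over the torus, it bounds the `L²` distance of the
stereographic images of `F_[r]` and `F_[ρ]` by the difference of the energies
`∫ log (1 + |F_[ρ]|²)` and `∫ log (1 + |F_[r]|²)`
(`IsHolomorphic.lintegral_sphDistSq_add_le`). The energies are bounded and increasing, so a sequence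
of dilations converges almost everywhere on the sphere, the limit is almost nowhere infinite by
Fatou's lemma, and Vitali's theorem turns this into convergence in `L⁰`
(`exists_seq_tendsto_toL0`). The limit `f` satisfies `f̃ = F`, which gives surjectivity.
-/

namespace SmirnovClass

noncomputable section

/-! ### Rotation invariance of the measures -/

instance fact_two_pi_pos : Fact (0 < 2 * Real.pi) := ⟨Real.two_pi_pos⟩

lemma circleMeasure_eq_map :
    circleMeasure = (ENNReal.ofReal (2 * Real.pi))⁻¹ •
      (volume : Measure (AddCircle (2 * Real.pi))).map AddCircle.homeomorphCircle' := by
  have h := (AddCircle.measurePreserving_mk (2 * Real.pi) 0).map_eq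
  rw [zero_add] at h
  rw [circleMeasure, ← h, Measure.map_map AddCircle.homeomorphCircle'.continuous.measurable
    (AddCircle.measurable_mk')]
  rfl

lemma measurePreserving_circle_mul (u : Circle) :
    MeasurePreserving (fun v => u * v) circleMeasure circleMeasure := by
  refine ⟨(continuous_const_mul u).measurable, ?_⟩
  obtain ⟨a, rfl⟩ := AddCircle.homeomorphCircle'.surjective u
  have hm : Measurable AddCircle.homeomorphCircle' :=
    AddCircle.homeomorphCircle'.continuous.measurable
  have hc : (fun v => AddCircle.homeomorphCircle' a * v) ∘ AddCircle.homeomorphCircle' =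
      AddCircle.homeomorphCircle' ∘ (fun x => a + x) := by
    funext x
    exact (Real.Angle.toCircle_add a x).symm
  rw [circleMeasure_eq_map, Measure.map_smul,
    Measure.map_map (continuous_const_mul _).measurable hm, hc,
    ← Measure.map_map hm (measurable_const_add a), (measurePreserving_add_left volume a).map_eq]

lemma measurePreserving_torus_mul (u : Torus) :
    MeasurePreserving (fun w => u * w) torusMeasure torusMeasure := by
  refine ⟨(continuous_const_mul u).measurable, ?_⟩
  have h := Measure.infinitePi_map_pi (μ := fun _ : ℕ => circleMeasure)
    (f := fun n v => u n * v) (fun n => (continuous_const_mul (u n)).measurable)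
  simp only [(measurePreserving_circle_mul _).map_eq] at h
  exact h

/-- Integrals against arc length are circle averages. -/
lemma integral_circleMeasure {E : Type*} [NormedAddCommGroup E] [NormedSpace ℝ E] (f : ℂ → E)
    (hf : Continuous fun u : Circle => f u) :
    ∫ u : Circle, f u ∂circleMeasure = Real.circleAverage f 0 1 := by
  have hm : Measurable (fun θ : ℝ => Circle.exp θ) := Circle.exp.continuous.measurable
  rw [circleMeasure, integral_smul_measure, integral_map hm.aemeasurable
    hf.aestronglyMeasurable, Real.circleAverage_def,
    intervalIntegral.integral_of_le Real.two_pi_pos.le]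
  congr 1
  · rw [ENNReal.toReal_inv, ENNReal.toReal_ofReal Real.two_pi_pos.le]
  · simp [circleMap, Circle.coe_exp]

/-- Averaging over a family of rotations `γ v`, against a kernel `k`, multiplies integrals over the
torus by the mass of `k`. -/
lemma lintegral_rotation {γ : Circle → Torus} (hγ : Measurable γ) {k : Circle → ℝ≥0∞}
    (hk : Measurable k) {f : Torus → ℝ≥0∞} (hf : Measurable f) :
    ∫⁻ w, ∫⁻ v, k v * f (γ v * w) ∂circleMeasure ∂torusMeasure =
      (∫⁻ v, k v ∂circleMeasure) * ∫⁻ w, f w ∂torusMeasure := by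
  have hm : Measurable (fun p : Torus × Circle => k p.2 * f (γ p.2 * p.1)) :=
    (hk.comp measurable_snd).mul (hf.comp ((hγ.comp measurable_snd).mul measurable_fst))
  rw [lintegral_lintegral_swap hm.aemeasurable, ← lintegral_mul_const _ hk]
  refine lintegral_congr fun v => ?_
  rw [lintegral_const_mul (k v) (show Measurable fun w => f (γ v * w) from
      hf.comp (measurable_const_mul (γ v))),
    (measurePreserving_torus_mul (γ v)).lintegral_comp hf]

/-- The weighted rotation `v ↦ (v, v², v³, …)`. -/
def weighted (v : Circle) : Torus := fun n => v ^ (n + 1)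

lemma continuous_weighted : Continuous weighted := by
  unfold weighted; fun_prop

lemma weighted_mul (u v : Circle) : weighted (u * v) = weighted u * weighted v := by
  funext n; simp [weighted, mul_pow]

lemma weighted_inv (u : Circle) : weighted u⁻¹ = (weighted u)⁻¹ := by
  funext n; simp [weighted, inv_pow]

/-- The arc length measure is invariant under the inversion `u ↦ u⁻¹`. -/
lemma measurePreserving_circle_inv :
    MeasurePreserving (fun v : Circle => v⁻¹) circleMeasure circleMeasure := by
  refine ⟨continuous_inv.measurable, ?_⟩
  have hm : Measurable AddCircle.homeomorphCircle' :=
    AddCircle.homeomorphCircle'.continuous.measurable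
  have hc : (fun v : Circle => v⁻¹) ∘ AddCircle.homeomorphCircle' =
      AddCircle.homeomorphCircle' ∘ (fun x => -x) := by
    funext x
    exact (Real.Angle.toCircle_neg x).symm
  rw [circleMeasure_eq_map, Measure.map_smul, Measure.map_map continuous_inv.measurable hm, hc,
    ← Measure.map_map hm measurable_neg, (Measure.measurePreserving_neg volume).map_eq]

/-! ### Characters of the infinite torus -/

/-- The character `w ↦ ∏ wₙ ^ αₙ` of the torus, for a finitely supported `α`. -/
def torusChar (α : ℕ →₀ ℤ) (w : Torus) : Circle := α.prod fun n k => w n ^ k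

lemma torusChar_zero (w : Torus) : torusChar 0 w = 1 := Finsupp.prod_zero_index

lemma torusChar_add (α β : ℕ →₀ ℤ) (w : Torus) :
    torusChar (α + β) w = torusChar α w * torusChar β w :=
  Finsupp.prod_add_index' (fun _ => zpow_zero _) (fun _ _ _ => zpow_add _ _ _)

lemma torusChar_neg (α : ℕ →₀ ℤ) (w : Torus) : torusChar (-α) w = (torusChar α w)⁻¹ := by
  rw [eq_inv_iff_mul_eq_one, ← torusChar_add, neg_add_cancel, torusChar_zero]

lemma torusChar_mul (α : ℕ →₀ ℤ) (u w : Torus) :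
    torusChar α (u * w) = torusChar α u * torusChar α w := by
  simp only [torusChar, Pi.mul_apply, mul_zpow, Finsupp.prod_mul]

lemma torusChar_single (n : ℕ) (k : ℤ) (w : Torus) :
    torusChar (Finsupp.single n k) w = w n ^ k :=
  Finsupp.prod_single_index (zpow_zero _)

lemma torusChar_mulSingle (α : ℕ →₀ ℤ) (n : ℕ) (v : Circle) :
    torusChar α (Pi.mulSingle n v) = v ^ α n := by
  unfold torusChar Finsupp.prod
  rw [Finset.prod_eq_single n]
  · simp
  · intro m _ hm
    simp [Pi.mulSingle_eq_of_ne hm]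
  · intro h
    simp [Finsupp.notMem_support_iff.1 h]

lemma continuous_torusChar (α : ℕ →₀ ℤ) : Continuous (torusChar α) := by
  unfold torusChar Finsupp.prod
  exact continuous_finsetProd _ fun n _ => (continuous_apply n).zpow _

/-- The character of exponent `α` as a complex continuous function. -/
def torusCharC (α : ℕ →₀ ℤ) : C(Torus, ℂ) :=
  ⟨fun w => (torusChar α w : ℂ), continuous_subtype_val.comp (continuous_torusChar α)⟩

lemma torusCharC_apply (α : ℕ →₀ ℤ) (w : Torus) : torusCharC α w = (torusChar α w : ℂ) := rfl

/-- The star subalgebra generated by the characters. -/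
def torusCharAlgebra : StarSubalgebra ℂ C(Torus, ℂ) where
  toSubalgebra := Algebra.adjoin ℂ (range torusCharC)
  star_mem' := by
    change Algebra.adjoin ℂ (range torusCharC) ≤ star (Algebra.adjoin ℂ (range torusCharC))
    refine Algebra.adjoin_le ?_
    rintro _ ⟨α, rfl⟩
    refine Algebra.subset_adjoin ⟨-α, ?_⟩
    ext w
    simp only [torusCharC_apply, torusChar_neg, Circle.coe_inv_eq_conj, ContinuousMap.star_apply]
    rfl

lemma torusCharAlgebra_coe :
    Subalgebra.toSubmodule torusCharAlgebra.toSubalgebra = Submodule.span ℂ (range torusCharC) := by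
  apply Algebra.adjoin_eq_span_of_subset
  refine .trans (fun x => Submonoid.closure_induction (fun _ => id) ⟨0, ?_⟩ ?_)
    Submodule.subset_span
  · ext w
    simp [torusCharC_apply, torusChar_zero]
  · rintro _ _ _ _ ⟨α, rfl⟩ ⟨β, rfl⟩
    refine ⟨α + β, ?_⟩
    ext w
    simp [torusCharC_apply, torusChar_add]

lemma span_torusCharC_closure_eq_top :
    (Submodule.span ℂ (range torusCharC)).topologicalClosure = ⊤ := by
  rw [← torusCharAlgebra_coe]
  refine congr_arg (Subalgebra.toSubmodule <| StarSubalgebra.toSubalgebra ·)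
    (ContinuousMap.starSubalgebra_topologicalClosure_eq_top_of_separatesPoints torusCharAlgebra ?_)
  intro x y hxy
  obtain ⟨n, hn⟩ := Function.ne_iff.1 hxy
  refine ⟨_, ⟨torusCharC (Finsupp.single n 1),
    Algebra.subset_adjoin ⟨Finsupp.single n 1, rfl⟩, rfl⟩, ?_⟩
  simp only [torusCharC_apply, torusChar_single, zpow_one]
  exact fun h => hn (Circle.ext h)

/-! ### The Poisson kernel and holomorphic functions on the disc -/

/-- Real continuous functions on the circle are uniform limits of real parts of analytic
polynomials. -/
lemma exists_polynomial_re_close {v : Circle → ℝ} (hv : Continuous v) {ε : ℝ} (hε : 0 < ε) :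
    ∃ Q : Polynomial ℂ, ∀ u : Circle, |v u - (Q.eval (u : ℂ)).re| ≤ ε := by
  let f : C(Torus, ℂ) := ⟨fun w => (v (w 0) : ℂ), by fun_prop⟩
  have hf : f ∈ closure (Submodule.span ℂ (range torusCharC) : Set C(Torus, ℂ)) := by
    rw [← Submodule.topologicalClosure_coe, span_torusCharC_closure_eq_top]
    trivial
  obtain ⟨g, hg, hfg⟩ := Metric.mem_closure_iff.1 hf ε hε
  -- the real part of a multiple of a character of the circle is the real part of a polynomial
  have key : ∀ c : ℂ, ∃ Q : Polynomial ℂ, ∀ u : Circle,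
      (c * g (Pi.mulSingle 0 u)).re = (Q.eval (u : ℂ)).re := by
    clear hfg
    induction hg using Submodule.span_induction with
    | mem x hx =>
      obtain ⟨α, rfl⟩ := hx
      intro c
      rcases Int.eq_nat_or_neg (α 0) with ⟨k, hk | hk⟩
      · refine ⟨Polynomial.C c * Polynomial.X ^ k, fun u => ?_⟩
        simp [torusCharC_apply, torusChar_mulSingle, hk]
      · refine ⟨Polynomial.C (star c) * Polynomial.X ^ k, fun u => ?_⟩
        rw [torusCharC_apply, torusChar_mulSingle, hk, ← Complex.conj_re]
        simp [← Circle.coe_inv_eq_conj]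
    | zero => exact fun c => ⟨0, by simp⟩
    | add x y _ _ hx hy =>
      intro c
      obtain ⟨Q, hQ⟩ := hx c
      obtain ⟨R, hR⟩ := hy c
      refine ⟨Q + R, fun u => ?_⟩
      rw [ContinuousMap.add_apply, mul_add, Complex.add_re, hQ, hR, Polynomial.eval_add,
        Complex.add_re]
    | smul a x _ hx =>
      intro c
      obtain ⟨Q, hQ⟩ := hx (c * a)
      refine ⟨Q, fun u => ?_⟩
      rw [← hQ, ContinuousMap.smul_apply, smul_eq_mul, mul_assoc]
  obtain ⟨Q, hQ⟩ := key 1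
  refine ⟨Q, fun u => ?_⟩
  rw [← hQ u, one_mul]
  have h1 := (ContinuousMap.dist_lt_iff hε).1 hfg (Pi.mulSingle 0 u)
  have h2 : f (Pi.mulSingle 0 u) = (v u : ℂ) := by simp [f]
  rw [h2, Complex.dist_eq] at h1
  have h3 := Complex.abs_re_le_norm ((v u : ℂ) - g (Pi.mulSingle 0 u))
  rw [Complex.sub_re, Complex.ofReal_re] at h3
  linarith

/-- The Poisson kernel of the unit disc. -/
def poisson (z : ℂ) (u : Circle) : ℝ := poissonKernel 0 z u

lemma poisson_eq (z : ℂ) (u : Circle) : poisson z u = (1 - ‖z‖ ^ 2) / ‖(u : ℂ) - z‖ ^ 2 := by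
  simp [poisson, poissonKernel, Circle.norm_coe]

lemma coe_sub_ne_zero {z : ℂ} (hz : ‖z‖ < 1) (u : Circle) : (u : ℂ) - z ≠ 0 := by
  intro h
  rw [← sub_eq_zero.1 h, Circle.norm_coe] at hz
  exact lt_irrefl _ hz

lemma continuous_poisson {z : ℂ} (hz : ‖z‖ < 1) : Continuous (poisson z) := by
  have h : poisson z = fun u : Circle => (1 - ‖z‖ ^ 2) / ‖(u : ℂ) - z‖ ^ 2 :=
    funext (poisson_eq z)
  rw [h]
  refine continuous_const.div (by fun_prop) fun u => ?_
  exact pow_ne_zero _ (norm_ne_zero_iff.2 (coe_sub_ne_zero hz u))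

lemma poisson_nonneg {z : ℂ} (hz : ‖z‖ < 1) (u : Circle) : 0 ≤ poisson z u := by
  rw [poisson_eq]
  have : ‖z‖ ^ 2 ≤ 1 := pow_le_one₀ (norm_nonneg _) hz.le
  exact div_nonneg (by linarith) (by positivity)

lemma poisson_le {z : ℂ} (hz : ‖z‖ < 1) (u : Circle) :
    poisson z u ≤ (1 + ‖z‖) / (1 - ‖z‖) := by
  have h := re_herglotzRieszKernel_le (R := 1) (c := 0) (w := z) (z := (u : ℂ))
    (by simp [Circle.norm_coe]) (by simpa using hz)
  rw [poisson, poissonKernel_eq_re_herglotzRieszKernel]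
  simpa [herglotzRieszKernel_def] using h

/-- The Poisson integral formula in terms of `circleMeasure`. -/
lemma integral_poisson_smul {g : ℂ → ℂ} (hg : DiffContOnCl ℂ g (Metric.ball 0 1)) {z : ℂ}
    (hz : ‖z‖ < 1) : ∫ u : Circle, (poisson z u : ℂ) * g u ∂circleMeasure = g z := by
  have hgc : Continuous fun u : Circle => g u := by
    refine hg.continuousOn_ball.comp_continuous (by fun_prop) fun u => by simp [Circle.norm_coe]
  have h := hg.circleAverage_poissonKernel_smul (w := z) (by simpa using hz)
  rw [← h, ← integral_circleMeasure]
  · rfl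
  · exact (Complex.continuous_ofReal.comp (continuous_poisson hz)).mul hgc

lemma integral_poisson {z : ℂ} (hz : ‖z‖ < 1) : ∫ u, poisson z u ∂circleMeasure = 1 := by
  have h := integral_poisson_smul (g := fun _ => 1) diffContOnCl_const hz
  simp only [mul_one] at h
  rw [integral_complex_ofReal] at h
  exact_mod_cast h

lemma integrable_circle {f : Circle → ℝ} (hf : Continuous f) : Integrable f circleMeasure :=
  hf.integrable_of_hasCompactSupport (HasCompactSupport.of_compactSpace f)

lemma lintegral_poisson {z : ℂ} (hz : ‖z‖ < 1) :
    ∫⁻ u, ENNReal.ofReal (poisson z u) ∂circleMeasure = 1 := by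
  rw [← ofReal_integral_eq_lintegral_ofReal (integrable_circle (continuous_poisson hz))
    (ae_of_all _ (poisson_nonneg hz)), integral_poisson hz, ENNReal.ofReal_one]

/-- **Subharmonicity of `log |g|`**, stated with a continuous majorant `v` of `log |g|` on the
circle so that zeros of `g` need no care: approximate `v` by real parts of polynomials `Q` and apply
the maximum principle to `g * exp (-Q)`. -/
lemma norm_le_exp_poisson {g : ℂ → ℂ} (hg : DiffContOnCl ℂ g (Metric.ball 0 1)) {v : Circle → ℝ}
    (hv : Continuous v) (hgv : ∀ u : Circle, ‖g u‖ ≤ Real.exp (v u)) {z : ℂ} (hz : ‖z‖ < 1) :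
    ‖g z‖ ≤ Real.exp (∫ u, poisson z u * v u ∂circleMeasure) := by
  have main : ∀ ε : ℝ, 0 < ε →
      ‖g z‖ ≤ Real.exp (∫ u, poisson z u * v u ∂circleMeasure + 2 * ε) := by
    intro ε hε
    obtain ⟨Q, hQ⟩ := exists_polynomial_re_close hv hε
    have hQd : DiffContOnCl ℂ (fun x => Q.eval x) (Metric.ball 0 1) :=
      Q.differentiable.diffContOnCl
    have hE : DiffContOnCl ℂ (fun x => Complex.exp (-Q.eval x)) (Metric.ball 0 1) :=
      (Q.differentiable.neg.cexp).diffContOnCl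
    have hmax : ‖g z * Complex.exp (-Q.eval z)‖ ≤ Real.exp ε := by
      refine Complex.norm_le_of_forall_mem_frontier_norm_le (f := fun x => g x * Complex.exp (-Q.eval x))
        Metric.isBounded_ball (hg.smul hE) ?_ (subset_closure (by simpa using hz))
      intro x hx
      rw [frontier_ball 0 one_ne_zero, mem_sphere_zero_iff_norm] at hx
      obtain ⟨u, rfl⟩ : ∃ u : Circle, (u : ℂ) = x := ⟨⟨x, mem_sphere_zero_iff_norm.2 hx⟩, rfl⟩
      have h1 := hgv u
      have h2 := (abs_le.1 (hQ u)).2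
      rw [norm_mul, Complex.norm_exp, Complex.neg_re]
      calc _ ≤ Real.exp (v u) * Real.exp (-(Q.eval (u : ℂ)).re) := by gcongr
        _ = Real.exp (v u - (Q.eval (u : ℂ)).re) := by
            rw [← Real.exp_add, sub_eq_add_neg]
        _ ≤ Real.exp ε := Real.exp_le_exp.2 h2
    have hre : (Q.eval z).re = ∫ u : Circle, poisson z u * (Q.eval (u : ℂ)).re ∂circleMeasure := by
      rw [← integral_poisson_smul hQd hz]
      have hi : Integrable (fun u : Circle => (poisson z u : ℂ) * Q.eval (u : ℂ)) circleMeasure := by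
        refine Continuous.integrable_of_hasCompactSupport ?_ (HasCompactSupport.of_compactSpace _)
        exact (Complex.continuous_ofReal.comp (continuous_poisson hz)).mul
          (Q.continuous.comp continuous_subtype_val)
      refine (integral_re hi).symm.trans (integral_congr_ae (ae_of_all _ fun u => ?_))
      simp
    have hle : (Q.eval z).re ≤ ∫ u, poisson z u * v u ∂circleMeasure + ε := by
      have h1 : ∫ u, poisson z u * v u ∂circleMeasure + ε =
          ∫ u, poisson z u * (v u + ε) ∂circleMeasure := by
        have i1 : Integrable (fun u => poisson z u * v u) circleMeasure :=
          integrable_circle ((continuous_poisson hz).mul hv)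
        have i2 : Integrable (fun u => poisson z u * ε) circleMeasure :=
          integrable_circle ((continuous_poisson hz).mul continuous_const)
        simp only [mul_add]
        rw [integral_add i1 i2, integral_mul_const, integral_poisson hz, one_mul]
      rw [h1, hre]
      refine integral_mono (integrable_circle ((continuous_poisson hz).mul ?_))
        (integrable_circle ((continuous_poisson hz).mul (hv.add continuous_const))) fun u => ?_
      · exact Complex.continuous_re.comp (Q.continuous.comp continuous_subtype_val)
      · have := (abs_le.1 (hQ u)).1
        exact mul_le_mul_of_nonneg_left (by linarith) (poisson_nonneg hz u)
    rw [norm_mul, Complex.norm_exp, Complex.neg_re] at hmax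
    calc ‖g z‖ = ‖g z‖ * Real.exp (-(Q.eval z).re) * Real.exp (Q.eval z).re := by
          rw [mul_assoc, ← Real.exp_add, neg_add_cancel, Real.exp_zero, mul_one]
      _ ≤ Real.exp ε * Real.exp (∫ u, poisson z u * v u ∂circleMeasure + ε) := by gcongr
      _ = _ := by rw [← Real.exp_add]; ring_nf
  have hc : Tendsto (fun ε : ℝ => Real.exp (∫ u, poisson z u * v u ∂circleMeasure + 2 * ε))
      (𝓝[>] 0) (𝓝 (Real.exp (∫ u, poisson z u * v u ∂circleMeasure + 2 * 0))) := by
    refine Tendsto.mono_left (Continuous.tendsto (by fun_prop) 0) nhdsWithin_le_nhds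
  rw [mul_zero, add_zero] at hc
  exact ge_of_tendsto hc (eventually_nhdsWithin_of_forall main)

/-! ### The integrand `log (1 + |x|)` -/

/-- The integrand `log (1 + |x|)` of `logNorm`, with values in `[0, ∞]`. -/
def logSize (x : ℂ) : ℝ≥0∞ := ENNReal.ofReal (Real.log (1 + ‖x‖))

lemma logNorm_eq_lintegral (f : Torus → ℂ) : logNorm f = ∫⁻ w, logSize (f w) ∂torusMeasure := rfl

lemma continuous_log_one_add_norm : Continuous fun x : ℂ => Real.log (1 + ‖x‖) :=
  (by fun_prop : Continuous fun x : ℂ => 1 + ‖x‖).log fun x => by positivity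

lemma continuous_logSize : Continuous logSize :=
  ENNReal.continuous_ofReal.comp continuous_log_one_add_norm

lemma measurable_logSize : Measurable logSize := continuous_logSize.measurable

@[simp] lemma logSize_zero : logSize 0 = 0 := by simp [logSize]

@[simp] lemma logSize_neg (x : ℂ) : logSize (-x) = logSize x := by simp [logSize]

lemma logSize_add_le (x y : ℂ) : logSize (x + y) ≤ logSize x + logSize y := by
  unfold logSize
  rw [← ENNReal.ofReal_add (log_one_add_norm_nonneg _) (log_one_add_norm_nonneg _)]
  exact ENNReal.ofReal_le_ofReal (log_one_add_norm_add_le x y)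

lemma logSize_mul_le (x y : ℂ) : logSize (x * y) ≤ logSize x + logSize y := by
  unfold logSize
  rw [← ENNReal.ofReal_add (log_one_add_norm_nonneg _) (log_one_add_norm_nonneg _)]
  exact ENNReal.ofReal_le_ofReal (log_one_add_norm_mul_le x y)

lemma logSize_ne_top (x : ℂ) : logSize x ≠ ∞ := ENNReal.ofReal_ne_top

lemma logSize_le_norm (x : ℂ) : logSize x ≤ ENNReal.ofReal ‖x‖ := by
  refine ENNReal.ofReal_le_ofReal ?_
  have := Real.log_le_sub_one_of_pos (show 0 < 1 + ‖x‖ by positivity)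
  linarith

lemma logSize_sub_comm (x y : ℂ) : logSize (x - y) = logSize (y - x) := by
  rw [← logSize_neg, neg_sub]

lemma tendsto_zero_of_logSize {ι : Type*} {l : Filter ι} {f : ι → ℂ}
    (h : Tendsto (fun i => logSize (f i)) l (𝓝 0)) : Tendsto f l (𝓝 0) := by
  rw [tendsto_zero_iff_norm_tendsto_zero]
  have h1 := (ENNReal.tendsto_toReal ENNReal.zero_ne_top).comp h
  have h2 := (Real.continuous_exp.tendsto _).comp h1
  simp only [ENNReal.toReal_zero, Real.exp_zero] at h2
  have h3 := h2.sub_const 1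
  rw [sub_self] at h3
  refine h3.congr fun i => ?_
  simp only [Function.comp_apply, logSize]
  rw [ENNReal.toReal_ofReal (log_one_add_norm_nonneg _), Real.exp_log (by positivity)]
  ring

/-- Subharmonicity of `log (1 + |g|)`, from that of `log |1 + c g|` with `|c| = 1`. -/
lemma logSize_le_lintegral_poisson {g : ℂ → ℂ} (hg : DiffContOnCl ℂ g (Metric.ball 0 1)) {z : ℂ}
    (hz : ‖z‖ < 1) :
    logSize (g z) ≤ ∫⁻ u : Circle, ENNReal.ofReal (poisson z u) * logSize (g u) ∂circleMeasure := by
  have hgc : Continuous fun u : Circle => g u :=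
    hg.continuousOn_ball.comp_continuous (by fun_prop) fun u => by simp [Circle.norm_coe]
  have hv : Continuous fun u : Circle => Real.log (1 + ‖g u‖) :=
    continuous_log_one_add_norm.comp hgc
  obtain ⟨c, hc, hcz⟩ : ∃ c : ℂ, ‖c‖ = 1 ∧ c * g z = ‖g z‖ := by
    rcases eq_or_ne (g z) 0 with h | h
    · exact ⟨1, by simp, by simp [h]⟩
    · refine ⟨‖g z‖ / g z, ?_, div_mul_cancel₀ _ h⟩
      rw [norm_div, Complex.norm_real, norm_norm, div_self (norm_ne_zero_iff.2 h)]
  have h1 : DiffContOnCl ℂ (fun x => 1 + c * g x) (Metric.ball 0 1) :=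
    (hg.const_smul c).const_add 1
  have h2 := norm_le_exp_poisson h1 hv (fun u => by
    rw [Real.exp_log (by positivity)]
    refine (norm_add_le _ _).trans ?_
    rw [norm_mul, hc, one_mul, norm_one]) hz
  rw [hcz, ← Complex.ofReal_one, ← Complex.ofReal_add, Complex.norm_real,
    Real.norm_of_nonneg (by positivity), ← Real.log_le_iff_le_exp (by positivity)] at h2
  refine (ENNReal.ofReal_le_ofReal h2).trans ?_
  have hi : Integrable (fun u : Circle => poisson z u * Real.log (1 + ‖g u‖)) circleMeasure :=
    integrable_circle ((continuous_poisson hz).mul hv)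
  rw [ofReal_integral_eq_lintegral_ofReal hi
    (ae_of_all _ fun u => mul_nonneg (poisson_nonneg hz u) (log_one_add_norm_nonneg _))]
  simp only [ENNReal.ofReal_mul (poisson_nonneg hz _)]
  exact le_rfl

/-! ### The energy inequality -/

/-- The stereographic projection of the plane onto the sphere. -/
def stereo (x : ℂ) : ℂ × ℝ := (x / ((1 + ‖x‖ ^ 2 : ℝ) : ℂ), 1 / (1 + ‖x‖ ^ 2))

lemma continuous_stereo : Continuous stereo := by
  unfold stereo
  refine Continuous.prodMk ?_ ?_
  · refine continuous_id.div (by fun_prop) fun x => ?_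
    exact_mod_cast (show (1 + ‖x‖ ^ 2 : ℝ) ≠ 0 by positivity)
  · exact continuous_const.div (by fun_prop) fun x => by positivity

lemma norm_stereo_sub_sq_mul_le (x y : ℂ) :
    ‖stereo x - stereo y‖ ^ 2 * ((1 + ‖x‖ ^ 2) * (1 + ‖y‖ ^ 2)) ≤ ‖x - y‖ ^ 2 := by
  have hx : (0 : ℝ) < 1 + ‖x‖ ^ 2 := by positivity
  have hy : (0 : ℝ) < 1 + ‖y‖ ^ 2 := by positivity
  have hS : 0 < (1 + ‖x‖ ^ 2) * (1 + ‖y‖ ^ 2) := by positivity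
  have hxC : ((1 + ‖x‖ ^ 2 : ℝ) : ℂ) ≠ 0 := by exact_mod_cast hx.ne'
  have hyC : ((1 + ‖y‖ ^ 2 : ℝ) : ℂ) ≠ 0 := by exact_mod_cast hy.ne'
  rcases max_choice ‖(stereo x - stereo y).1‖ ‖(stereo x - stereo y).2‖ with h | h
  · rw [Prod.norm_def, h]
    have e : (stereo x - stereo y).1 =
        ((x - y) - x * y * (starRingEnd ℂ) (x - y)) /
          (((1 + ‖x‖ ^ 2) * (1 + ‖y‖ ^ 2) : ℝ) : ℂ) := by
      have ex : ((1 + ‖x‖ ^ 2 : ℝ) : ℂ) = 1 + x * (starRingEnd ℂ) x := by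
        rw [Complex.mul_conj']; push_cast; rfl
      have ey : ((1 + ‖y‖ ^ 2 : ℝ) : ℂ) = 1 + y * (starRingEnd ℂ) y := by
        rw [Complex.mul_conj']; push_cast; rfl
      simp only [stereo, Prod.fst_sub]
      rw [Complex.ofReal_mul, div_sub_div _ _ hxC hyC, ex, ey, map_sub]
      congr 1
      ring
    rw [e, norm_div, Complex.norm_real, Real.norm_of_nonneg hS.le, div_pow, div_mul_eq_mul_div,
      div_le_iff₀ (by positivity)]
    have h1 : ‖(x - y) - x * y * (starRingEnd ℂ) (x - y)‖ ≤ (1 + ‖x‖ * ‖y‖) * ‖x - y‖ := by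
      refine (norm_sub_le _ _).trans_eq ?_
      rw [norm_mul, norm_mul, Complex.norm_conj]
      ring
    have h2 : (1 + ‖x‖ * ‖y‖) ^ 2 ≤ (1 + ‖x‖ ^ 2) * (1 + ‖y‖ ^ 2) := by
      nlinarith [sq_nonneg (‖x‖ - ‖y‖)]
    calc _ ≤ ((1 + ‖x‖ * ‖y‖) * ‖x - y‖) ^ 2 * ((1 + ‖x‖ ^ 2) * (1 + ‖y‖ ^ 2)) := by gcongr
      _ = ‖x - y‖ ^ 2 * ((1 + ‖x‖ * ‖y‖) ^ 2 * ((1 + ‖x‖ ^ 2) * (1 + ‖y‖ ^ 2))) := by ring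
      _ ≤ ‖x - y‖ ^ 2 * (((1 + ‖x‖ ^ 2) * (1 + ‖y‖ ^ 2)) * ((1 + ‖x‖ ^ 2) * (1 + ‖y‖ ^ 2))) := by
        gcongr
      _ = _ := by ring
  · rw [Prod.norm_def, h]
    have e : (stereo x - stereo y).2 =
        (‖y‖ - ‖x‖) * (‖x‖ + ‖y‖) / ((1 + ‖x‖ ^ 2) * (1 + ‖y‖ ^ 2)) := by
      simp only [stereo, Prod.snd_sub]
      field_simp
      ring
    rw [e, Real.norm_eq_abs, sq_abs, div_pow, div_mul_eq_mul_div, div_le_iff₀ (by positivity)]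
    have h1 : (‖y‖ - ‖x‖) ^ 2 ≤ ‖x - y‖ ^ 2 := by
      rw [← sq_abs, norm_sub_rev]
      gcongr
      exact abs_norm_sub_norm_le y x
    have h2 : (‖x‖ + ‖y‖) ^ 2 ≤ (1 + ‖x‖ ^ 2) * (1 + ‖y‖ ^ 2) := by
      nlinarith [sq_nonneg (1 - ‖x‖ * ‖y‖)]
    calc _ = (‖y‖ - ‖x‖) ^ 2 * ((‖x‖ + ‖y‖) ^ 2 * ((1 + ‖x‖ ^ 2) * (1 + ‖y‖ ^ 2))) := by ring
      _ ≤ ‖x - y‖ ^ 2 * (((1 + ‖x‖ ^ 2) * (1 + ‖y‖ ^ 2)) * ((1 + ‖x‖ ^ 2) * (1 + ‖y‖ ^ 2))) := by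
        gcongr
      _ = _ := by ring

lemma norm_one_add_conj_mul_sq (x y : ℂ) :
    ‖1 + (starRingEnd ℂ) x * y‖ ^ 2 + ‖y - x‖ ^ 2 = (1 + ‖x‖ ^ 2) * (1 + ‖y‖ ^ 2) := by
  simp only [← Complex.normSq_eq_norm_sq, Complex.normSq_apply, Complex.add_re, Complex.add_im,
    Complex.mul_re, Complex.mul_im, Complex.conj_re, Complex.conj_im, Complex.sub_re,
    Complex.sub_im, Complex.one_re, Complex.one_im]
  ring

/-- `log (1 + |x|²)`, the potential of the spherical metric. -/
def sphLog (x : ℂ) : ℝ := Real.log (1 + ‖x‖ ^ 2)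

lemma sphLog_nonneg (x : ℂ) : 0 ≤ sphLog x := Real.log_nonneg (by nlinarith [norm_nonneg x])

lemma continuous_sphLog : Continuous sphLog :=
  (by fun_prop : Continuous fun x : ℂ => 1 + ‖x‖ ^ 2).log fun x => by positivity

/-- The variance of the stereographic image of a holomorphic function `g` under the Poisson kernel
at `z` is controlled by the defect of subharmonicity of `log (1 + |g|²)`. With `x = g z`, this is
the subharmonicity of `log |1 + conj x * g|`, combined with
`|1 + conj x * y|² = (1 + |x|²) (1 + |y|²) - |y - x|²`. -/
lemma integral_poisson_stereo_le {g : ℂ → ℂ} (hg : DiffContOnCl ℂ g (Metric.ball 0 1)) {z : ℂ}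
    (hz : ‖z‖ < 1) :
    ∫ u : Circle, poisson z u * ‖stereo (g u) - stereo (g z)‖ ^ 2 ∂circleMeasure + sphLog (g z) ≤
      ∫ u : Circle, poisson z u * sphLog (g u) ∂circleMeasure := by
  have hgc : Continuous fun u : Circle => g u :=
    hg.continuousOn_ball.comp_continuous (by fun_prop) fun u => by simp [Circle.norm_coe]
  set x := g z with hx
  have hd : Continuous fun u : Circle => ‖stereo (g u) - stereo x‖ ^ 2 :=
    (((continuous_stereo.comp hgc).sub continuous_const).norm).pow 2
  have hs : Continuous fun u : Circle => sphLog (g u) := continuous_sphLog.comp hgc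
  let v : Circle → ℝ := fun u =>
    2⁻¹ * (sphLog x + sphLog (g u) - ‖stereo (g u) - stereo x‖ ^ 2)
  have hv : Continuous v := continuous_const.mul ((continuous_const.add hs).sub hd)
  have h1 : DiffContOnCl ℂ (fun t => 1 + (starRingEnd ℂ) x * g t) (Metric.ball 0 1) :=
    (hg.const_smul ((starRingEnd ℂ) x)).const_add 1
  have h2 := norm_le_exp_poisson h1 hv (fun u => by
    refine le_of_sq_le_sq ?_ (Real.exp_pos _).le
    rw [← Real.exp_nat_mul]
    have e1 : ((2 : ℕ) : ℝ) * v u =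
        sphLog x + sphLog (g u) - ‖stereo (g u) - stereo x‖ ^ 2 := by
      simp only [v]; push_cast; ring
    have hxp : (0 : ℝ) < 1 + ‖x‖ ^ 2 := by positivity
    have hyp : (0 : ℝ) < 1 + ‖g u‖ ^ 2 := by positivity
    rw [e1, sub_eq_add_neg, Real.exp_add, Real.exp_add, sphLog, sphLog, Real.exp_log hxp,
      Real.exp_log hyp]
    have h3 := norm_one_add_conj_mul_sq x (g u)
    have h4 := norm_stereo_sub_sq_mul_le (g u) x
    have h5 := Real.add_one_le_exp (-‖stereo (g u) - stereo x‖ ^ 2)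
    have h6 := mul_le_mul_of_nonneg_left h5 (mul_pos hxp hyp).le
    nlinarith) hz
  have e2 : ‖1 + (starRingEnd ℂ) x * x‖ = 1 + ‖x‖ ^ 2 := by
    rw [mul_comm, Complex.mul_conj', ← Complex.ofReal_pow, ← Complex.ofReal_one,
      ← Complex.ofReal_add, Complex.norm_real, Real.norm_of_nonneg (by positivity)]
  rw [← hx, e2, ← Real.log_le_iff_le_exp (by positivity)] at h2
  have i1 : Integrable (fun u => poisson z u * sphLog x) circleMeasure :=
    integrable_circle ((continuous_poisson hz).mul continuous_const)
  have i2 : Integrable (fun u : Circle => poisson z u * sphLog (g u)) circleMeasure :=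
    integrable_circle ((continuous_poisson hz).mul hs)
  have i3 : Integrable (fun u : Circle => poisson z u * ‖stereo (g u) - stereo x‖ ^ 2)
      circleMeasure := integrable_circle ((continuous_poisson hz).mul hd)
  have e3 : ∫ u, poisson z u * v u ∂circleMeasure =
      2⁻¹ * (sphLog x + ∫ u : Circle, poisson z u * sphLog (g u) ∂circleMeasure
        - ∫ u : Circle, poisson z u * ‖stereo (g u) - stereo x‖ ^ 2 ∂circleMeasure) := by
    have e4 : ∀ u, poisson z u * v u = 2⁻¹ * ((poisson z u * sphLog x +
        poisson z u * sphLog (g u)) - poisson z u * ‖stereo (g u) - stereo x‖ ^ 2) := by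
      intro u; simp only [v]; ring
    simp only [e4]
    rw [integral_const_mul, integral_sub (by exact i1.add i2) i3, integral_add i1 i2,
      integral_mul_const, integral_poisson hz, one_mul]
  rw [e3] at h2
  change sphLog x ≤ _ at h2
  linarith

/-! ### The disc algebra of the infinite polydisc -/

/-- The closed polydisc, a compact set for the product topology. -/
def closedPolydisc : Set (ℕ → ℂ) := {ζ | ∀ n, ‖ζ n‖ ≤ 1}

lemma isCompact_closedPolydisc : IsCompact closedPolydisc := by
  have h : closedPolydisc = Set.pi univ fun _ => Metric.closedBall (0 : ℂ) 1 := by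
    ext ζ; simp [closedPolydisc]
  rw [h]
  exact isCompact_univ_pi fun _ => isCompact_closedBall 0 1

/-- The points of the torus, as sequences of complex numbers. -/
def torusPoint (w : Torus) : ℕ → ℂ := fun n => (w n : ℂ)

lemma continuous_torusPoint : Continuous torusPoint := by
  unfold torusPoint; fun_prop

lemma torusPoint_mem (w : Torus) : torusPoint w ∈ closedPolydisc := fun n => by
  simp [torusPoint, Circle.norm_coe]

/-- The curve `z ↦ (z w₁, z² w₂, …)` through a point of the torus. -/
def curve (w : Torus) (z : ℂ) : ℕ → ℂ := fun n => z ^ (n + 1) * (w n : ℂ)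

lemma continuous_curve (w : Torus) : Continuous (curve w) := by
  unfold curve; fun_prop

lemma curve_mem (w : Torus) {z : ℂ} (hz : ‖z‖ ≤ 1) : curve w z ∈ closedPolydisc := fun n => by
  simpa [curve, Circle.norm_coe] using pow_le_one₀ (norm_nonneg z) hz

lemma curve_circle (w : Torus) (u : Circle) : curve w u = torusPoint (weighted u * w) := by
  funext n; simp [curve, torusPoint, weighted]

/-- A version of the disc algebra in infinitely many variables: the functions that are continuous on
the closed polydisc for the product topology, and holomorphic in each variable as well as along the
curves `z ↦ (z w₁, z² w₂, …)`. -/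
structure IsDiscAlgebra (Φ : (ℕ → ℂ) → ℂ) : Prop where
  cont : ContinuousOn Φ closedPolydisc
  coord : ∀ ζ ∈ closedPolydisc, ∀ n,
    DifferentiableOn ℂ (fun z => Φ (Function.update ζ n z)) (Metric.ball 0 1)
  radial : ∀ w : Torus, DifferentiableOn ℂ (fun z => Φ (curve w z)) (Metric.ball 0 1)

lemma update_mem {ζ : ℕ → ℂ} (hζ : ζ ∈ closedPolydisc) (n : ℕ) {z : ℂ} (hz : ‖z‖ ≤ 1) :
    Function.update ζ n z ∈ closedPolydisc := fun m => by
  rcases eq_or_ne m n with rfl | h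
  · simpa using hz
  · simpa [h] using hζ m

namespace IsDiscAlgebra

variable {Φ Ψ : (ℕ → ℂ) → ℂ}

lemma continuous_torus (h : IsDiscAlgebra Φ) : Continuous fun w => Φ (torusPoint w) :=
  h.cont.comp_continuous continuous_torusPoint torusPoint_mem

lemma exists_bound (h : IsDiscAlgebra Φ) : ∃ C, ∀ ζ ∈ closedPolydisc, ‖Φ ζ‖ ≤ C :=
  isCompact_closedPolydisc.exists_bound_of_continuousOn h.cont

lemma diffContOnCl_coord (h : IsDiscAlgebra Φ) {ζ : ℕ → ℂ} (hζ : ζ ∈ closedPolydisc) (n : ℕ) :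
    DiffContOnCl ℂ (fun z => Φ (Function.update ζ n z)) (Metric.ball 0 1) := by
  refine ⟨h.coord ζ hζ n, ?_⟩
  rw [closure_ball 0 one_ne_zero]
  have hu : Continuous fun z : ℂ => Function.update ζ n z := continuous_const.update n continuous_id
  exact h.cont.comp hu.continuousOn fun z hz =>
    update_mem hζ n (by simpa using hz)

lemma diffContOnCl_radial (h : IsDiscAlgebra Φ) (w : Torus) :
    DiffContOnCl ℂ (fun z => Φ (curve w z)) (Metric.ball 0 1) := by
  refine ⟨h.radial w, ?_⟩
  rw [closure_ball 0 one_ne_zero]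
  exact h.cont.comp (continuous_curve w).continuousOn fun z hz =>
    curve_mem w (by simpa using hz)

lemma sub (h : IsDiscAlgebra Φ) (h' : IsDiscAlgebra Ψ) : IsDiscAlgebra fun ζ => Φ ζ - Ψ ζ where
  cont := h.cont.sub h'.cont
  coord ζ hζ n := (h.coord ζ hζ n).sub (h'.coord ζ hζ n)
  radial w := (h.radial w).sub (h'.radial w)

end IsDiscAlgebra

lemma differentiable_eval_mvPolynomial (q : MvPolynomial ℕ ℂ) {f : ℂ → ℕ → ℂ}
    (hf : ∀ n, Differentiable ℂ fun z => f z n) :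
    Differentiable ℂ fun z => MvPolynomial.eval (f z) q := by
  induction q using MvPolynomial.induction_on with
  | C a => simp
  | add p q hp hq => simpa using hp.fun_add hq
  | mul_X p n hp => simpa using hp.fun_mul (hf n)

lemma isDiscAlgebra_eval (q : MvPolynomial ℕ ℂ) :
    IsDiscAlgebra fun ζ => MvPolynomial.eval ζ q where
  cont := (MvPolynomial.continuous_eval q).continuousOn
  coord ζ _ n := by
    refine (differentiable_eval_mvPolynomial q fun m => ?_).differentiableOn
    rcases eq_or_ne m n with rfl | h
    · simp
    · simp [h]
  radial w :=
    (differentiable_eval_mvPolynomial q fun m => by unfold curve; fun_prop).differentiableOn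

/-! ### Point evaluations are bounded by `logNorm` -/

/-- Harnack's constant `(1 + |z|) / (1 - |z|)`, the supremum of the Poisson kernel at `z`. -/
def harnack (z : ℂ) : ℝ≥0∞ := ENNReal.ofReal ((1 + ‖z‖) / (1 - ‖z‖))

/-- The point with the first `N` coordinates of the point `w` of the torus and the other ones
of `ζ`. -/
def mixPoint (N : ℕ) (ζ : ℕ → ℂ) (w : Torus) : ℕ → ℂ := fun n => if n < N then (w n : ℂ) else ζ n

lemma mixPoint_mem (N : ℕ) {ζ : ℕ → ℂ} (hζ : ζ ∈ closedPolydisc) (w : Torus) :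
    mixPoint N ζ w ∈ closedPolydisc := fun n => by
  unfold mixPoint
  split_ifs
  · simp [Circle.norm_coe]
  · exact hζ n

lemma continuous_mixPoint (N : ℕ) (ζ : ℕ → ℂ) : Continuous (mixPoint N ζ) := by
  refine continuous_pi fun n => ?_
  unfold mixPoint
  split_ifs <;> fun_prop

lemma mixPoint_succ (N : ℕ) (ζ : ℕ → ℂ) (w : Torus) (u : Circle) :
    mixPoint (N + 1) ζ (Pi.mulSingle N u * w) =
      Function.update (mixPoint N ζ w) N ((u : ℂ) * (w N : ℂ)) := by
  funext n
  rcases lt_trichotomy n N with h | rfl | h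
  · simp [mixPoint, h, h.ne, Nat.lt_succ_of_lt h]
  · simp [mixPoint]
  · simp [mixPoint, h.ne', h.not_gt, show ¬ n < N + 1 by omega]

/-- Subharmonicity in one variable at a time, integrated over the torus. -/
lemma IsDiscAlgebra.logSize_le_prod {Φ : (ℕ → ℂ) → ℂ} (h : IsDiscAlgebra Φ) {ζ : ℕ → ℂ}
    (hζ : ∀ n, ‖ζ n‖ < 1) (N : ℕ) :
    logSize (Φ ζ) ≤ (∏ n ∈ Finset.range N, harnack (ζ n)) *
      ∫⁻ w, logSize (Φ (mixPoint N ζ w)) ∂torusMeasure := by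
  have hζ' : ζ ∈ closedPolydisc := fun n => (hζ n).le
  have hm : ∀ N, Measurable fun w => logSize (Φ (mixPoint N ζ w)) := fun N =>
    (continuous_logSize.comp (h.cont.comp_continuous (continuous_mixPoint N ζ)
      (mixPoint_mem N hζ'))).measurable
  induction N with
  | zero =>
    have h0 : ∀ w, mixPoint 0 ζ w = ζ := fun w => by funext n; simp [mixPoint]
    simp [h0]
  | succ N ih =>
    refine ih.trans ?_
    rw [Finset.prod_range_succ, mul_assoc]
    refine mul_le_mul_right ?_ _
    have hγ : Measurable fun v : Circle => (Pi.mulSingle N v : Torus) :=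
      (continuous_mulSingle N).measurable
    have hrot := lintegral_rotation hγ (measurable_const (a := harnack (ζ N))) (hm (N + 1))
    rw [lintegral_const, measure_univ, mul_one] at hrot
    rw [← hrot]
    refine lintegral_mono fun w => ?_
    have hin : DiffContOnCl ℂ (fun z : ℂ => z * (w N : ℂ)) (Metric.ball 0 1) :=
      (differentiable_id.mul_const _).diffContOnCl
    have hg := (h.diffContOnCl_coord (mixPoint_mem N hζ' w) N).comp hin (fun z hz => by
      simpa [Circle.norm_coe] using hz)
    have hz : ‖ζ N * (w N : ℂ)⁻¹‖ < 1 := by simpa [Circle.norm_coe] using hζ N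
    have h1 := logSize_le_lintegral_poisson hg hz
    simp only [Function.comp_apply] at h1
    rw [inv_mul_cancel_right₀ (Circle.coe_ne_zero _)] at h1
    have h2 : Function.update (mixPoint N ζ w) N (ζ N) = mixPoint N ζ w := by
      have : ζ N = mixPoint N ζ w N := by simp [mixPoint]
      rw [this, Function.update_eq_self]
    rw [h2] at h1
    refine h1.trans (lintegral_mono fun u => ?_)
    rw [mixPoint_succ]
    refine mul_le_mul_left ?_ _
    refine ENNReal.ofReal_le_ofReal ((poisson_le hz u).trans_eq ?_)
    simp [Circle.norm_coe]

lemma IsDiscAlgebra.tendsto_lintegral_mixPoint {Φ : (ℕ → ℂ) → ℂ} (h : IsDiscAlgebra Φ) {ζ : ℕ → ℂ}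
    (hζ : ζ ∈ closedPolydisc) :
    Tendsto (fun N => ∫⁻ w, logSize (Φ (mixPoint N ζ w)) ∂torusMeasure) atTop
      (𝓝 (logNorm fun w => Φ (torusPoint w))) := by
  obtain ⟨C, hC⟩ := h.exists_bound
  refine tendsto_lintegral_of_dominated_convergence (fun _ => ENNReal.ofReal (max C 0))
    (fun N => ?_) (fun N => ae_of_all _ fun w => ?_) (by simp) (ae_of_all _ fun w => ?_)
  · exact (continuous_logSize.comp (h.cont.comp_continuous (continuous_mixPoint N ζ)
      (mixPoint_mem N hζ))).measurable
  · exact (logSize_le_norm _).trans (ENNReal.ofReal_le_ofReal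
      ((hC _ (mixPoint_mem N hζ w)).trans (le_max_left _ _)))
  · have h1 : Tendsto (fun N => mixPoint N ζ w) atTop (𝓝[closedPolydisc] (torusPoint w)) := by
      refine tendsto_nhdsWithin_iff.2 ⟨tendsto_pi_nhds.2 fun n => ?_,
        Eventually.of_forall fun N => mixPoint_mem N hζ w⟩
      refine tendsto_const_nhds.congr' ?_
      filter_upwards [eventually_gt_atTop n] with N hN
      simp [mixPoint, hN, torusPoint]
    exact (continuous_logSize.tendsto _).comp ((h.cont _ (torusPoint_mem w)).tendsto.comp h1)

lemma sum_norm_le (ζ : Ell1) (s : Finset ℕ) : ∑ n ∈ s, ‖ζ n‖ ≤ ‖ζ‖ := by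
  have h := lp.sum_rpow_le_norm_rpow (p := 1) (by simp) ζ s
  simpa using h

/-- On a neighbourhood of each point of the domain the coordinates stay away from the unit
circle. -/
lemma exists_dist_polydisc (x : polydisc) :
    ∃ δ : ℝ, 0 < δ ∧ ∀ n, ‖(x : Ell1) n‖ ≤ 1 - δ := by
  have hs : Summable fun n => ‖(x : Ell1) n‖ :=
    summable_of_sum_le (fun _ => norm_nonneg _) (sum_norm_le x)
  obtain ⟨N, hN⟩ := eventually_atTop.1 (hs.tendsto_atTop_zero.eventually
    (gt_mem_nhds (show (0 : ℝ) < 1 / 2 by norm_num)))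
  have hfin : ∃ δ : ℝ, 0 < δ ∧ ∀ n < N, ‖(x : Ell1) n‖ ≤ 1 - δ := by
    clear hN
    induction N with
    | zero => exact ⟨1, one_pos, by simp⟩
    | succ N ih =>
      obtain ⟨δ, h0, h⟩ := ih
      refine ⟨min δ (1 - ‖(x : Ell1) N‖), lt_min h0 (by linarith [x.2 N]), fun n hn => ?_⟩
      rcases Nat.lt_succ_iff_lt_or_eq.1 hn with h1 | rfl
      · linarith [h n h1, min_le_left δ (1 - ‖(x : Ell1) N‖)]
      · linarith [min_le_right δ (1 - ‖(x : Ell1) n‖)]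
  obtain ⟨δ, h0, h⟩ := hfin
  refine ⟨min δ (1 / 2), lt_min h0 (by norm_num), fun n => ?_⟩
  rcases lt_or_ge n N with h1 | h1
  · linarith [h n h1, min_le_left δ (1 / 2)]
  · linarith [hN n h1, min_le_right δ (1 / 2)]

lemma isOpen_polydisc : IsOpen polydisc := by
  refine Metric.isOpen_iff.2 fun x hx => ?_
  obtain ⟨δ, h0, h⟩ := exists_dist_polydisc ⟨x, hx⟩
  refine ⟨δ, h0, fun y hy n => ?_⟩
  have h1 : ‖(y - x) n‖ ≤ ‖y - x‖ := lp.norm_apply_le_norm one_ne_zero _ n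
  rw [Metric.mem_ball, dist_eq_norm] at hy
  have h2 : y n = x n + (y - x) n := by simp
  rw [h2]
  have := norm_add_le (x n) ((y - x) n)
  have := h n
  simp only at this
  linarith

lemma prod_harnack_le {ζ : Ell1} {δ : ℝ} (h0 : 0 < δ) (h : ∀ n, ‖ζ n‖ ≤ 1 - δ) (N : ℕ) :
    ∏ n ∈ Finset.range N, harnack (ζ n) ≤ ENNReal.ofReal (Real.exp (2 / δ * ‖ζ‖)) := by
  have h1 : ∀ n, (1 + ‖ζ n‖) / (1 - ‖ζ n‖) ≤ Real.exp (2 / δ * ‖ζ n‖) := fun n => by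
    have hp : 0 < 1 - ‖ζ n‖ := by linarith [h n]
    have e : (1 + ‖ζ n‖) / (1 - ‖ζ n‖) = 2 * ‖ζ n‖ / (1 - ‖ζ n‖) + 1 := by
      field_simp; ring
    have h2 : 2 * ‖ζ n‖ / (1 - ‖ζ n‖) ≤ 2 / δ * ‖ζ n‖ := by
      rw [div_mul_eq_mul_div]
      gcongr
      linarith [h n]
    rw [e]
    exact (add_le_add_left h2 1).trans (Real.add_one_le_exp _)
  calc ∏ n ∈ Finset.range N, harnack (ζ n)
      ≤ ∏ n ∈ Finset.range N, ENNReal.ofReal (Real.exp (2 / δ * ‖ζ n‖)) :=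
        Finset.prod_le_prod' fun n _ => ENNReal.ofReal_le_ofReal (h1 n)
    _ = ENNReal.ofReal (Real.exp (2 / δ * ∑ n ∈ Finset.range N, ‖ζ n‖)) := by
        rw [← ENNReal.ofReal_prod_of_nonneg fun n _ => (Real.exp_pos _).le, ← Real.exp_sum,
          Finset.mul_sum]
    _ ≤ _ := by
        refine ENNReal.ofReal_le_ofReal (Real.exp_le_exp.2 ?_)
        exact mul_le_mul_of_nonneg_left (sum_norm_le ζ _) (by positivity)

/-- The values of the functions of the disc algebra are bounded by `logNorm`, with a locally bounded
constant. -/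
lemma exists_logSize_le (x : polydisc) :
    ∃ C : ℝ, 0 ≤ C ∧ ∃ U ∈ 𝓝 x, ∀ y ∈ U, ∀ Φ, IsDiscAlgebra Φ →
      logSize (Φ fun n => (y : Ell1) n) ≤
        ENNReal.ofReal C * logNorm fun w => Φ (torusPoint w) := by
  obtain ⟨δ, h0, h⟩ := exists_dist_polydisc x
  refine ⟨Real.exp (2 / (δ / 2) * (‖(x : Ell1)‖ + δ / 2)), (Real.exp_pos _).le,
    Metric.ball x (δ / 2), Metric.ball_mem_nhds _ (by positivity), fun y hy Φ hΦ => ?_⟩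
  have hy1 : ‖(y : Ell1) - x‖ < δ / 2 := by
    rw [← dist_eq_norm]; exact hy
  have hy2 : ∀ n, ‖(y : Ell1) n‖ ≤ 1 - δ / 2 := fun n => by
    have h1 : ‖((y : Ell1) - x) n‖ ≤ ‖(y : Ell1) - x‖ := lp.norm_apply_le_norm one_ne_zero _ n
    have h2 : (y : Ell1) n = (x : Ell1) n + ((y : Ell1) - x) n := by simp
    rw [h2]
    have := norm_add_le ((x : Ell1) n) (((y : Ell1) - x) n)
    linarith [h n]
  have hy3 : ‖(y : Ell1)‖ ≤ ‖(x : Ell1)‖ + δ / 2 := by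
    have := norm_add_le (x : Ell1) ((y : Ell1) - x)
    rw [add_sub_cancel] at this
    linarith
  have hmem : (fun n => (y : Ell1) n) ∈ closedPolydisc := fun n => (y.2 n).le
  refine ge_of_tendsto (ENNReal.Tendsto.const_mul (hΦ.tendsto_lintegral_mixPoint hmem)
    (Or.inr ENNReal.ofReal_ne_top)) (Eventually.of_forall fun N => ?_)
  refine (hΦ.logSize_le_prod y.2 N).trans ?_
  refine mul_le_mul_left ((prod_harnack_le (half_pos h0) hy2 N).trans ?_) _
  refine ENNReal.ofReal_le_ofReal (Real.exp_le_exp.2 ?_)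
  gcongr

/-- Subharmonicity along the curves `z ↦ (z w₁, z² w₂, …)`. -/
lemma IsDiscAlgebra.logSize_curve_le {Φ : (ℕ → ℂ) → ℂ} (h : IsDiscAlgebra Φ) (w : Torus) {z : ℂ}
    (hz : ‖z‖ < 1) :
    logSize (Φ (curve w z)) ≤ ∫⁻ u : Circle, ENNReal.ofReal (poisson z u) *
      logSize (Φ (torusPoint (weighted u * w))) ∂circleMeasure := by
  have h1 := logSize_le_lintegral_poisson (h.diffContOnCl_radial w) hz
  simpa only [curve_circle] using h1

lemma IsDiscAlgebra.continuous_curve {Φ : (ℕ → ℂ) → ℂ} (h : IsDiscAlgebra Φ) {z : ℂ}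
    (hz : ‖z‖ ≤ 1) : Continuous fun w => Φ (curve w z) :=
  h.cont.comp_continuous (by unfold curve; fun_prop) fun w => curve_mem w hz

lemma IsDiscAlgebra.lintegral_curve_le {Φ : (ℕ → ℂ) → ℂ} (h : IsDiscAlgebra Φ) {z : ℂ}
    (hz : ‖z‖ < 1) : (logNorm fun w => Φ (curve w z)) ≤ logNorm fun w => Φ (torusPoint w) := by
  have hrot := lintegral_rotation continuous_weighted.measurable
    (k := fun u => ENNReal.ofReal (poisson z u)) (continuous_poisson hz).measurable.ennreal_ofReal
    (f := fun w => logSize (Φ (torusPoint w)))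
    (continuous_logSize.comp h.continuous_torus).measurable
  rw [lintegral_poisson hz, one_mul] at hrot
  rw [logNorm_eq_lintegral, logNorm_eq_lintegral, ← hrot]
  exact lintegral_mono fun w => h.logSize_curve_le w hz

/-! ### The topological algebra `L⁰` of the torus -/

/-- A sequence of functions whose integrals tend to zero has a subsequence tending to zero almost
everywhere. -/
lemma exists_seq_ae_tendsto_zero {α : Type*} [MeasurableSpace α] {μ : Measure α}
    {F : ℕ → α → ℝ≥0∞} (hF : ∀ n, AEMeasurable (F n) μ)
    (h : Tendsto (fun n => ∫⁻ x, F n x ∂μ) atTop (𝓝 0)) :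
    ∃ φ : ℕ → ℕ, StrictMono φ ∧ ∀ᵐ x ∂μ, Tendsto (fun k => F (φ k) x) atTop (𝓝 0) := by
  have h1 : ∀ k : ℕ, ∀ᶠ n in atTop, ∫⁻ x, F n x ∂μ ≤ (2⁻¹ : ℝ≥0∞) ^ k := fun k =>
    (h.eventually (gt_mem_nhds (ENNReal.pow_pos (by simp) k))).mono fun n hn => hn.le
  obtain ⟨φ, hφ, hφ'⟩ := extraction_forall_of_eventually h1
  refine ⟨φ, hφ, ?_⟩
  have h2 : ∫⁻ x, ∑' k, F (φ k) x ∂μ ≠ ∞ := by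
    rw [lintegral_tsum fun k => hF _]
    refine ne_top_of_le_ne_top ?_ (ENNReal.tsum_le_tsum hφ')
    rw [ENNReal.tsum_geometric]
    simp
  filter_upwards [ae_lt_top' (AEMeasurable.tsum fun k => hF _) h2] with x hx
  exact ENNReal.tendsto_atTop_zero_of_tsum_ne_top hx.ne

lemma coeFn_L0_sub (f g : L0) :
    ((f - g : L0) : MeasFun) =ᵐ[torusMeasure] fun w => (f : MeasFun) w - (g : MeasFun) w :=
  AEEqFun.coeFn_sub (f : MeasFun) (g : MeasFun)

lemma coeFn_L0_add (f g : L0) :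
    ((f + g : L0) : MeasFun) =ᵐ[torusMeasure] fun w => (f : MeasFun) w + (g : MeasFun) w :=
  AEEqFun.coeFn_add (f : MeasFun) (g : MeasFun)

lemma coeFn_L0_mul (f g : L0) :
    ((f * g : L0) : MeasFun) =ᵐ[torusMeasure] fun w => (f : MeasFun) w * (g : MeasFun) w :=
  AEEqFun.coeFn_mul (f : MeasFun) (g : MeasFun)

lemma coeFn_L0_algebraMap (c : ℂ) :
    ((algebraMap ℂ L0 c : L0) : MeasFun) =ᵐ[torusMeasure] fun _ => c := by
  have e : ((algebraMap ℂ L0 c : L0) : MeasFun) = c • (1 : MeasFun) :=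
    Algebra.algebraMap_eq_smul_one c
  rw [e]
  filter_upwards [AEEqFun.coeFn_smul c (1 : MeasFun),
    AEEqFun.coeFn_one (μ := torusMeasure) (α := Torus) (β := ℂ)] with w h1 h2
  rw [h1, Pi.smul_apply, h2]
  simp

lemma aemeasurable_L0 (f : L0) : AEMeasurable (f : MeasFun) torusMeasure :=
  (AEEqFun.aestronglyMeasurable _).aemeasurable

lemma L0_edist (f g : L0) :
    edist f g = ∫⁻ w, logSize ((f : MeasFun) w - (g : MeasFun) w) ∂torusMeasure := by
  rw [L0_edist_eq]
  exact logNorm_congr (coeFn_L0_sub f g)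

/-- The distance of `L⁰` in terms of representatives. -/
lemma L0_edist_of_ae {f g : L0} {F G : Torus → ℂ} (hF : (f : MeasFun) =ᵐ[torusMeasure] F)
    (hG : (g : MeasFun) =ᵐ[torusMeasure] G) :
    edist f g = logNorm fun w => F w - G w := by
  rw [L0_edist, logNorm_eq_lintegral]
  refine lintegral_congr_ae ?_
  filter_upwards [hF, hG] with w h1 h2
  rw [h1, h2]

instance : ContinuousAdd L0 := by
  refine ⟨continuous_iff_continuousAt.2 fun p => ?_⟩
  rw [ContinuousAt, tendsto_iff_edist_tendsto_0]
  have h1 : Tendsto (fun q : L0 × L0 => edist q.1 p.1 + edist q.2 p.2) (𝓝 p) (𝓝 0) := by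
    have h2 : Continuous fun q : L0 × L0 => edist q.1 p.1 + edist q.2 p.2 := by fun_prop
    simpa using h2.tendsto p
  refine tendsto_of_tendsto_of_tendsto_of_le_of_le tendsto_const_nhds h1 (fun _ => zero_le) fun q => ?_
  simp only [L0_edist]
  have hm : AEMeasurable (fun w => logSize ((q.1 : MeasFun) w - (p.1 : MeasFun) w)) torusMeasure :=
    measurable_logSize.comp_aemeasurable ((aemeasurable_L0 _).sub (aemeasurable_L0 _))
  rw [← lintegral_add_left' hm]
  refine lintegral_mono_ae ?_
  filter_upwards [coeFn_L0_add q.1 q.2, coeFn_L0_add p.1 p.2] with w h1 h2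
  rw [h1, h2, add_sub_add_comm]
  exact logSize_add_le _ _

/-- Multiplication by a fixed element of `L⁰` is continuous: along a sequence `a → 0`, the difference
`log (1 + |a g|) - log (1 + |a|)` is dominated by `log (1 + |g|)`. -/
lemma continuous_L0_mul_const (g : L0) : Continuous fun f : L0 => f * g := by
  refine continuous_iff_seqContinuous.2 fun f f₀ hf => ?_
  rw [tendsto_iff_edist_tendsto_0] at hf ⊢
  refine tendsto_of_subseq_tendsto fun ns hns => ?_
  let a : ℕ → Torus → ℂ := fun n w => (f n : MeasFun) w - (f₀ : MeasFun) w
  have ham : ∀ n, AEMeasurable (a n) torusMeasure := fun n =>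
    (aemeasurable_L0 _).sub (aemeasurable_L0 _)
  have ha : Tendsto (fun n => ∫⁻ w, logSize (a (ns n) w) ∂torusMeasure) atTop (𝓝 0) := by
    refine (hf.comp hns).congr fun n => ?_
    simp only [Function.comp_apply, L0_edist, a]
  obtain ⟨φ, hφ, hφa⟩ := exists_seq_ae_tendsto_zero
    (fun n => measurable_logSize.comp_aemeasurable (ham (ns n))) ha
  refine ⟨φ, ?_⟩
  have hD : Tendsto (fun k => ∫⁻ w, (logSize (a (ns (φ k)) w * (g : MeasFun) w)
      - logSize (a (ns (φ k)) w)) ∂torusMeasure) atTop (𝓝 (∫⁻ _, 0 ∂torusMeasure)) := by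
    refine tendsto_lintegral_of_dominated_convergence' (fun w => logSize ((g : MeasFun) w))
      (fun k => ?_) (fun k => ae_of_all _ fun w => ?_) g.2.ne ?_
    · exact (measurable_logSize.comp_aemeasurable ((ham _).mul (aemeasurable_L0 g))).sub
        (measurable_logSize.comp_aemeasurable (ham _))
    · rw [tsub_le_iff_left]
      exact logSize_mul_le _ _
    · filter_upwards [hφa] with w hw
      have h1 := (tendsto_zero_of_logSize hw).mul_const ((g : MeasFun) w)
      rw [zero_mul] at h1
      have h2 := (continuous_logSize.tendsto 0).comp h1
      rw [logSize_zero] at h2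
      exact tendsto_of_tendsto_of_tendsto_of_le_of_le tendsto_const_nhds h2 (fun _ => zero_le)
        fun k => tsub_le_self
  have hsum := (ha.comp hφ.tendsto_atTop).add hD
  rw [lintegral_zero, add_zero] at hsum
  refine tendsto_of_tendsto_of_tendsto_of_le_of_le tendsto_const_nhds hsum (fun _ => zero_le)
    fun k => ?_
  simp only [L0_edist, Function.comp_apply]
  have hm : AEMeasurable (fun w => logSize (a (ns (φ k)) w)) torusMeasure :=
    measurable_logSize.comp_aemeasurable (ham _)
  rw [← lintegral_add_left' hm]
  refine lintegral_mono_ae ?_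
  filter_upwards [coeFn_L0_mul (f (ns (φ k))) g, coeFn_L0_mul f₀ g] with w h1 h2
  rw [h1, h2, ← sub_mul]
  exact le_add_tsub

lemma coeFn_polyTorus (q : MvPolynomial ℕ ℂ) :
    (polyTorus q : MeasFun) =ᵐ[torusMeasure] fun w => MvPolynomial.eval (torusPoint w) q :=
  AEEqFun.coeFn_mk _ _

/-- Elements of `L⁰` that agree almost everywhere are equal. -/
lemma L0_ext {f g : L0} (h : (f : MeasFun) =ᵐ[torusMeasure] (g : MeasFun)) : f = g :=
  Subtype.ext (AEEqFun.ext h)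

/-- The map `polyTorus` as a homomorphism of algebras. -/
def polyTorusHom : MvPolynomial ℕ ℂ →ₐ[ℂ] L0 :=
  have hC : ∀ c : ℂ, polyTorus (MvPolynomial.C c) = algebraMap ℂ L0 c := fun c => L0_ext <| by
    filter_upwards [coeFn_polyTorus (MvPolynomial.C c), coeFn_L0_algebraMap c] with w h1 h2
    rw [h1, h2, MvPolynomial.eval_C]
  { toFun := polyTorus
    map_one' := by
      have h := hC 1
      rwa [map_one, map_one] at h
    map_zero' := by
      have h := hC 0
      rwa [map_zero, map_zero] at h
    map_add' := fun p q => L0_ext <| by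
      filter_upwards [coeFn_polyTorus (p + q), coeFn_polyTorus p, coeFn_polyTorus q,
        coeFn_L0_add (polyTorus p) (polyTorus q)] with w h1 h2 h3 h4
      rw [h1, h4, h2, h3, map_add]
    map_mul' := fun p q => L0_ext <| by
      filter_upwards [coeFn_polyTorus (p * q), coeFn_polyTorus p, coeFn_polyTorus q,
        coeFn_L0_mul (polyTorus p) (polyTorus q)] with w h1 h2 h3 h4
      rw [h1, h4, h2, h3, map_mul]
    commutes' := hC }

instance : IsSemitopologicalSemiring L0 where
  continuous_const_mul {g} := by simpa only [mul_comm g] using continuous_L0_mul_const g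
  continuous_mul_const {g} := continuous_L0_mul_const g

/-- The Smirnov class of the torus, as a subalgebra of `L⁰`. -/
def smirnovTorusAlgebra : Subalgebra ℂ L0 := polyTorusHom.range.topologicalClosure

lemma coe_smirnovTorusAlgebra : (smirnovTorusAlgebra : Set L0) = smirnovTorus := by
  rw [smirnovTorusAlgebra, Subalgebra.topologicalClosure_coe, AlgHom.coe_range]
  rfl

/-! ### Point evaluations on the Smirnov class of the torus -/

/-- A continuous function on the torus as an element of `L⁰`. -/
def continuousL0 (f : Torus → ℂ) (hf : Continuous f) : L0 :=
  ⟨AEEqFun.mk f hf.aestronglyMeasurable, by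
    obtain ⟨C, hC⟩ := isCompact_univ.exists_bound_of_continuousOn hf.continuousOn
    refine logNorm_lt_top_of_bound (C := C) ?_
    filter_upwards [AEEqFun.coeFn_mk _ hf.aestronglyMeasurable] with w hw
    rw [hw]
    exact hC w (mem_univ w)⟩

lemma coeFn_continuousL0 (f : Torus → ℂ) (hf : Continuous f) :
    (continuousL0 f hf : MeasFun) =ᵐ[torusMeasure] f := AEEqFun.coeFn_mk _ _

/-- The boundary values of a function of the disc algebra, as an element of `L⁰`. -/
def IsDiscAlgebra.toL0 {Φ : (ℕ → ℂ) → ℂ} (h : IsDiscAlgebra Φ) : L0 :=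
  continuousL0 (fun w => Φ (torusPoint w)) h.continuous_torus

lemma edist_toL0 {Φ Ψ : (ℕ → ℂ) → ℂ} (h : IsDiscAlgebra Φ) (h' : IsDiscAlgebra Ψ) :
    edist h.toL0 h'.toL0 = logNorm fun w => Φ (torusPoint w) - Ψ (torusPoint w) :=
  L0_edist_of_ae (coeFn_continuousL0 _ _) (coeFn_continuousL0 _ _)

/-- Locally uniform continuity of the point evaluations on the disc algebra. -/
lemma exists_logSize_sub_le (x : polydisc) :
    ∃ C : ℝ, 0 ≤ C ∧ ∃ U ∈ 𝓝 x, ∀ y ∈ U, ∀ Φ Ψ, ∀ h : IsDiscAlgebra Φ, ∀ h' : IsDiscAlgebra Ψ,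
      logSize ((Φ fun n => (y : Ell1) n) - Ψ fun n => (y : Ell1) n) ≤
        ENNReal.ofReal C * edist h.toL0 h'.toL0 := by
  obtain ⟨C, hC, U, hU, H⟩ := exists_logSize_le x
  refine ⟨C, hC, U, hU, fun y hy Φ Ψ h h' => ?_⟩
  rw [edist_toL0]
  exact H y hy _ (h.sub h')

lemma tendsto_of_logSize_sub {ι : Type*} {l : Filter ι} {f : ι → ℂ} {a : ℂ} {C : ℝ} {d : ι → ℝ≥0∞}
    (h : ∀ i, logSize (f i - a) ≤ ENNReal.ofReal C * d i) (hd : Tendsto d l (𝓝 0)) :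
    Tendsto f l (𝓝 a) := by
  have h1 : Tendsto (fun i => ENNReal.ofReal C * d i) l (𝓝 0) := by
    simpa using ENNReal.Tendsto.const_mul hd (Or.inr ENNReal.ofReal_ne_top)
  exact tendsto_sub_nhds_zero_iff.1 (tendsto_zero_of_logSize
    (tendsto_of_tendsto_of_tendsto_of_le_of_le tendsto_const_nhds h1 (fun _ => zero_le) h))

lemma comap_polyTorus_neBot {f : L0} (hf : f ∈ smirnovTorus) : (comap polyTorus (𝓝 f)).NeBot :=
  comap_neBot_iff_frequently.2 (mem_closure_iff_frequently.1 hf)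

/-- The limit that defines `pointEval ζ f` exists for `f` in the Smirnov class. -/
lemma tendsto_pointEval (ζ : polydisc) {f : L0} (hf : f ∈ smirnovTorus) :
    Tendsto (polyEval ζ) (comap polyTorus (𝓝 f)) (𝓝 (pointEval ζ f)) := by
  have := comap_polyTorus_neBot hf
  obtain ⟨C, hC, U, hU, H⟩ := exists_logSize_sub_le ζ
  refine tendsto_nhds_limUnder (cauchy_map_iff_exists_tendsto.1 ?_)
  rw [cauchy_map_iff, uniformity_eq_comap_nhds_zero, tendsto_comap_iff]
  refine ⟨inferInstance, tendsto_zero_of_logSize ?_⟩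
  have h1 : Tendsto (fun p : MvPolynomial ℕ ℂ × MvPolynomial ℕ ℂ =>
      ENNReal.ofReal C * edist (polyTorus p.2) (polyTorus p.1))
      (comap polyTorus (𝓝 f) ×ˢ comap polyTorus (𝓝 f)) (𝓝 0) := by
    have h2 : Tendsto (fun p : MvPolynomial ℕ ℂ × MvPolynomial ℕ ℂ =>
        edist (polyTorus p.2) (polyTorus p.1))
        (comap polyTorus (𝓝 f) ×ˢ comap polyTorus (𝓝 f)) (𝓝 (edist f f)) :=
      (tendsto_comap.comp tendsto_snd).edist (tendsto_comap.comp tendsto_fst)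
    rw [edist_self] at h2
    simpa using ENNReal.Tendsto.const_mul h2 (Or.inr ENNReal.ofReal_ne_top)
  refine tendsto_of_tendsto_of_tendsto_of_le_of_le tendsto_const_nhds h1 (fun _ => zero_le)
    fun p => ?_
  exact H ζ (mem_of_mem_nhds hU) _ _ (isDiscAlgebra_eval p.2) (isDiscAlgebra_eval p.1)

/-- The point evaluations have their natural values on the disc algebra. -/
lemma pointEval_toL0 (ζ : polydisc) {Φ : (ℕ → ℂ) → ℂ} (h : IsDiscAlgebra Φ)
    (hΦ : h.toL0 ∈ smirnovTorus) : pointEval ζ h.toL0 = Φ fun n => (ζ : Ell1) n := by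
  have := comap_polyTorus_neBot hΦ
  obtain ⟨C, hC, U, hU, H⟩ := exists_logSize_sub_le ζ
  refine tendsto_nhds_unique (tendsto_pointEval ζ hΦ) (tendsto_of_logSize_sub (fun q =>
    H ζ (mem_of_mem_nhds hU) _ _ (isDiscAlgebra_eval q) h) ?_)
  have h2 : Tendsto (fun q => edist (polyTorus q) h.toL0) (comap polyTorus (𝓝 h.toL0))
      (𝓝 (edist h.toL0 h.toL0)) := tendsto_comap.edist tendsto_const_nhds
  rwa [edist_self] at h2

lemma polyTorus_mem (q : MvPolynomial ℕ ℂ) : polyTorus q ∈ smirnovTorus :=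
  subset_closure ⟨q, rfl⟩

lemma pointEval_polyTorus (ζ : polydisc) (q : MvPolynomial ℕ ℂ) :
    pointEval ζ (polyTorus q) = polyEval ζ q :=
  pointEval_toL0 ζ (isDiscAlgebra_eval q) (polyTorus_mem q)

lemma exists_logSize_pointEval_sub_le (x : polydisc) :
    ∃ C : ℝ, 0 ≤ C ∧ ∃ U ∈ 𝓝 x, ∀ y ∈ U, ∀ f ∈ smirnovTorus, ∀ g ∈ smirnovTorus,
      logSize (pointEval y f - pointEval y g) ≤ ENNReal.ofReal C * edist f g := by
  obtain ⟨C, hC, U, hU, H⟩ := exists_logSize_sub_le x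
  refine ⟨C, hC, U, hU, fun y hy f hf g hg => ?_⟩
  have := comap_polyTorus_neBot hf
  have := comap_polyTorus_neBot hg
  have h1 : Tendsto (fun p : MvPolynomial ℕ ℂ × MvPolynomial ℕ ℂ =>
      logSize (polyEval y p.1 - polyEval y p.2))
      (comap polyTorus (𝓝 f) ×ˢ comap polyTorus (𝓝 g))
      (𝓝 (logSize (pointEval y f - pointEval y g))) :=
    (continuous_logSize.tendsto _).comp (((tendsto_pointEval y hf).comp tendsto_fst).sub
      ((tendsto_pointEval y hg).comp tendsto_snd))
  have h2 : Tendsto (fun p : MvPolynomial ℕ ℂ × MvPolynomial ℕ ℂ =>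
      ENNReal.ofReal C * edist (polyTorus p.1) (polyTorus p.2))
      (comap polyTorus (𝓝 f) ×ˢ comap polyTorus (𝓝 g)) (𝓝 (ENNReal.ofReal C * edist f g)) :=
    ENNReal.Tendsto.const_mul ((tendsto_comap.comp tendsto_fst).edist
      (tendsto_comap.comp tendsto_snd)) (Or.inr ENNReal.ofReal_ne_top)
  exact le_of_tendsto_of_tendsto' h1 h2 fun p =>
    H y hy _ _ (isDiscAlgebra_eval p.1) (isDiscAlgebra_eval p.2)

lemma tendsto_pointEval_of_tendsto {ι : Type*} {l : Filter ι} {f : ι → L0} {g : L0} (ζ : polydisc)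
    (hf : ∀ i, f i ∈ smirnovTorus) (hg : g ∈ smirnovTorus) (h : Tendsto f l (𝓝 g)) :
    Tendsto (fun i => pointEval ζ (f i)) l (𝓝 (pointEval ζ g)) := by
  obtain ⟨C, hC, U, hU, H⟩ := exists_logSize_pointEval_sub_le ζ
  exact tendsto_of_logSize_sub (fun i => H ζ (mem_of_mem_nhds hU) _ (hf i) _ hg)
    (tendsto_iff_edist_tendsto_0.1 h)

lemma continuousOn_pointEval (ζ : polydisc) : ContinuousOn (pointEval ζ) smirnovTorus := by
  rw [continuousOn_iff_continuous_domRestrict]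
  refine continuous_iff_continuousAt.2 fun f => ?_
  exact tendsto_pointEval_of_tendsto ζ (fun g : smirnovTorus => g.2) f.2
    (continuous_subtype_val.tendsto f)

lemma mem_smirnovTorusAlgebra {f : L0} : f ∈ smirnovTorusAlgebra ↔ f ∈ smirnovTorus := by
  rw [← coe_smirnovTorusAlgebra]; rfl

lemma pointEval_add (ζ : polydisc) {f g : L0} (hf : f ∈ smirnovTorus) (hg : g ∈ smirnovTorus) :
    pointEval ζ (f + g) = pointEval ζ f + pointEval ζ g := by
  have := comap_polyTorus_neBot hf
  have := comap_polyTorus_neBot hg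
  have hfg : f + g ∈ smirnovTorus :=
    mem_smirnovTorusAlgebra.1 (add_mem (mem_smirnovTorusAlgebra.2 hf) (mem_smirnovTorusAlgebra.2 hg))
  have h1 : Tendsto (fun p : MvPolynomial ℕ ℂ × MvPolynomial ℕ ℂ => polyTorus (p.1 + p.2))
      (comap polyTorus (𝓝 f) ×ˢ comap polyTorus (𝓝 g)) (𝓝 (f + g)) := by
    have h2 : Tendsto (fun p : MvPolynomial ℕ ℂ × MvPolynomial ℕ ℂ => polyTorus p.1 + polyTorus p.2)
        (comap polyTorus (𝓝 f) ×ˢ comap polyTorus (𝓝 g)) (𝓝 (f + g)) :=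
      (tendsto_comap.comp tendsto_fst).add (tendsto_comap.comp tendsto_snd)
    exact h2.congr fun p => (map_add polyTorusHom p.1 p.2).symm
  refine tendsto_nhds_unique (tendsto_pointEval_of_tendsto ζ (fun p => polyTorus_mem _) hfg h1) ?_
  have h3 := ((tendsto_pointEval ζ hf).comp (tendsto_fst (g := comap polyTorus (𝓝 g)))).add
    ((tendsto_pointEval ζ hg).comp (tendsto_snd (f := comap polyTorus (𝓝 f))))
  refine h3.congr fun p => ?_
  rw [pointEval_polyTorus]
  exact (map_add (MvPolynomial.eval fun n => (ζ : Ell1) n) p.1 p.2).symm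

lemma pointEval_mul (ζ : polydisc) {f g : L0} (hf : f ∈ smirnovTorus) (hg : g ∈ smirnovTorus) :
    pointEval ζ (f * g) = pointEval ζ f * pointEval ζ g := by
  have hmem : ∀ {f g : L0}, f ∈ smirnovTorus → g ∈ smirnovTorus → f * g ∈ smirnovTorus :=
    fun hf hg => mem_smirnovTorusAlgebra.1
      (mul_mem (mem_smirnovTorusAlgebra.2 hf) (mem_smirnovTorusAlgebra.2 hg))
  -- the product of `L⁰` is only used as a separately continuous one: one factor at a time
  have key : ∀ {f g : L0}, f ∈ smirnovTorus → g ∈ smirnovTorus →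
      (∀ p, pointEval ζ (polyTorus p * g) = pointEval ζ (polyTorus p) * pointEval ζ g) →
      pointEval ζ (f * g) = pointEval ζ f * pointEval ζ g := by
    intro f g hf hg h
    have := comap_polyTorus_neBot hf
    have h1 : Tendsto (fun p => polyTorus p * g) (comap polyTorus (𝓝 f)) (𝓝 (f * g)) :=
      ((continuous_L0_mul_const g).tendsto f).comp tendsto_comap
    refine tendsto_nhds_unique (tendsto_pointEval_of_tendsto ζ
      (fun p => hmem (polyTorus_mem p) hg) (hmem hf hg) h1) ?_
    refine ((tendsto_pointEval ζ hf).mul_const (pointEval ζ g)).congr fun p => ?_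
    rw [h, pointEval_polyTorus]
  refine key hf hg fun p => ?_
  rw [mul_comm, mul_comm (pointEval ζ (polyTorus p))]
  refine key hg (polyTorus_mem p) fun q => ?_
  have e : polyTorus q * polyTorus p = polyTorus (q * p) := (map_mul polyTorusHom q p).symm
  rw [e, pointEval_polyTorus, pointEval_polyTorus, pointEval_polyTorus]
  exact map_mul (MvPolynomial.eval fun n => (ζ : Ell1) n) q p

/-- The map `f ↦ f̃` on the Smirnov class of the torus, as a homomorphism of algebras. -/
def tildeHom : smirnovTorusAlgebra →ₐ[ℂ] (polydisc → ℂ) :=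
  have hC : ∀ c : ℂ, tilde (algebraMap ℂ L0 c) = algebraMap ℂ (polydisc → ℂ) c := fun c => by
    funext ζ
    have e : algebraMap ℂ L0 c = polyTorus (MvPolynomial.C c) := (polyTorusHom.commutes c).symm
    rw [e, tilde, pointEval_polyTorus]
    exact MvPolynomial.eval_C c
  { toFun := fun f => tilde f
    map_one' := by
      have h := hC 1
      rwa [map_one, map_one] at h
    map_zero' := by
      have h := hC 0
      rwa [map_zero, map_zero] at h
    map_add' := fun f g => funext fun ζ =>
      pointEval_add ζ (mem_smirnovTorusAlgebra.1 f.2) (mem_smirnovTorusAlgebra.1 g.2)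
    map_mul' := fun f g => funext fun ζ =>
      pointEval_mul ζ (mem_smirnovTorusAlgebra.1 f.2) (mem_smirnovTorusAlgebra.1 g.2)
    commutes' := hC }

lemma tildeHom_apply (f : smirnovTorusAlgebra) : tildeHom f = tilde (f : L0) := rfl

/-! ### The function `f̃` is holomorphic -/

lemma eventually_mul_edist_lt {f : L0} (C : ℝ) {ε : ℝ≥0∞} (hε : 0 < ε) :
    ∀ᶠ q in comap polyTorus (𝓝 f), ENNReal.ofReal C * edist f (polyTorus q) < ε := by
  have h2 : Tendsto (fun q => edist f (polyTorus q)) (comap polyTorus (𝓝 f)) (𝓝 (edist f f)) :=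
    tendsto_const_nhds.edist tendsto_comap
  rw [edist_self] at h2
  have h3 := ENNReal.Tendsto.const_mul h2 (Or.inr (ENNReal.ofReal_ne_top (r := C)))
  rw [mul_zero] at h3
  exact h3.eventually (gt_mem_nhds hε)

lemma norm_le_of_logSize_lt {x : ℂ} {ε : ℝ} (hε : 0 < ε)
    (h : logSize x < ENNReal.ofReal (Real.log (1 + ε))) : ‖x‖ < ε := by
  have h1 := (ENNReal.ofReal_lt_ofReal_iff_of_nonneg (log_one_add_norm_nonneg x)).1 h
  have h2 := (Real.log_lt_log_iff (by positivity) (by positivity)).1 h1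
  linarith

/-- Polynomials that converge to `f` in `L⁰` converge to `f̃` locally uniformly. -/
lemma exists_nhds_eventually_norm_sub_lt (x : polydisc) {f : L0} (hf : f ∈ smirnovTorus) {ε : ℝ}
    (hε : 0 < ε) :
    ∃ U ∈ 𝓝 x, ∀ᶠ q in comap polyTorus (𝓝 f), ∀ y ∈ U, ‖tilde f y - polyEval y q‖ < ε := by
  obtain ⟨C, hC, U, hU, H⟩ := exists_logSize_pointEval_sub_le x
  refine ⟨U, hU, ?_⟩
  filter_upwards [eventually_mul_edist_lt (f := f) C (ENNReal.ofReal_pos.2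
    (Real.log_pos (by linarith : 1 < 1 + ε)))] with q hq y hy
  refine norm_le_of_logSize_lt hε ((?_ : _ ≤ _).trans_lt hq)
  rw [← pointEval_polyTorus]
  exact H y hy f hf _ (polyTorus_mem q)

lemma isHolomorphic_tilde {f : L0} (hf : f ∈ smirnovTorus) : IsHolomorphic (tilde f) := by
  have := comap_polyTorus_neBot hf
  refine ⟨fun x => ?_, fun x₀ x => ?_⟩
  · obtain ⟨U, hU, h⟩ := exists_nhds_eventually_norm_sub_lt x hf one_pos
    obtain ⟨q, hq⟩ := h.exists
    obtain ⟨C, hC⟩ := (isDiscAlgebra_eval q).exists_bound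
    refine ⟨U, hU, 1 + C, fun y hy => ?_⟩
    have h1 := hC (fun n => (y : Ell1) n) fun n => (y.2 n).le
    have h2 := norm_add_le (tilde f y - polyEval y q) (polyEval y q)
    rw [sub_add_cancel] at h2
    have h3 := hq y hy
    change ‖polyEval y q‖ ≤ C at h1
    linarith
  · have hline : Continuous fun z : ℂ => (x₀ : Ell1) + z • x := by fun_prop
    have hV : IsOpen {z : ℂ | (x₀ : Ell1) + z • x ∈ polydisc} := isOpen_polydisc.preimage hline
    have hlim : TendstoLocallyUniformlyOn
        (fun (q : MvPolynomial ℕ ℂ) (z : ℂ) =>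
          MvPolynomial.eval (fun n => ((x₀ : Ell1) + z • x) n) q)
        (fun z : ℂ => Function.extend Subtype.val (tilde f) 0 ((x₀ : Ell1) + z • x))
        (comap polyTorus (𝓝 f)) {z : ℂ | (x₀ : Ell1) + z • x ∈ polydisc} := by
      rw [Metric.tendstoLocallyUniformlyOn_iff]
      intro ε hε z hz
      obtain ⟨U, hU, h⟩ := exists_nhds_eventually_norm_sub_lt ⟨_, hz⟩ hf hε
      obtain ⟨W, hW, hWU⟩ := mem_nhds_induced Subtype.val _ _ |>.1 hU
      refine ⟨_, inter_mem_nhdsWithin _ (hline.continuousAt.preimage_mem_nhds hW), ?_⟩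
      filter_upwards [h] with q hq t ht
      have h1 : Function.extend Subtype.val (tilde f) 0 ((x₀ : Ell1) + t • x) =
          tilde f ⟨(x₀ : Ell1) + t • x, ht.1⟩ :=
        Subtype.val_injective.extend_apply _ _ (⟨(x₀ : Ell1) + t • x, ht.1⟩ : polydisc)
      rw [h1, dist_eq_norm]
      exact hq _ (hWU ht.2)
    refine hlim.differentiableOn (Eventually.of_forall fun q => ?_) hV
    refine (differentiable_eval_mvPolynomial q fun n => ?_).differentiableOn
    have e : ∀ z : ℂ, ((x₀ : Ell1) + z • x) n = (x₀ : Ell1) n + z * x n := fun _ => rfl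
    simp only [e]
    fun_prop

/-! ### Radial dilations of `f̃` -/

lemma norm_radius_lt (r : Ioo (0 : ℝ) 1) : ‖((r : ℝ) : ℂ)‖ < 1 := by
  rw [Complex.norm_real, Real.norm_of_nonneg r.2.1.le]; exact r.2.2

lemma exists_seq_polyTorus {f : L0} (hf : f ∈ smirnovTorus) :
    ∃ q : ℕ → MvPolynomial ℕ ℂ, Tendsto (fun k => polyTorus (q k)) atTop (𝓝 f) := by
  obtain ⟨u, hu, hlim⟩ := mem_closure_iff_seq_limit.1 hf
  choose q hq using hu
  exact ⟨q, by simpa only [hq] using hlim⟩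

lemma tendsto_polyEval {f : L0} (hf : f ∈ smirnovTorus) {q : ℕ → MvPolynomial ℕ ℂ}
    (hq : Tendsto (fun k => polyTorus (q k)) atTop (𝓝 f)) (ζ : polydisc) :
    Tendsto (fun k => polyEval ζ (q k)) atTop (𝓝 (tilde f ζ)) :=
  (tendsto_pointEval ζ hf).comp (tendsto_comap_iff.2 hq)

lemma continuous_polyEval_radialPoint (r : Ioo (0 : ℝ) 1) (q : MvPolynomial ℕ ℂ) :
    Continuous fun w => polyEval (radialPoint r w) q :=
  (isDiscAlgebra_eval q).continuous_curve (norm_radius_lt r).le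

lemma measurable_dilate_tilde {f : L0} (hf : f ∈ smirnovTorus) (r : Ioo (0 : ℝ) 1) :
    Measurable (dilate (tilde f) r) := by
  obtain ⟨q, hq⟩ := exists_seq_polyTorus hf
  exact measurable_of_tendsto_metrizable
    (fun k => (continuous_polyEval_radialPoint r (q k)).measurable)
    (tendsto_pi_nhds.2 fun w => tendsto_polyEval hf hq (radialPoint r w))

lemma logNorm_coe_eq_edist (f : L0) : logNorm (f : MeasFun) = edist f 0 := by
  rw [L0_edist_eq, sub_zero]

lemma logNorm_dilate_tilde_le {f : L0} (hf : f ∈ smirnovTorus) (r : Ioo (0 : ℝ) 1) :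
    logNorm (dilate (tilde f) r) ≤ logNorm (f : MeasFun) := by
  obtain ⟨q, hq⟩ := exists_seq_polyTorus hf
  have h1 : ∀ w, logSize (dilate (tilde f) r w) =
      liminf (fun k => logSize (polyEval (radialPoint r w) (q k))) atTop := fun w =>
    ((continuous_logSize.tendsto _).comp (tendsto_polyEval hf hq (radialPoint r w))).liminf_eq.symm
  have h2 : ∀ k, ∫⁻ w, logSize (polyEval (radialPoint r w) (q k)) ∂torusMeasure ≤
      edist (polyTorus (q k)) 0 := fun k => by
    rw [← logNorm_coe_eq_edist, logNorm_congr (coeFn_polyTorus (q k))]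
    exact (isDiscAlgebra_eval (q k)).lintegral_curve_le (norm_radius_lt r)
  rw [logNorm_eq_lintegral, logNorm_coe_eq_edist]
  simp only [h1]
  refine (lintegral_liminf_le fun k => measurable_logSize.comp
    (continuous_polyEval_radialPoint r (q k)).measurable).trans ?_
  have h3 : Tendsto (fun k => edist (polyTorus (q k)) 0) atTop (𝓝 (edist f 0)) :=
    hq.edist tendsto_const_nhds
  rw [← h3.liminf_eq]
  exact liminf_le_liminf (Eventually.of_forall h2)

/-! ### Radial limits of Poisson integrals -/

/-- The Poisson kernel at the point `r` of the real axis, as a function of the angle. -/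
def angleKernel (r t : ℝ) : ℝ := (1 - r ^ 2) / (1 - 2 * r * Real.cos t + r ^ 2)

lemma angleKernel_denom_pos {r : ℝ} (hr : r ∈ Ioo (0 : ℝ) 1) (t : ℝ) :
    0 < 1 - 2 * r * Real.cos t + r ^ 2 := by
  have h1 : r * Real.cos t ≤ r * 1 := mul_le_mul_of_nonneg_left (Real.cos_le_one t) hr.1.le
  nlinarith [hr.1, hr.2, mul_pos (sub_pos.2 hr.2) (sub_pos.2 hr.2)]

lemma poisson_exp {r : ℝ} (t : ℝ) : poisson (r : ℂ) (Circle.exp t) = angleKernel r t := by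
  rw [poisson_eq, angleKernel, Complex.norm_real, Real.norm_eq_abs, sq_abs, Circle.coe_exp]
  congr 1
  rw [← Complex.normSq_eq_norm_sq, Complex.exp_mul_I, Complex.normSq_apply]
  simp only [← Complex.ofReal_cos, ← Complex.ofReal_sin, Complex.add_re, Complex.sub_re,
    Complex.mul_re, Complex.ofReal_re, Complex.I_re, Complex.ofReal_im, Complex.I_im,
    Complex.add_im, Complex.sub_im, Complex.mul_im]
  nlinarith [Real.sin_sq_add_cos_sq t]

lemma hasDerivAt_angleKernel {r : ℝ} (hr : r ∈ Ioo (0 : ℝ) 1) (t : ℝ) :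
    HasDerivAt (angleKernel r)
      (-((1 - r ^ 2) * (2 * r * Real.sin t)) / (1 - 2 * r * Real.cos t + r ^ 2) ^ 2) t := by
  have hD : HasDerivAt (fun t => 1 - 2 * r * Real.cos t + r ^ 2) (2 * r * Real.sin t) t := by
    have h := ((Real.hasDerivAt_cos t).const_mul (2 * r)).const_sub 1 |>.add_const (r ^ 2)
    convert! h using 1
    ring
  have h := (hasDerivAt_const t (1 - r ^ 2)).div hD (angleKernel_denom_pos hr t).ne'
  convert! h using 1
  ring

lemma contDiff_angleKernel {r : ℝ} (hr : r ∈ Ioo (0 : ℝ) 1) : ContDiff ℝ 1 (angleKernel r) := by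
  unfold angleKernel
  exact contDiff_const.div (by fun_prop) fun t => (angleKernel_denom_pos hr t).ne'

lemma angleKernel_nonneg {r : ℝ} (hr : r ∈ Ioo (0 : ℝ) 1) (t : ℝ) : 0 ≤ angleKernel r t :=
  div_nonneg (by nlinarith [hr.1, hr.2]) (angleKernel_denom_pos hr t).le

lemma le_angleKernel_denom {r : ℝ} (hr : r ∈ Ioo (0 : ℝ) 1) {t : ℝ} (ht : |t| ≤ Real.pi) :
    4 * r / Real.pi ^ 2 * t ^ 2 ≤ 1 - 2 * r * Real.cos t + r ^ 2 := by
  have h := Real.cos_le_one_sub_mul_cos_sq ht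
  have h2 := mul_le_mul_of_nonneg_left h hr.1.le
  have e : 4 * r / Real.pi ^ 2 * t ^ 2 = 2 * (r * (2 / Real.pi ^ 2 * t ^ 2)) := by ring
  rw [e]
  nlinarith [sq_nonneg (1 - r)]

lemma sq_mul_angleKernel_le {r : ℝ} (hr : r ∈ Ioo (0 : ℝ) 1) {t : ℝ} (ht : |t| ≤ Real.pi) :
    t ^ 2 * angleKernel r t ≤ (1 - r ^ 2) * Real.pi ^ 2 / (4 * r) := by
  have h1 := le_angleKernel_denom hr ht
  have hD := angleKernel_denom_pos hr t
  have hr0 := hr.1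
  have h3 : (0 : ℝ) ≤ 1 - r ^ 2 := by nlinarith [hr.1, hr.2]
  rw [angleKernel, ← mul_div_assoc, div_le_div_iff₀ hD (by positivity)]
  have e : t ^ 2 * (1 - r ^ 2) * (4 * r) =
      (1 - r ^ 2) * Real.pi ^ 2 * (4 * r / Real.pi ^ 2 * t ^ 2) := by
    field_simp
  rw [e]
  gcongr

lemma abs_mul_deriv_angleKernel_le {r : ℝ} (hr : r ∈ Ioo (0 : ℝ) 1) {t : ℝ} (ht : |t| ≤ Real.pi) :
    |t| * |deriv (angleKernel r) t| ≤ Real.pi ^ 2 / 2 * angleKernel r t := by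
  have h1 := le_angleKernel_denom hr ht
  have hD := angleKernel_denom_pos hr t
  have hr0 := hr.1
  have h3 : (0 : ℝ) ≤ 1 - r ^ 2 := by nlinarith [hr.1, hr.2]
  rw [(hasDerivAt_angleKernel hr t).deriv, angleKernel, abs_div, abs_neg, abs_mul, abs_mul,
    abs_of_nonneg h3, abs_of_pos (show 0 < 2 * r by positivity), abs_of_pos (pow_pos hD 2),
    ← mul_div_assoc, ← mul_div_assoc, div_le_div_iff₀ (pow_pos hD 2) hD]
  have hs : |t| * |Real.sin t| ≤ t ^ 2 := by
    rw [← sq_abs t, sq]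
    exact mul_le_mul_of_nonneg_left Real.abs_sin_le_abs (abs_nonneg t)
  have h4 : 2 * r * (|t| * |Real.sin t|) ≤ Real.pi ^ 2 / 2 * (1 - 2 * r * Real.cos t + r ^ 2) := by
    calc 2 * r * (|t| * |Real.sin t|) ≤ 2 * r * t ^ 2 := by gcongr
      _ = Real.pi ^ 2 / 2 * (4 * r / Real.pi ^ 2 * t ^ 2) := by field_simp; ring
      _ ≤ _ := by gcongr
  calc _ = (1 - r ^ 2) * (1 - 2 * r * Real.cos t + r ^ 2) * (2 * r * (|t| * |Real.sin t|)) := by ring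
    _ ≤ (1 - r ^ 2) * (1 - 2 * r * Real.cos t + r ^ 2) *
        (Real.pi ^ 2 / 2 * (1 - 2 * r * Real.cos t + r ^ 2)) := by gcongr
    _ = _ := by ring

/-- Circle integrals as integrals over `[-π, π]`. -/
lemma integral_circleMeasure_angle (f : Circle → ℝ) (hf : AEStronglyMeasurable f circleMeasure) :
    ∫ u, f u ∂circleMeasure = (2 * Real.pi)⁻¹ * ∫ t in -Real.pi..Real.pi, f (Circle.exp t) := by
  have hm : Measurable (fun θ : ℝ => Circle.exp θ) := Circle.exp.continuous.measurable
  have hf' : AEStronglyMeasurable f ((volume.restrict (Ioc (0 : ℝ) (2 * Real.pi))).map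
      (fun θ : ℝ => Circle.exp θ)) := by
    refine hf.mono_ac ?_
    rw [circleMeasure]
    exact Measure.absolutelyContinuous_smul (ENNReal.inv_ne_zero.2 ENNReal.ofReal_ne_top)
  have hp : Function.Periodic (fun t : ℝ => f (Circle.exp t)) (2 * Real.pi) := fun t => by
    simp only [Circle.exp_add_two_pi]
  have h := hp.intervalIntegral_add_eq 0 (-Real.pi)
  rw [zero_add, show -Real.pi + 2 * Real.pi = Real.pi by ring] at h
  rw [circleMeasure, integral_smul_measure, integral_map hm.aemeasurable hf', ← h,
    intervalIntegral.integral_of_le Real.two_pi_pos.le, ENNReal.toReal_inv,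
    ENNReal.toReal_ofReal Real.two_pi_pos.le, smul_eq_mul]

lemma integral_angleKernel {r : ℝ} (hr : r ∈ Ioo (0 : ℝ) 1) :
    ∫ t in -Real.pi..Real.pi, angleKernel r t = 2 * Real.pi := by
  have hr' : ‖(r : ℂ)‖ < 1 := by
    rw [Complex.norm_real, Real.norm_of_nonneg hr.1.le]; exact hr.2
  have h := integral_poisson hr'
  rw [integral_circleMeasure_angle _ (continuous_poisson hr').aestronglyMeasurable] at h
  simp only [poisson_exp] at h
  rw [inv_mul_eq_one₀ Real.two_pi_pos.ne'] at h
  exact h.symm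

/-- If the primitive of `g` that vanishes at `0` is `o(t)`, then the integrals of `g` against the
Poisson kernel tend to zero: integrate by parts, and use that `t K'(t)` is dominated by `K(t)`. -/
lemma tendsto_integral_angleKernel_mul {g : ℝ → ℝ}
    (hg : IntervalIntegrable g volume (-Real.pi) Real.pi)
    (hG : HasDerivAt (fun t => ∫ x in (0 : ℝ)..t, g x) 0 0) :
    Tendsto (fun r => ∫ t in -Real.pi..Real.pi, angleKernel r t * g t) (𝓝[<] 1) (𝓝 0) := by
  set G : ℝ → ℝ := fun t => ∫ x in (0 : ℝ)..t, g x with hGdef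
  have hpi := Real.pi_pos
  have h0mem : (0 : ℝ) ∈ uIcc (-Real.pi) Real.pi := by
    rw [uIcc_of_le (by linarith)]; exact ⟨by linarith, by linarith⟩
  have hGac : AbsolutelyContinuousOnInterval G (-Real.pi) Real.pi :=
    hg.absolutelyContinuousOnInterval_intervalIntegral h0mem
  have hG0 : G 0 = 0 := by simp [G]
  obtain ⟨M, hM⟩ := hGac.exists_bound
  have hM0 : 0 ≤ M := (norm_nonneg _).trans (hM 0 h0mem)
  have hGb : ∀ ε : ℝ, 0 < ε → ∃ B : ℝ, 0 ≤ B ∧ ∀ t, |t| ≤ Real.pi →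
      |G t| ≤ |t| * (ε + B * t ^ 2) := by
    intro ε hε
    have h1 := hG.isLittleO
    simp only [hG0, smul_zero, sub_zero] at h1
    obtain ⟨δ, hδ, h2⟩ := Metric.eventually_nhds_iff.1 (h1.def hε)
    refine ⟨M / δ ^ 3, by positivity, fun t ht => ?_⟩
    rcases lt_or_ge |t| δ with h3 | h3
    · have h4 := h2 (y := t) (by simpa [Real.dist_eq] using h3)
      rw [Real.norm_eq_abs, Real.norm_eq_abs] at h4
      have h5 : 0 ≤ |t| * (M / δ ^ 3 * t ^ 2) := by positivity
      calc |G t| ≤ ε * |t| := h4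
        _ ≤ _ := by linarith
    · have h4 : |G t| ≤ M := by
        refine hM t ?_
        rw [uIcc_of_le (by linarith)]
        exact abs_le.1 ht
      have h5 : M ≤ M / δ ^ 3 * |t| ^ 3 := by
        rw [div_mul_eq_mul_div, le_div_iff₀ (by positivity)]
        gcongr
      have h6 : |t| * (M / δ ^ 3 * t ^ 2) = M / δ ^ 3 * |t| ^ 3 := by rw [← sq_abs]; ring
      have h7 : 0 ≤ |t| * ε := by positivity
      linarith
  -- integrating by parts moves the derivative onto the kernel, whose variation is controlled
  have hparts : ∀ r ∈ Ioo (0 : ℝ) 1, ∫ t in -Real.pi..Real.pi, angleKernel r t * g t =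
      angleKernel r Real.pi * G Real.pi - angleKernel r (-Real.pi) * G (-Real.pi) -
        ∫ t in -Real.pi..Real.pi, deriv (angleKernel r) t * G t := by
    intro r hr
    have hK : AbsolutelyContinuousOnInterval (angleKernel r) (-Real.pi) Real.pi :=
      (contDiff_angleKernel hr).contDiffOn.absolutelyContinuousOnInterval
    rw [← hK.integral_mul_deriv_eq_deriv_mul hGac]
    refine intervalIntegral.integral_congr_ae ?_
    filter_upwards [hg.ae_hasDerivAt_integral] with t ht ht'
    rw [(ht (uIoc_subset_uIcc ht') 0 h0mem).deriv]
  have hest : ∀ ε : ℝ, 0 < ε → ∃ B : ℝ, ∀ r ∈ Ioo (0 : ℝ) 1,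
      |∫ t in -Real.pi..Real.pi, angleKernel r t * g t| ≤
        (1 - r ^ 2) / (1 + r) ^ 2 * (2 * M) + Real.pi ^ 2 / 2 * (ε * (2 * Real.pi) +
          2 * Real.pi * (B * ((1 - r ^ 2) * Real.pi ^ 2 / (4 * r)))) := by
    intro ε hε
    obtain ⟨B, hB0, hB⟩ := hGb ε hε
    refine ⟨B, fun r hr => ?_⟩
    rw [hparts r hr]
    have hKπ : angleKernel r Real.pi = (1 - r ^ 2) / (1 + r) ^ 2 := by
      rw [angleKernel, Real.cos_pi]; congr 1; ring
    have hKπ' : angleKernel r (-Real.pi) = (1 - r ^ 2) / (1 + r) ^ 2 := by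
      rw [angleKernel, Real.cos_neg, Real.cos_pi]; congr 1; ring
    have hK0 : 0 ≤ (1 - r ^ 2) / (1 + r) ^ 2 := hKπ ▸ angleKernel_nonneg hr _
    have h1 : |angleKernel r Real.pi * G Real.pi - angleKernel r (-Real.pi) * G (-Real.pi)| ≤
        (1 - r ^ 2) / (1 + r) ^ 2 * (2 * M) := by
      rw [hKπ, hKπ', ← mul_sub, abs_mul, abs_of_nonneg hK0]
      refine mul_le_mul_of_nonneg_left ((abs_sub _ _).trans ?_) hK0
      have h2 := hM Real.pi right_mem_uIcc
      have h3 := hM (-Real.pi) left_mem_uIcc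
      rw [Real.norm_eq_abs] at h2 h3
      linarith
    have h2 : |∫ t in -Real.pi..Real.pi, deriv (angleKernel r) t * G t| ≤
        ∫ t in -Real.pi..Real.pi, Real.pi ^ 2 / 2 * (ε * angleKernel r t +
          B * ((1 - r ^ 2) * Real.pi ^ 2 / (4 * r))) := by
      have hKi : Continuous (angleKernel r) := (contDiff_angleKernel hr).continuous
      rw [← Real.norm_eq_abs]
      refine intervalIntegral.norm_integral_le_of_norm_le (by linarith) ?_
        (Continuous.intervalIntegrable (by fun_prop) _ _)
      refine ae_of_all _ fun t ht => ?_
      have ht' : |t| ≤ Real.pi := abs_le.2 ⟨ht.1.le, ht.2⟩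
      have h3 := abs_mul_deriv_angleKernel_le hr ht'
      have h4 := sq_mul_angleKernel_le hr ht'
      rw [norm_mul, Real.norm_eq_abs, Real.norm_eq_abs]
      calc |deriv (angleKernel r) t| * |G t|
          ≤ |deriv (angleKernel r) t| * (|t| * (ε + B * t ^ 2)) := by gcongr; exact hB t ht'
        _ = |t| * |deriv (angleKernel r) t| * (ε + B * t ^ 2) := by ring
        _ ≤ Real.pi ^ 2 / 2 * angleKernel r t * (ε + B * t ^ 2) := by gcongr
        _ = Real.pi ^ 2 / 2 * (ε * angleKernel r t + B * (t ^ 2 * angleKernel r t)) := by ring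
        _ ≤ _ := by gcongr
    have h3 : ∫ t in -Real.pi..Real.pi, Real.pi ^ 2 / 2 * (ε * angleKernel r t +
          B * ((1 - r ^ 2) * Real.pi ^ 2 / (4 * r))) = Real.pi ^ 2 / 2 * (ε * (2 * Real.pi) +
          2 * Real.pi * (B * ((1 - r ^ 2) * Real.pi ^ 2 / (4 * r)))) := by
      have hKi : Continuous (angleKernel r) := (contDiff_angleKernel hr).continuous
      have i1 : IntervalIntegrable (fun t => ε * angleKernel r t) volume (-Real.pi) Real.pi :=
        (continuous_const.mul hKi).intervalIntegrable _ _
      have i2 : IntervalIntegrable (fun _ : ℝ => B * ((1 - r ^ 2) * Real.pi ^ 2 / (4 * r))) volume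
        (-Real.pi) Real.pi := continuous_const.intervalIntegrable _ _
      rw [intervalIntegral.integral_const_mul, intervalIntegral.integral_add i1 i2,
        intervalIntegral.integral_const_mul, integral_angleKernel hr,
        intervalIntegral.integral_const, smul_eq_mul]
      ring
    rw [h3] at h2
    exact (abs_sub _ _).trans (add_le_add h1 h2)
  rw [tendsto_zero_iff_abs_tendsto_zero]
  refine Metric.tendsto_nhds.2 fun ε hε => ?_
  set η : ℝ := ε / (2 * Real.pi ^ 3) with hη
  have hη0 : 0 < η := by positivity
  obtain ⟨B, hB⟩ := hest η hη0
  have hlim : Tendsto (fun r : ℝ => (1 - r ^ 2) / (1 + r) ^ 2 * (2 * M) + Real.pi ^ 2 / 2 *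
      (η * (2 * Real.pi) + 2 * Real.pi * (B * ((1 - r ^ 2) * Real.pi ^ 2 / (4 * r)))))
      (𝓝[<] 1) (𝓝 (ε / 2)) := by
    have hc : ContinuousAt (fun r : ℝ => (1 - r ^ 2) / (1 + r) ^ 2 * (2 * M) + Real.pi ^ 2 / 2 *
      (η * (2 * Real.pi) + 2 * Real.pi * (B * ((1 - r ^ 2) * Real.pi ^ 2 / (4 * r))))) 1 := by
      have h1 : (1 + (1 : ℝ)) ^ 2 ≠ 0 := by norm_num
      have h2 : 4 * (1 : ℝ) ≠ 0 := by norm_num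
      fun_prop (disch := assumption)
    have h := hc.tendsto
    have e : ε / 2 = (1 - (1 : ℝ) ^ 2) / (1 + 1) ^ 2 * (2 * M) + Real.pi ^ 2 / 2 *
      (η * (2 * Real.pi) + 2 * Real.pi * (B * ((1 - (1 : ℝ) ^ 2) * Real.pi ^ 2 / (4 * 1)))) := by
      rw [hη]; field_simp; ring
    rw [e]
    exact h.mono_left nhdsWithin_le_nhds
  filter_upwards [hlim.eventually (gt_mem_nhds (half_lt_self hε)),
    Ioo_mem_nhdsLT (zero_lt_one (α := ℝ))] with r h1 hr
  rw [Real.dist_eq, sub_zero, Function.comp_apply, abs_abs]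
  exact (hB r hr).trans_lt h1

/-- **Fatou's theorem** for Poisson integrals. -/
lemma ae_tendsto_integral_poisson {u : Circle → ℝ} (hu : Integrable u circleMeasure) :
    ∀ᵐ θ : ℝ, Tendsto (fun r : ℝ => ∫ v, poisson r v * u (v * Circle.exp θ) ∂circleMeasure)
      (𝓝[<] 1) (𝓝 (u (Circle.exp θ))) := by
  have hm : Measurable (fun θ : ℝ => Circle.exp θ) := Circle.exp.continuous.measurable
  set h : ℝ → ℝ := fun t => u (Circle.exp t) with hh
  have hp : Function.Periodic h (2 * Real.pi) := fun t => by
    simp only [hh, Circle.exp_add_two_pi]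
  have hint0 : IntervalIntegrable h volume 0 (2 * Real.pi) := by
    rw [intervalIntegrable_iff_integrableOn_Ioc_of_le Real.two_pi_pos.le]
    rw [circleMeasure, integrable_smul_measure (ENNReal.inv_ne_zero.2 ENNReal.ofReal_ne_top)
      (by simp [Real.pi_pos])] at hu
    exact (integrable_map_measure hu.aestronglyMeasurable hm.aemeasurable).1 hu
  have hint : ∀ a b, IntervalIntegrable h volume a b :=
    hp.intervalIntegrable₀ Real.two_pi_pos.ne' hint0
  have hloc : LocallyIntegrable h volume := by
    intro x
    refine ⟨Icc (x - 1) (x + 1), Icc_mem_nhds (by linarith) (by linarith), ?_⟩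
    rw [integrableOn_Icc_iff_integrableOn_Ioc]
    exact (intervalIntegrable_iff_integrableOn_Ioc_of_le (by linarith)).1 (hint _ _)
  filter_upwards [LocallyIntegrable.ae_hasDerivAt_integral hloc] with θ hθ
  have h1 := hθ θ
  set g : ℝ → ℝ := fun t => h (t + θ) - h θ with hg
  have hgi : ∀ a b, IntervalIntegrable (fun t => h (t + θ)) volume a b := fun a b => by
    have := (hint (a + θ) (b + θ)).comp_add_right θ
    simpa using this
  have hG : HasDerivAt (fun t => ∫ x in (0 : ℝ)..t, g x) 0 0 := by
    have e : (fun t => ∫ x in (0 : ℝ)..t, g x) =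
        fun t => (∫ x in θ..t + θ, h x) - t * h θ := by
      funext t
      simp only [hg]
      rw [intervalIntegral.integral_sub (hgi _ _) (by simp),
        intervalIntegral.integral_comp_add_right, zero_add]
      simp
    rw [e]
    have h2 : HasDerivAt (fun t => ∫ x in θ..t + θ, h x) (h θ) 0 := by
      have h3 : HasDerivAt (fun t => ∫ x in θ..t, h x) (h θ) (0 + θ) := by rwa [zero_add]
      exact h3.comp_add_const 0 θ
    have h4 := h2.fun_sub ((hasDerivAt_id' (0 : ℝ)).mul_const (h θ))
    simpa using h4
  have h5 := tendsto_integral_angleKernel_mul ((hgi _ _).sub (by simp)) hG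
  have h6 := (h5.const_mul (2 * Real.pi)⁻¹).add_const (h θ)
  rw [mul_zero, zero_add] at h6
  refine h6.congr' ?_
  filter_upwards [Ioo_mem_nhdsLT (zero_lt_one (α := ℝ))] with r hr
  have hr' : ‖(r : ℂ)‖ < 1 := by
    rw [Complex.norm_real, Real.norm_of_nonneg hr.1.le]; exact hr.2
  have hKi : Continuous (angleKernel r) := (contDiff_angleKernel hr).continuous
  have hmp : MeasurePreserving (fun v => v * Circle.exp θ) circleMeasure circleMeasure := by
    simpa only [mul_comm] using measurePreserving_circle_mul (Circle.exp θ)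
  have hsm : AEStronglyMeasurable (fun v => poisson r v * u (v * Circle.exp θ)) circleMeasure :=
    (continuous_poisson hr').aestronglyMeasurable.mul
      (hu.aestronglyMeasurable.comp_measurePreserving hmp)
  rw [integral_circleMeasure_angle _ hsm]
  simp only [poisson_exp, ← Circle.exp_add]
  change (2 * Real.pi)⁻¹ * (∫ t in -Real.pi..Real.pi, angleKernel r t * g t) + h θ =
    (2 * Real.pi)⁻¹ * ∫ t in -Real.pi..Real.pi, angleKernel r t * h (t + θ)
  have e1 : ∀ t, angleKernel r t * g t = angleKernel r t * h (t + θ) - angleKernel r t * h θ :=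
    fun t => by simp only [hg]; ring
  simp_rw [e1]
  have i2 : IntervalIntegrable (fun t => angleKernel r t * h θ) volume (-Real.pi) Real.pi :=
    (hKi.mul continuous_const).intervalIntegrable _ _
  rw [intervalIntegral.integral_sub ((hgi _ _).continuousOn_mul hKi.continuousOn) i2,
    intervalIntegral.integral_mul_const,
    integral_angleKernel hr, mul_sub, ← mul_assoc, inv_mul_cancel₀ Real.two_pi_pos.ne', one_mul,
    sub_add_cancel]

/-! ### Holomorphic functions on open subsets of a normed space -/

section Holomorphic

variable {E : Type*} [NormedAddCommGroup E] [NormedSpace ℂ E] {V : Set E} {F : V → ℂ}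

lemma extend_val {E : Type*} {V : Set E} (F : V → ℂ) (x : V) : Function.extend Subtype.val F 0 (x : E) = F x :=
  Subtype.val_injective.extend_apply _ _ x

/-- A function that is bounded near a point and holomorphic along complex lines is Lipschitz near
that point, by the Schwarz lemma. -/
lemma IsHolomorphic.exists_lipschitz (h : IsHolomorphic F) (hV : IsOpen V) (x : V) :
    ∃ K : ℝ, ∃ U ∈ 𝓝 (x : E), U ⊆ V ∧ ∀ y ∈ U, ∀ z ∈ U,
      ‖Function.extend Subtype.val F 0 y - Function.extend Subtype.val F 0 z‖ ≤ K * ‖y - z‖ := by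
  obtain ⟨U, hU, C, hC⟩ := h.1 x
  obtain ⟨W, hW, hWU⟩ := (mem_nhds_induced Subtype.val _ _).1 hU
  obtain ⟨δ, hδ, hball⟩ := Metric.mem_nhds_iff.1 (inter_mem hW (hV.mem_nhds x.2))
  have hbd : ∀ y ∈ Metric.ball (x : E) δ, ‖Function.extend Subtype.val F 0 y‖ ≤ C := fun y hy => by
    rw [extend_val F ⟨y, (hball hy).2⟩]
    exact hC _ (hWU (hball hy).1)
  refine ⟨2 * C / (δ / 2), Metric.ball x (δ / 4), Metric.ball_mem_nhds _ (by positivity),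
    fun y hy => (hball (Metric.ball_subset_ball (by linarith) hy)).2, fun y hy z hz => ?_⟩
  rcases eq_or_ne y z with rfl | hyz
  · simp
  have hd : 0 < ‖y - z‖ := norm_pos_iff.2 (sub_ne_zero.2 hyz)
  rw [Metric.mem_ball, dist_eq_norm] at hy hz
  have hlt : ‖y - z‖ < δ / 2 := by
    have := norm_sub_le (y - x) (z - x)
    rw [sub_sub_sub_cancel_right] at this
    linarith
  -- the line through the two points stays in the ball up to the parameter `(δ / 2) / ‖y - z‖`
  have hmem : ∀ t ∈ Metric.ball (0 : ℂ) (δ / 2 / ‖y - z‖),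
      z + t • (y - z) ∈ Metric.ball (x : E) δ := fun t ht => by
    rw [mem_ball_zero_iff, lt_div_iff₀ hd] at ht
    rw [Metric.mem_ball, dist_eq_norm]
    have := norm_add_le (z - x) (t • (y - z))
    rw [norm_smul] at this
    rw [add_sub_right_comm]
    linarith
  have hzV : z ∈ V := (hball (by rw [Metric.mem_ball, dist_eq_norm]; linarith)).2
  have h1 : (1 : ℂ) ∈ Metric.ball (0 : ℂ) (δ / 2 / ‖y - z‖) := by
    rw [mem_ball_zero_iff, norm_one, one_lt_div hd]
    exact hlt
  have h0 : (0 : ℂ) ∈ Metric.ball (0 : ℂ) (δ / 2 / ‖y - z‖) := Metric.mem_ball_self (by positivity)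
  have key := Complex.dist_le_div_mul_dist_of_mapsTo_ball (R₂ := 2 * C)
    ((h.2 ⟨z, hzV⟩ (y - z)).mono fun t ht => (hball (hmem t ht)).2) (fun t ht => by
      rw [Metric.mem_closedBall, dist_eq_norm]
      have := norm_sub_le (Function.extend Subtype.val F 0 (z + t • (y - z)))
        (Function.extend Subtype.val F 0 (z + (0 : ℂ) • (y - z)))
      have := hbd _ (hmem t ht)
      have := hbd _ (hmem 0 h0)
      linarith) h1
  rw [dist_eq_norm, dist_zero_right, norm_one] at key
  simp only [one_smul, add_sub_cancel, zero_smul, add_zero] at key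
  refine key.trans_eq ?_
  field_simp

lemma IsHolomorphic.continuousAt (h : IsHolomorphic F) (hV : IsOpen V) (x : V) :
    ContinuousAt (Function.extend Subtype.val F 0) (x : E) := by
  obtain ⟨K, U, hU, -, H⟩ := h.exists_lipschitz hV x
  rw [ContinuousAt, tendsto_iff_norm_sub_tendsto_zero]
  have h1 : Tendsto (fun y : E => K * ‖y - x‖) (𝓝 x) (𝓝 0) := by
    have : Continuous fun y : E => K * ‖y - x‖ := by fun_prop
    simpa using this.tendsto (x : E)
  refine squeeze_zero' (Eventually.of_forall fun _ => norm_nonneg _) ?_ h1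
  filter_upwards [hU] with y hy
  exact H y hy x (mem_of_mem_nhds hU)

/-- The chain rule for a holomorphic curve: near a point it differs from its tangent line by a term
of the second order, which the Lipschitz bound absorbs. -/
lemma IsHolomorphic.differentiableAt_comp (h : IsHolomorphic F) (hV : IsOpen V) {γ : ℂ → E} {t : ℂ}
    (hγ : DifferentiableAt ℂ γ t) (ht : γ t ∈ V) :
    DifferentiableAt ℂ (fun z => Function.extend Subtype.val F 0 (γ z)) t := by
  set G := Function.extend Subtype.val F (0 : E → ℂ) with hG
  obtain ⟨K, U, hU, -, H⟩ := h.exists_lipschitz hV ⟨γ t, ht⟩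
  have hv := hγ.hasDerivAt
  set v := deriv γ t
  have hline : ContinuousAt (fun z : ℂ => γ t + (z - t) • v) t := by fun_prop
  have hl : DifferentiableAt ℂ (fun z : ℂ => G (γ t + z • v)) (t - t) := by
    refine (h.2 ⟨γ t, ht⟩ v).differentiableAt ?_
    rw [sub_self]
    have h1 : Continuous fun z : ℂ => γ t + z • v := by fun_prop
    exact (hV.preimage h1).mem_nhds (by simpa using ht)
  have hl' : HasDerivAt (fun z : ℂ => G (γ t + (z - t) • v))
      (deriv (fun z : ℂ => G (γ t + z • v)) (t - t)) t := by
    simpa [Function.comp_def] using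
      hl.hasDerivAt.comp (h := fun z => z - t) t ((hasDerivAt_id' t).sub_const t)
  refine HasDerivAt.differentiableAt
    (f' := deriv (fun z : ℂ => G (γ t + z • v)) (t - t)) ?_
  rw [hasDerivAt_iff_isLittleO] at hl' hv ⊢
  have h2 : (fun z => G (γ z) - G (γ t + (z - t) • v)) =o[𝓝 t] fun z => z - t := by
    refine Asymptotics.IsBigO.trans_isLittleO ?_ hv
    refine Asymptotics.IsBigO.of_bound K ?_
    have hU2 : U ∈ 𝓝 (γ t + (t - t) • v) := by simpa using hU
    filter_upwards [hγ.continuousAt.preimage_mem_nhds hU, hline.preimage_mem_nhds hU2]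
      with z h3 h4
    rw [sub_sub]
    exact H _ h3 _ h4
  refine (h2.add hl').congr_left fun z => ?_
  simp only [sub_self, zero_smul, add_zero]
  abel

end Holomorphic

/-! ### Dilations of a holomorphic function on `ℓ¹ ∩ 𝔻^∞` -/

/-- The point `(ρ ζ₁, ρ² ζ₂, …)` of `ℓ¹`, for a bounded sequence `ζ` and `0 ≤ ρ < 1`. -/
def scale (ρ : ℝ) (ζ : ℕ → ℂ) : Ell1 :=
  ∑' n, lp.single 1 n ((ρ : ℂ) ^ (n + 1) * ζ n)

lemma scale_eq_of_forall {ρ : ℝ} {ζ : ℕ → ℂ} {x : Ell1} (h : ∀ n, x n = (ρ : ℂ) ^ (n + 1) * ζ n) :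
    scale ρ ζ = x := by
  have := lp.hasSum_single (p := 1) ENNReal.one_ne_top x
  simp only [h] at this
  exact this.tsum_eq

lemma norm_single_scale_le (ρ : Ioo (0 : ℝ) 1) {ζ : ℕ → ℂ} (hζ : ζ ∈ closedPolydisc) (n : ℕ) :
    ‖(lp.single 1 n (((ρ : ℝ) : ℂ) ^ (n + 1) * ζ n) : Ell1)‖ ≤ (ρ : ℝ) ^ (n + 1) := by
  rw [lp.norm_single one_pos, norm_mul, norm_pow, Complex.norm_real, Real.norm_of_nonneg ρ.2.1.le]
  exact mul_le_of_le_one_right (pow_nonneg ρ.2.1.le _) (hζ n)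

lemma summable_pow_succ (ρ : Ioo (0 : ℝ) 1) : Summable fun n : ℕ => (ρ : ℝ) ^ (n + 1) :=
  (summable_nat_add_iff 1).2 (summable_geometric_of_lt_one ρ.2.1.le ρ.2.2)

lemma scale_apply (ρ : Ioo (0 : ℝ) 1) {ζ : ℕ → ℂ} (hζ : ζ ∈ closedPolydisc) (n : ℕ) :
    scale ρ ζ n = ((ρ : ℝ) : ℂ) ^ (n + 1) * ζ n := by
  have hx : Memℓp (fun n => ((ρ : ℝ) : ℂ) ^ (n + 1) * ζ n) 1 := by
    refine memℓp_gen ?_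
    simp only [ENNReal.toReal_one, Real.rpow_one]
    refine Summable.of_nonneg_of_le (fun _ => norm_nonneg _) (fun n => ?_) (summable_pow_succ ρ)
    rw [norm_mul, norm_pow, Complex.norm_real, Real.norm_of_nonneg ρ.2.1.le]
    exact mul_le_of_le_one_right (pow_nonneg ρ.2.1.le _) (hζ n)
  rw [scale_eq_of_forall (x := (⟨_, hx⟩ : Ell1)) fun n => rfl]

lemma scale_mem (ρ : Ioo (0 : ℝ) 1) {ζ : ℕ → ℂ} (hζ : ζ ∈ closedPolydisc) :
    scale ρ ζ ∈ polydisc := fun n => by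
  rw [scale_apply ρ hζ, norm_mul, norm_pow, Complex.norm_real, Real.norm_of_nonneg ρ.2.1.le]
  exact (mul_le_of_le_one_right (pow_nonneg ρ.2.1.le _) (hζ n)).trans_lt
    (pow_lt_one₀ ρ.2.1.le ρ.2.2 (Nat.succ_ne_zero n))

lemma continuousOn_scale (ρ : Ioo (0 : ℝ) 1) : ContinuousOn (scale ρ) closedPolydisc := by
  refine continuousOn_tsum (fun n => ?_) (summable_pow_succ ρ)
    fun n ζ hζ => norm_single_scale_le ρ hζ n
  have h := (lp.singleContinuousLinearMap ℂ (fun _ : ℕ => ℂ) 1 n).continuous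
  exact (h.comp (by fun_prop : Continuous fun ζ : ℕ → ℂ => ((ρ : ℝ) : ℂ) ^ (n + 1) * ζ n)).continuousOn

lemma differentiableOn_scale (ρ : Ioo (0 : ℝ) 1) {f : ℂ → ℕ → ℂ}
    (hf : ∀ n, Differentiable ℂ fun z => f z n)
    (hm : ∀ z ∈ Metric.ball (0 : ℂ) 1, f z ∈ closedPolydisc) :
    DifferentiableOn ℂ (fun z => scale ρ (f z)) (Metric.ball 0 1) := by
  refine Complex.differentiableOn_tsum_of_summable_norm (summable_pow_succ ρ) (fun n => ?_)
    Metric.isOpen_ball fun n z hz => norm_single_scale_le ρ (hm z hz) n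
  have h := (lp.singleContinuousLinearMap ℂ (fun _ : ℕ => ℂ) 1 n).differentiable
  exact (h.comp ((hf n).const_mul (((ρ : ℝ) : ℂ) ^ (n + 1)))).differentiableOn

/-- The dilation `ζ ↦ F(ρ ζ₁, ρ² ζ₂, …)` of a function on `ℓ¹ ∩ 𝔻^∞`, defined on the closed
polydisc (with junk values outside). -/
def scaled (F : polydisc → ℂ) (ρ : ℝ) (ζ : ℕ → ℂ) : ℂ :=
  Function.extend Subtype.val F 0 (scale ρ ζ)

lemma IsHolomorphic.isDiscAlgebra_scaled {F : polydisc → ℂ} (h : IsHolomorphic F)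
    (ρ : Ioo (0 : ℝ) 1) : IsDiscAlgebra (scaled F ρ) := by
  have hd : ∀ f : ℂ → ℕ → ℂ, (∀ n, Differentiable ℂ fun z => f z n) →
      (∀ z ∈ Metric.ball (0 : ℂ) 1, f z ∈ closedPolydisc) →
      DifferentiableOn ℂ (fun z => scaled F ρ (f z)) (Metric.ball 0 1) := by
    intro f hf hm z hz
    exact (h.differentiableAt_comp isOpen_polydisc
      ((differentiableOn_scale ρ hf hm).differentiableAt (Metric.isOpen_ball.mem_nhds hz))
      (scale_mem ρ (hm z hz))).differentiableWithinAt
  refine ⟨fun ζ hζ => ?_, fun ζ hζ n => ?_, fun w => ?_⟩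
  · exact ContinuousAt.comp_continuousWithinAt
      (h.continuousAt isOpen_polydisc ⟨scale ρ ζ, scale_mem ρ hζ⟩) (continuousOn_scale ρ ζ hζ)
  · refine hd _ (fun m => ?_) fun z hz => update_mem hζ n (by simpa using (mem_ball_zero_iff.1 hz).le)
    rcases eq_or_ne m n with rfl | hmn
    · simp
    · simp [hmn]
  · refine hd _ (fun m => ?_) fun z hz => curve_mem w (mem_ball_zero_iff.1 hz).le
    unfold curve
    fun_prop

lemma dilate_eq_scaled (F : polydisc → ℂ) (r : Ioo (0 : ℝ) 1) (w : Torus) :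
    dilate F r w = scaled F r (torusPoint w) := by
  have h : scale r (torusPoint w) = radialPoint r w := scale_eq_of_forall fun n => rfl
  rw [dilate, scaled, h, extend_val]

lemma dilate_eq_scaled_curve (F : polydisc → ℂ) (r ρ : Ioo (0 : ℝ) 1) (w : Torus) :
    dilate F r w = scaled F ρ (curve w (((r : ℝ) / ρ : ℝ) : ℂ)) := by
  have h : scale ρ (curve w (((r : ℝ) / ρ : ℝ) : ℂ)) = radialPoint r w :=
    scale_eq_of_forall fun n => by
      have h0 : ((ρ : ℝ) : ℂ) ≠ 0 := Complex.ofReal_ne_zero.2 ρ.2.1.ne'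
      change ((r : ℝ) : ℂ) ^ (n + 1) * (w n : ℂ) = _
      rw [curve, ← mul_assoc, ← mul_pow]
      push_cast
      rw [mul_div_cancel₀ _ h0]
  rw [dilate, scaled, h, extend_val]

lemma IsHolomorphic.continuous_dilate {F : polydisc → ℂ} (h : IsHolomorphic F)
    (r : Ioo (0 : ℝ) 1) : Continuous (dilate F r) := by
  exact (h.isDiscAlgebra_scaled r).continuous_torus.congr fun w => (dilate_eq_scaled F r w).symm

lemma IsHolomorphic.continuous_dilate_radius {F : polydisc → ℂ} (h : IsHolomorphic F) (w : Torus) :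
    Continuous fun r => dilate F r w := by
  refine continuous_iff_continuousAt.2 fun r => ?_
  obtain ⟨ρ, hrρ, hρ⟩ := exists_between r.2.2
  let ρ' : Ioo (0 : ℝ) 1 := ⟨ρ, r.2.1.trans hrρ, hρ⟩
  simp only [dilate_eq_scaled_curve F _ ρ' w]
  have hc : Continuous fun s : Ioo (0 : ℝ) 1 => curve w (((s : ℝ) / ρ : ℝ) : ℂ) :=
    (continuous_curve w).comp (Complex.continuous_ofReal.comp (by fun_prop))
  have hr : ‖(((r : ℝ) / ρ : ℝ) : ℂ)‖ < 1 := by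
    rw [Complex.norm_real, Real.norm_of_nonneg (div_nonneg r.2.1.le ρ'.2.1.le),
      div_lt_one ρ'.2.1]
    exact hrρ
  have hd := (h.isDiscAlgebra_scaled ρ').radial w
  exact ContinuousAt.comp (f := fun s : Ioo (0 : ℝ) 1 => (((s : ℝ) / ρ : ℝ) : ℂ))
    (hd.differentiableAt (Metric.isOpen_ball.mem_nhds (mem_ball_zero_iff.2 hr))).continuousAt
    (Complex.continuous_ofReal.comp (by fun_prop)).continuousAt

lemma tendsto_scale (ζ : polydisc) :
    Tendsto (fun ρ : ℝ => scale ρ fun n => (ζ : Ell1) n) (𝓝[<] 1) (𝓝 (ζ : Ell1)) := by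
  have hs : Summable fun n => ‖(ζ : Ell1) n‖ :=
    summable_of_sum_le (fun _ => norm_nonneg _) (sum_norm_le ζ)
  have h1 : ∑' n, lp.single 1 n ((ζ : Ell1) n) = (ζ : Ell1) :=
    (lp.hasSum_single (p := 1) ENNReal.one_ne_top (ζ : Ell1)).tsum_eq
  nth_rewrite 2 [← h1]
  refine tendsto_tsum_of_dominated_convergence hs (fun n => ?_) ?_
  · have h := (lp.singleContinuousLinearMap ℂ (fun _ : ℕ => ℂ) 1 n).continuous
    have h2 : Continuous fun ρ : ℝ => (ρ : ℂ) ^ (n + 1) * (ζ : Ell1) n := by fun_prop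
    have h3 := (h.comp h2).tendsto 1
    simp only [Function.comp_apply, Complex.ofReal_one, one_pow, one_mul] at h3
    exact h3.mono_left nhdsWithin_le_nhds
  · filter_upwards [Ioo_mem_nhdsLT (show (0 : ℝ) < 1 from one_pos)] with ρ hρ n
    rw [lp.norm_single one_pos, norm_mul, norm_pow, Complex.norm_real, Real.norm_of_nonneg hρ.1.le]
    exact mul_le_of_le_one_left (norm_nonneg _) (pow_le_one₀ hρ.1.le hρ.2.le)

lemma IsHolomorphic.tendsto_scaled {F : polydisc → ℂ} (h : IsHolomorphic F) (ζ : polydisc) :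
    Tendsto (fun ρ : ℝ => scaled F ρ fun n => (ζ : Ell1) n) (𝓝[<] 1) (𝓝 (F ζ)) := by
  have := (h.continuousAt isOpen_polydisc ζ).tendsto.comp (tendsto_scale ζ)
  rwa [extend_val] at this

/-! ### Rotations of the torus along the one-parameter group `weighted` -/

lemma measurePreserving_rotation :
    MeasurePreserving (fun p : Circle × Torus => weighted p.1 * p.2)
      (circleMeasure.prod torusMeasure) torusMeasure := by
  have hm : Measurable (Function.uncurry fun (u : Circle) (w : Torus) => weighted u * w) :=
    (continuous_weighted.measurable.comp measurable_fst).mul measurable_snd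
  have h := (MeasurePreserving.id circleMeasure).skew_product
    (g := fun (u : Circle) (w : Torus) => weighted u * w) hm
    (ae_of_all _ fun u => (measurePreserving_torus_mul (weighted u)).map_eq)
  exact measurePreserving_snd.comp h

lemma ae_rotation {P : Torus → Prop} (h : ∀ᵐ w ∂torusMeasure, P w) :
    ∀ᵐ w ∂torusMeasure, ∀ᵐ u ∂circleMeasure, P (weighted u * w) := by
  have h1 : ∀ᵐ p ∂torusMeasure.prod circleMeasure, P (weighted p.2 * p.1) :=
    (measurePreserving_rotation.comp Measure.measurePreserving_swap).quasiMeasurePreserving.ae h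
  exact Measure.ae_ae_of_ae_prod h1

lemma ae_of_ae_rotation {S : Set Torus} (hS : MeasurableSet S)
    (h : ∀ᵐ w ∂torusMeasure, ∀ᵐ u ∂circleMeasure, weighted u * w ∈ S) :
    ∀ᵐ w ∂torusMeasure, w ∈ S := by
  have hp := measurePreserving_rotation.comp
    (Measure.measurePreserving_swap (μ := torusMeasure) (ν := circleMeasure))
  have h1 : ∀ᵐ p ∂torusMeasure.prod circleMeasure, weighted p.2 * p.1 ∈ S :=
    (Measure.ae_prod_mem_iff_ae_ae_mem (hp.measurable hS)).2 h
  rw [← hp.map_eq]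
  exact (ae_map_iff hp.aemeasurable hS).2 h1

lemma ae_circle_of_ae_angle {S : Set Circle} (hS : MeasurableSet S)
    (h : ∀ᵐ θ ∂volume.restrict (Ioc (0 : ℝ) (2 * Real.pi)), Circle.exp θ ∈ S) :
    ∀ᵐ u ∂circleMeasure, u ∈ S :=
  Measure.ae_smul_measure ((ae_map_iff Circle.exp.continuous.measurable.aemeasurable hS).2 h) _

lemma ae_angle_of_ae_circle {P : Circle → Prop} (h : ∀ᵐ u ∂circleMeasure, P u) :
    ∀ᵐ θ ∂volume.restrict (Ioc (0 : ℝ) (2 * Real.pi)), P (Circle.exp θ) := by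
  refine ae_of_ae_map Circle.exp.continuous.measurable.aemeasurable ?_
  rwa [circleMeasure, Measure.ae_ennreal_smul_measure_iff
    (ENNReal.inv_ne_zero.2 ENNReal.ofReal_ne_top)] at h

/-! ### Radial limits of `f̃` -/

/-- The filter of the radii that tend to `1`. -/
abbrev nearOne : Filter (Ioo (0 : ℝ) 1) := comap (fun r : Ioo (0 : ℝ) 1 => (r : ℝ)) (𝓝 1)

lemma tendsto_coe_nearOne : Tendsto (fun r : Ioo (0 : ℝ) 1 => (r : ℝ)) nearOne (𝓝[<] 1) :=
  tendsto_nhdsWithin_iff.2 ⟨tendsto_comap, Eventually.of_forall fun r => r.2.2⟩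

/-- The pointwise distance on the torus between a polynomial and a function. -/
def gap (g : Torus → ℂ) (q : MvPolynomial ℕ ℂ) (w : Torus) : ℝ≥0∞ :=
  logSize (MvPolynomial.eval (torusPoint w) q - g w)

lemma gap_ne_top (g : Torus → ℂ) (q : MvPolynomial ℕ ℂ) (w : Torus) : gap g q w ≠ ∞ :=
  logSize_ne_top _

lemma measurable_gap {g : Torus → ℂ} (hg : Measurable g) (q : MvPolynomial ℕ ℂ) :
    Measurable (gap g q) :=
  measurable_logSize.comp ((continuous_polyFun q).measurable.sub hg)

lemma measurable_gap_weighted {g : Torus → ℂ} (hg : Measurable g) (q : MvPolynomial ℕ ℂ)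
    (w : Torus) : Measurable fun v : Circle => gap g q (weighted v * w) :=
  (measurable_gap hg q).comp (continuous_weighted.measurable.mul_const w)

lemma measurable_L0 (f : L0) : Measurable (f : MeasFun) :=
  (AEEqFun.stronglyMeasurable (f : MeasFun)).measurable

lemma lintegral_poisson_mul_le {z : ℂ} (hz : ‖z‖ < 1) (k : Circle → ℝ≥0∞) :
    ∫⁻ v, ENNReal.ofReal (poisson z v) * k v ∂circleMeasure ≤
      harnack z * ∫⁻ v, k v ∂circleMeasure := by
  rw [← lintegral_const_mul' _ _ (show harnack z ≠ ∞ from ENNReal.ofReal_ne_top)]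
  exact lintegral_mono fun v => mul_le_mul_left (ENNReal.ofReal_le_ofReal (poisson_le hz v)) _

/-- The dilations of `f̃ - q` are bounded by the Poisson integral of `log (1 + |f - q|)` over an
orbit, as soon as some sequence of polynomials tends to `f` in mean on that orbit. -/
lemma logSize_dilate_tilde_sub_le {f : L0} (hf : f ∈ smirnovTorus) {q : ℕ → MvPolynomial ℕ ℂ}
    (hq : Tendsto (fun k => polyTorus (q k)) atTop (𝓝 f)) {w : Torus}
    (hA : Tendsto (fun k => ∫⁻ v, gap (f : MeasFun) (q k) (weighted v * w) ∂circleMeasure)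
      atTop (𝓝 0)) (r : Ioo (0 : ℝ) 1) (p : MvPolynomial ℕ ℂ) :
    logSize (dilate (tilde f) r w - polyEval (radialPoint r w) p) ≤
      ∫⁻ v, ENNReal.ofReal (poisson ((r : ℝ) : ℂ) v) * gap (f : MeasFun) p (weighted v * w)
        ∂circleMeasure := by
  have hr := norm_radius_lt r
  have hP : Measurable fun v => ENNReal.ofReal (poisson ((r : ℝ) : ℂ) v) :=
    (continuous_poisson hr).measurable.ennreal_ofReal
  set R := ∫⁻ v, ENNReal.ofReal (poisson ((r : ℝ) : ℂ) v) *
    gap (f : MeasFun) p (weighted v * w) ∂circleMeasure with hR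
  have h1 : ∀ j, logSize (polyEval (radialPoint r w) (q j) - polyEval (radialPoint r w) p) ≤
      harnack ((r : ℝ) : ℂ) * (∫⁻ v, gap (f : MeasFun) (q j) (weighted v * w) ∂circleMeasure)
        + R := fun j => by
    refine (((isDiscAlgebra_eval (q j)).sub (isDiscAlgebra_eval p)).logSize_curve_le w hr).trans ?_
    refine le_trans ?_ (add_le_add_left (lintegral_poisson_mul_le hr _) R)
    rw [hR, ← lintegral_add_left (show Measurable fun v => ENNReal.ofReal (poisson ((r : ℝ) : ℂ) v) *
      gap (f : MeasFun) (q j) (weighted v * w) from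
      hP.mul (measurable_gap_weighted (measurable_L0 f) (q j) w))]
    refine lintegral_mono fun v => ?_
    rw [← mul_add]
    refine mul_le_mul_right ?_ _
    unfold gap
    rw [logSize_sub_comm (MvPolynomial.eval (torusPoint (weighted v * w)) p)]
    refine le_trans (le_of_eq ?_) (logSize_add_le _ _)
    rw [sub_add_sub_cancel]
  have h2 : Tendsto (fun j => harnack ((r : ℝ) : ℂ) *
      (∫⁻ v, gap (f : MeasFun) (q j) (weighted v * w) ∂circleMeasure) + R) atTop (𝓝 R) := by
    have := (ENNReal.Tendsto.const_mul hA (Or.inr (show harnack ((r : ℝ) : ℂ) ≠ ∞ from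
      ENNReal.ofReal_ne_top))).add_const R
    simpa using this
  refine le_of_tendsto_of_tendsto ((continuous_logSize.tendsto _).comp
    ((tendsto_polyEval hf hq (radialPoint r w)).sub_const _)) h2 (Eventually.of_forall h1)

lemma tendsto_polyEval_radialPoint (p : MvPolynomial ℕ ℂ) (w : Torus) :
    Tendsto (fun r => polyEval (radialPoint r w) p) nearOne
      (𝓝 (MvPolynomial.eval (torusPoint w) p)) := by
  have h1 : Continuous fun r : ℝ => MvPolynomial.eval (curve w (r : ℂ)) p :=
    (MvPolynomial.continuous_eval p).comp
      ((continuous_curve w).comp Complex.continuous_ofReal)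
  have h2 := (h1.tendsto 1).comp
    (tendsto_comap (f := fun r : Ioo (0 : ℝ) 1 => (r : ℝ)) (x := 𝓝 1))
  have h3 : curve w ((1 : ℝ) : ℂ) = torusPoint w := by funext n; simp [curve, torusPoint]
  rw [h3] at h2
  exact h2

/-- Fatou's theorem along almost every point of a good orbit. -/
lemma ae_angle_tendsto_dilate_tilde {f : L0} (hf : f ∈ smirnovTorus) {q : ℕ → MvPolynomial ℕ ℂ}
    (hq : Tendsto (fun k => polyTorus (q k)) atTop (𝓝 f)) {w : Torus}
    (hA : Tendsto (fun k => ∫⁻ v, gap (f : MeasFun) (q k) (weighted v * w) ∂circleMeasure)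
      atTop (𝓝 0))
    (hfin : ∀ k, ∫⁻ v, gap (f : MeasFun) (q k) (weighted v * w) ∂circleMeasure ≠ ∞)
    (hpt : ∀ᵐ u ∂circleMeasure,
      Tendsto (fun k => gap (f : MeasFun) (q k) (weighted u * w)) atTop (𝓝 0)) :
    ∀ᵐ θ ∂volume.restrict (Ioc (0 : ℝ) (2 * Real.pi)),
      Tendsto (fun r => dilate (tilde f) r (weighted (Circle.exp θ) * w)) nearOne
        (𝓝 ((f : MeasFun) (weighted (Circle.exp θ) * w))) := by
  set g : Torus → ℂ := ⇑(f : MeasFun) with hg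
  have hgm : Measurable g := measurable_L0 f
  set U : ℕ → Circle → ℝ := fun k v => (gap g (q k) (weighted v * w)).toReal with hU
  have hUi : ∀ k, Integrable (U k) circleMeasure := fun k =>
    integrable_toReal_of_lintegral_ne_top (measurable_gap_weighted hgm (q k) w).aemeasurable
      (hfin k)
  have hlim : ∀ᵐ θ : ℝ, ∀ k, Tendsto
      (fun r : ℝ => ∫ v, poisson r v * U k (v * Circle.exp θ) ∂circleMeasure)
      (𝓝[<] 1) (𝓝 (U k (Circle.exp θ))) :=
    ae_all_iff.2 fun k => ae_tendsto_integral_poisson (hUi k)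
  filter_upwards [ae_restrict_of_ae hlim, ae_angle_of_ae_circle hpt] with θ h1 h2
  set s := Circle.exp θ
  have hrot : ∀ v, weighted v * (weighted s * w) = weighted (v * s) * w := fun v => by
    rw [weighted_mul, mul_assoc]
  have hshift : MeasurePreserving (fun v => v * s) circleMeasure circleMeasure := by
    simpa only [mul_comm] using measurePreserving_circle_mul s
  have hA' : Tendsto (fun k => ∫⁻ v, gap g (q k) (weighted v * (weighted s * w)) ∂circleMeasure)
      atTop (𝓝 0) := by
    refine hA.congr fun k => ?_
    simp only [hrot]
    exact (hshift.lintegral_comp (measurable_gap_weighted hgm (q k) w)).symm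
  have hP : ∀ k (r : Ioo (0 : ℝ) 1),
      ∫⁻ v, ENNReal.ofReal (poisson ((r : ℝ) : ℂ) v) * gap g (q k) (weighted v * (weighted s * w))
        ∂circleMeasure =
      ENNReal.ofReal (∫ v, poisson ((r : ℝ) : ℂ) v * U k (v * s) ∂circleMeasure) := fun k r => by
    have hr := norm_radius_lt r
    have hi : Integrable (fun v => U k (v * s)) circleMeasure :=
      hshift.integrable_comp_of_integrable (hUi k)
    rw [ofReal_integral_eq_lintegral_ofReal]
    · refine lintegral_congr fun v => ?_
      rw [ENNReal.ofReal_mul (poisson_nonneg hr v), hU, hrot]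
      simp only
      rw [ENNReal.ofReal_toReal (gap_ne_top _ _ _)]
    · refine hi.bdd_mul (c := (1 + ‖((r : ℝ) : ℂ)‖) / (1 - ‖((r : ℝ) : ℂ)‖))
        (continuous_poisson hr).aestronglyMeasurable (ae_of_all _ fun v => ?_)
      rw [Real.norm_of_nonneg (poisson_nonneg hr v)]
      exact poisson_le hr v
    · exact ae_of_all _ fun v => mul_nonneg (poisson_nonneg hr v) ENNReal.toReal_nonneg
  refine tendsto_sub_nhds_zero_iff.1 (tendsto_zero_of_logSize ?_)
  set R : ℕ → Ioo (0 : ℝ) 1 → ℝ≥0∞ := fun k r =>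
    ENNReal.ofReal (∫ v, poisson ((r : ℝ) : ℂ) v * U k (v * s) ∂circleMeasure) +
    (logSize (polyEval (radialPoint r (weighted s * w)) (q k) -
      MvPolynomial.eval (torusPoint (weighted s * w)) (q k)) + gap g (q k) (weighted s * w)) with hR
  have hle : ∀ k r, logSize (dilate (tilde f) r (weighted s * w) - g (weighted s * w)) ≤ R k r :=
    fun k r => by
      have h3 := logSize_dilate_tilde_sub_le hf hq hA' r (q k)
      rw [hP] at h3
      have h4 : dilate (tilde f) r (weighted s * w) - g (weighted s * w) =
          (dilate (tilde f) r (weighted s * w) - polyEval (radialPoint r (weighted s * w)) (q k)) +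
          ((polyEval (radialPoint r (weighted s * w)) (q k) -
            MvPolynomial.eval (torusPoint (weighted s * w)) (q k)) +
          (MvPolynomial.eval (torusPoint (weighted s * w)) (q k) - g (weighted s * w))) := by
        ring
      rw [h4]
      exact (logSize_add_le _ _).trans (add_le_add h3 (logSize_add_le _ _))
  have hRlim : ∀ k, Tendsto (R k) nearOne
      (𝓝 (gap g (q k) (weighted s * w) + (0 + gap g (q k) (weighted s * w)))) := fun k => by
    refine Tendsto.add ?_ (Tendsto.add ?_ tendsto_const_nhds)
    · have h3 := (ENNReal.continuous_ofReal.tendsto _).comp ((h1 k).comp tendsto_coe_nearOne)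
      rw [hU] at h3
      simp only at h3
      rw [ENNReal.ofReal_toReal (gap_ne_top _ _ _)] at h3
      exact h3
    · have h3 := (continuous_logSize.tendsto _).comp
        ((tendsto_polyEval_radialPoint (q k) (weighted s * w)).sub_const
          (MvPolynomial.eval (torusPoint (weighted s * w)) (q k)))
      rwa [sub_self, logSize_zero] at h3
  refine ENNReal.tendsto_nhds_zero.2 fun ε hε => ?_
  have h5 : Tendsto (fun k => gap g (q k) (weighted s * w) + (0 + gap g (q k) (weighted s * w)))
      atTop (𝓝 0) := by
    simpa using h2.add h2
  obtain ⟨k, hk⟩ := (h5.eventually (gt_mem_nhds hε)).exists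
  filter_upwards [(hRlim k).eventually (gt_mem_nhds hk)] with r hr
  exact (hle k r).trans hr.le

lemma tendsto_nearOne_of_dense {φ : Ioo (0 : ℝ) 1 → ℂ} (hφ : Continuous φ) {D : Set (Ioo (0 : ℝ) 1)}
    (hD : Dense D) {a : ℂ}
    (h : Tendsto (fun r : D => φ r) (comap (fun r : D => ((r : Ioo (0 : ℝ) 1) : ℝ)) (𝓝 1)) (𝓝 a)) :
    Tendsto φ nearOne (𝓝 a) := by
  refine (closed_nhds_basis a).tendsto_right_iff.2 fun K hK => ?_
  have h1 := h.eventually hK.1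
  obtain ⟨W, ⟨hW, hWo⟩, hWK⟩ := ((nhds_basis_opens (1 : ℝ)).comap _).eventually_iff.1 h1
  refine ((nhds_basis_opens (1 : ℝ)).comap _).eventually_iff.2 ⟨W, ⟨hW, hWo⟩, fun r hr => ?_⟩
  have hWo' : IsOpen ((fun r : Ioo (0 : ℝ) 1 => (r : ℝ)) ⁻¹' W) :=
    hWo.preimage continuous_subtype_val
  have h2 := hD.open_subset_closure_inter hWo' hr
  refine (hK.2.preimage hφ).closure_subset_iff.2 ?_ h2
  rintro t ⟨ht, htD⟩
  exact hWK (x := ⟨t, htD⟩) ht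
lemma lintegral_gap (f : L0) (q : MvPolynomial ℕ ℂ) :
    ∫⁻ w, gap (f : MeasFun) q w ∂torusMeasure = edist (polyTorus q) f :=
  (L0_edist_of_ae (coeFn_polyTorus q) EventuallyEq.rfl).symm

lemma measurable_lintegral_gap_weighted {g : Torus → ℂ} (hg : Measurable g)
    (q : MvPolynomial ℕ ℂ) :
    Measurable fun w => ∫⁻ v, gap g q (weighted v * w) ∂circleMeasure :=
  Measurable.lintegral_prod_right' (f := fun p : Torus × Circle => gap g q (weighted p.2 * p.1))
    ((measurable_gap hg q).comp
      ((continuous_weighted.measurable.comp measurable_snd).mul measurable_fst))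

lemma lintegral_lintegral_gap_weighted (f : L0) (q : MvPolynomial ℕ ℂ) :
    ∫⁻ w, ∫⁻ v, gap (f : MeasFun) q (weighted v * w) ∂circleMeasure ∂torusMeasure =
      edist (polyTorus q) f := by
  have h := lintegral_rotation continuous_weighted.measurable (measurable_const (a := 1))
    (measurable_gap (measurable_L0 f) q)
  simpa [lintegral_gap] using h

/-- Fatou's theorem: `f` is the radial boundary value of `f̃`. -/
lemma isBoundaryValue_tilde {f : L0} (hf : f ∈ smirnovTorus) :
    IsBoundaryValue (tilde f) (f : MeasFun) := by
  have hfm := measurable_L0 f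
  obtain ⟨q, hq⟩ := exists_seq_polyTorus hf
  have hsum : Tendsto (fun k => ∫⁻ w, (gap (f : MeasFun) (q k) w +
      ∫⁻ v, gap (f : MeasFun) (q k) (weighted v * w) ∂circleMeasure) ∂torusMeasure)
      atTop (𝓝 0) := by
    have h1 : Tendsto (fun k => edist (polyTorus (q k)) f) atTop (𝓝 0) :=
      tendsto_iff_edist_tendsto_0.1 hq
    have h2 := h1.add h1
    rw [add_zero] at h2
    refine h2.congr fun k => ?_
    rw [lintegral_add_left (measurable_gap hfm (q k)), lintegral_gap,
      lintegral_lintegral_gap_weighted]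
  obtain ⟨φ, hφ, hae⟩ := exists_seq_ae_tendsto_zero (fun k =>
    ((measurable_gap hfm (q k)).add (measurable_lintegral_gap_weighted hfm (q k))).aemeasurable)
    hsum
  have hfin : ∀ᵐ w ∂torusMeasure, ∀ k,
      ∫⁻ v, gap (f : MeasFun) (q k) (weighted v * w) ∂circleMeasure ≠ ∞ :=
    ae_all_iff.2 fun k => by
      refine (ae_lt_top (measurable_lintegral_gap_weighted hfm (q k)) ?_).mono fun w hw => hw.ne
      rw [lintegral_lintegral_gap_weighted]
      exact edist_ne_top _ _
  have hpt : ∀ᵐ w ∂torusMeasure,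
      Tendsto (fun k => gap (f : MeasFun) (q (φ k)) w) atTop (𝓝 0) := by
    filter_upwards [hae] with w hw
    exact tendsto_of_tendsto_of_tendsto_of_le_of_le tendsto_const_nhds hw (fun _ => zero_le)
      fun k => le_self_add
  -- countably many radii suffice, by continuity: this makes the set of convergence measurable
  obtain ⟨D, hDc, hD⟩ := TopologicalSpace.exists_countable_dense (Ioo (0 : ℝ) 1)
  have : Countable D := hDc.to_subtype
  set S : Set Torus := {w | Tendsto (fun r : D => dilate (tilde f) r w)
    (comap (fun r : D => ((r : Ioo (0 : ℝ) 1) : ℝ)) (𝓝 1)) (𝓝 ((f : MeasFun) w))} with hS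
  have hSm : MeasurableSet S :=
    measurableSet_tendsto_fun (f := fun (r : D) w => dilate (tilde f) r w)
      (fun r => measurable_dilate_tilde hf r) hfm
  have hSae : ∀ᵐ w ∂torusMeasure, w ∈ S := by
    refine ae_of_ae_rotation hSm ?_
    filter_upwards [hae, hfin, ae_rotation hpt] with w h1 h2 h3
    refine ae_circle_of_ae_angle
      (hSm.preimage (continuous_weighted.measurable.mul_const w)) ?_
    have h4 := ae_angle_tendsto_dilate_tilde hf (hq.comp hφ.tendsto_atTop)
      (tendsto_of_tendsto_of_tendsto_of_le_of_le tendsto_const_nhds h1 (fun _ => zero_le)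
        fun k => by rw [Pi.add_apply]; exact le_add_self) (fun k => h2 (φ k)) h3
    filter_upwards [h4] with θ hθ
    refine hθ.comp (f := fun r : D => (r : Ioo (0 : ℝ) 1)) ?_
    exact tendsto_comap_iff.2 tendsto_comap
  filter_upwards [hSae] with w hw
  exact tendsto_nearOne_of_dense ((isHolomorphic_tilde hf).continuous_dilate_radius w) hD hw

/-! ### `f̃` belongs to the Smirnov class, and `f ↦ f̃` is isometric -/

lemma exists_seq_nearOne : ∃ r : ℕ → Ioo (0 : ℝ) 1, StrictMono r ∧ Tendsto r atTop nearOne := by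
  obtain ⟨u, hmono, hu, hlim⟩ := exists_seq_strictMono_tendsto' (show (0 : ℝ) < 1 from one_pos)
  exact ⟨fun n => ⟨u n, hu n⟩, fun m n hmn => hmono hmn, tendsto_comap_iff.2 hlim⟩

lemma discNorm_tilde {f : L0} (hf : f ∈ smirnovTorus) :
    discNorm (tilde f) = logNorm (f : MeasFun) := by
  refine le_antisymm (iSup_le fun r => logNorm_dilate_tilde_le hf r) ?_
  obtain ⟨r, -, hr⟩ := exists_seq_nearOne
  have h1 : ∀ᵐ w ∂torusMeasure, logSize ((f : MeasFun) w) =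
      liminf (fun k => logSize (dilate (tilde f) (r k) w)) atTop := by
    filter_upwards [isBoundaryValue_tilde hf] with w hw
    exact ((continuous_logSize.tendsto _).comp (hw.comp hr)).liminf_eq.symm
  rw [logNorm_eq_lintegral, lintegral_congr_ae h1]
  refine (lintegral_liminf_le fun k =>
    measurable_logSize.comp (measurable_dilate_tilde hf (r k))).trans ?_
  refine liminf_le_of_frequently_le' (Frequently.of_forall fun k => ?_)
  exact le_iSup (fun r => logNorm (dilate (tilde f) r)) (r k)

lemma posLog_le_log_one_add {x : ℝ} (hx : 0 ≤ x) : Real.posLog x ≤ Real.log (1 + x) := by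
  rw [Real.posLog_eq_log_max_one hx]
  exact Real.log_le_log (by positivity) (max_le (by linarith) (by linarith))

lemma posLog_le_logSize (x : ℂ) : ENNReal.ofReal (Real.posLog ‖x‖) ≤ logSize x :=
  ENNReal.ofReal_le_ofReal (posLog_le_log_one_add (norm_nonneg x))

lemma enorm_posLog (x : ℂ) : ‖Real.posLog ‖x‖‖ₑ = ENNReal.ofReal (Real.posLog ‖x‖) :=
  Real.enorm_of_nonneg Real.posLog_nonneg

lemma sub_mem_smirnovTorus {f g : L0} (hf : f ∈ smirnovTorus) (hg : g ∈ smirnovTorus) :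
    f - g ∈ smirnovTorus :=
  mem_smirnovTorusAlgebra.1 (sub_mem (mem_smirnovTorusAlgebra.2 hf) (mem_smirnovTorusAlgebra.2 hg))

lemma tilde_sub {f g : L0} (hf : f ∈ smirnovTorus) (hg : g ∈ smirnovTorus) :
    tilde (f - g) = tilde f - tilde g := by
  funext ζ
  have h := pointEval_add ζ (sub_mem_smirnovTorus hf hg) hg
  rw [sub_add_cancel] at h
  exact eq_sub_of_add_eq h.symm

lemma discNorm_tilde_sub {f g : L0} (hf : f ∈ smirnovTorus) (hg : g ∈ smirnovTorus) :
    discNorm (tilde f - tilde g) = edist f g := by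
  rw [← tilde_sub hf hg, discNorm_tilde (sub_mem_smirnovTorus hf hg), L0_edist_eq]

/-- Polynomials are bounded on the torus, and approximate all dilations of `f̃` uniformly in mean:
this gives the uniform integrability. -/
lemma unifIntegrable_dilate_tilde {f : L0} (hf : f ∈ smirnovTorus) :
    UnifIntegrable (fun (r : Ioo (0 : ℝ) 1) (w : Torus) => Real.posLog ‖dilate (tilde f) r w‖) 1
      torusMeasure := by
  intro ε hε
  obtain ⟨q, hq⟩ := exists_seq_polyTorus hf
  have h1 : Tendsto (fun k => edist f (polyTorus (q k))) atTop (𝓝 0) := by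
    simpa only [edist_comm] using tendsto_iff_edist_tendsto_0.1 hq
  obtain ⟨k, hk⟩ := (h1.eventually (gt_mem_nhds (ENNReal.ofReal_pos.2 (half_pos hε)))).exists
  obtain ⟨C, hC⟩ := (isDiscAlgebra_eval (q k)).exists_bound
  set C' := max C 1
  have hC' : 0 < C' := one_pos.trans_le (le_max_right _ _)
  refine ⟨ε / (2 * C'), by positivity, fun r s hs hμ => ?_⟩
  rw [eLpNorm_one_eq_lintegral_enorm]
  have h2 : ∀ w, ‖s.indicator (fun w => Real.posLog ‖dilate (tilde f) r w‖) w‖ₑ =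
      s.indicator (fun w => ENNReal.ofReal (Real.posLog ‖dilate (tilde f) r w‖)) w := fun w => by
    by_cases hw : w ∈ s
    · simp only [indicator_of_mem hw, enorm_posLog]
    · simp only [indicator_of_notMem hw, enorm_zero]
  simp only [h2]
  rw [lintegral_indicator hs]
  have hp := polyTorus_mem (q k)
  have h3 : ∀ w, ENNReal.ofReal (Real.posLog ‖dilate (tilde f) r w‖) ≤
      logSize (dilate (tilde (f - polyTorus (q k))) r w) + ENNReal.ofReal C' := fun w => by
    have e : dilate (tilde f) r w =
        dilate (tilde (f - polyTorus (q k))) r w + polyEval (radialPoint r w) (q k) := by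
      rw [tilde_sub hf hp, ← pointEval_polyTorus]
      exact (sub_add_cancel _ _).symm
    refine (posLog_le_logSize _).trans ?_
    rw [e]
    refine (logSize_add_le _ _).trans (add_le_add_right ?_ _)
    refine (logSize_le_norm _).trans (ENNReal.ofReal_le_ofReal ?_)
    exact (hC _ (curve_mem w (norm_radius_lt r).le)).trans (le_max_left _ _)
  refine (lintegral_mono h3).trans ?_
  rw [lintegral_add_right _ measurable_const, setLIntegral_const]
  have h4 : ∫⁻ w in s, logSize (dilate (tilde (f - polyTorus (q k))) r w) ∂torusMeasure ≤
      ENNReal.ofReal (ε / 2) := by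
    refine (setLIntegral_le_lintegral _ _).trans
      ((logNorm_dilate_tilde_le (sub_mem_smirnovTorus hf hp) r).trans ?_)
    rw [← L0_edist_eq]
    exact hk.le
  have h5 : ENNReal.ofReal C' * torusMeasure s ≤ ENNReal.ofReal (ε / 2) := by
    refine (mul_le_mul_right hμ _).trans_eq ?_
    rw [← ENNReal.ofReal_mul hC'.le]
    congr 1
    field_simp
  refine (add_le_add h4 h5).trans_eq ?_
  rw [← ENNReal.ofReal_add (half_pos hε).le (half_pos hε).le, add_halves]

lemma tilde_mem_smirnovDisc {f : L0} (hf : f ∈ smirnovTorus) : tilde f ∈ smirnovDisc := by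
  have h1 : ∀ r : Ioo (0 : ℝ) 1,
      ∫⁻ w, ENNReal.ofReal (Real.posLog ‖dilate (tilde f) r w‖) ∂torusMeasure ≤
        logNorm (f : MeasFun) := fun r =>
    (lintegral_mono fun w => posLog_le_logSize _).trans (logNorm_dilate_tilde_le hf r)
  have hfin : logNorm (f : MeasFun) < ∞ := f.2
  refine ⟨⟨isHolomorphic_tilde hf, (iSup_le h1).trans_lt hfin⟩, fun r => ?_,
    unifIntegrable_dilate_tilde hf, (logNorm (f : MeasFun)).toNNReal, fun r => ?_⟩
  · exact (Real.continuous_posLog.measurable.comp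
      (measurable_dilate_tilde hf r).norm).aestronglyMeasurable
  · rw [eLpNorm_one_eq_lintegral_enorm, ENNReal.coe_toNNReal hfin.ne]
    simp only [enorm_posLog]
    exact h1 r

/-! ### Fourier series on the torus -/

lemma integral_torusChar_eq_zero {α : ℕ →₀ ℤ} (hα : α ≠ 0) :
    ∫ w, (torusChar α w : ℂ) ∂torusMeasure = 0 := by
  obtain ⟨n, hn⟩ := Finsupp.ne_iff.1 hα
  rw [Finsupp.zero_apply] at hn
  -- a rotation of the coordinate `n` by a suitable angle changes the sign of the character
  obtain ⟨v, hv⟩ : ∃ v : Circle, ((v ^ α n : Circle) : ℂ) = -1 := by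
    refine ⟨Circle.exp (Real.pi / α n), ?_⟩
    rw [← Circle.exp_zsmul, zsmul_eq_mul, mul_div_cancel₀ _ (Int.cast_ne_zero.2 hn),
      Circle.coe_exp, Complex.exp_pi_mul_I]
  have h1 := (measurePreserving_torus_mul (Pi.mulSingle n v)).integral_comp
    (MeasurableEquiv.mulLeft _).measurableEmbedding fun w => (torusChar α w : ℂ)
  simp only [torusChar_mul, torusChar_mulSingle, Circle.coe_mul, hv, neg_one_mul,
    integral_neg] at h1
  exact self_eq_neg.1 h1.symm

/-- The characters as elements of `L²`. -/
def torusCharL2 (α : ℕ →₀ ℤ) : Lp ℂ 2 torusMeasure :=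
  ContinuousMap.toLp 2 torusMeasure ℂ (torusCharC α)

lemma orthonormal_torusCharL2 : Orthonormal ℂ torusCharL2 := by
  rw [orthonormal_iff_ite]
  intro α β
  rw [torusCharL2, torusCharL2, ContinuousMap.inner_toLp]
  have h1 : ∀ w, torusCharC β w * (starRingEnd ℂ) (torusCharC α w) =
      (torusChar (β - α) w : ℂ) := fun w => by
    rw [torusCharC_apply, torusCharC_apply, ← Circle.coe_inv_eq_conj, ← Circle.coe_mul,
      sub_eq_add_neg, torusChar_add, torusChar_neg]
  simp only [h1]
  split_ifs with h
  · simp [h, torusChar_zero]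
  · exact integral_torusChar_eq_zero (sub_ne_zero.2 (Ne.symm h))

lemma span_torusCharL2_closure_eq_top :
    (Submodule.span ℂ (range torusCharL2)).topologicalClosure = ⊤ := by
  have h := (ContinuousMap.toLp_denseRange ℂ torusMeasure ℂ
    (p := 2) (by simp)).topologicalClosure_map_submodule span_torusCharC_closure_eq_top
  rw [Submodule.map_span, ← range_comp] at h
  exact h

/-- The characters form a Hilbert basis of `L²` of the torus. -/
def torusBasis : HilbertBasis (ℕ →₀ ℤ) ℂ (Lp ℂ 2 torusMeasure) :=
  HilbertBasis.mk orthonormal_torusCharL2 span_torusCharL2_closure_eq_top.ge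

lemma coe_torusBasis : ⇑torusBasis = torusCharL2 := HilbertBasis.coe_mk _ _

/-- A function of the disc algebra, as a continuous function on the torus. -/
def IsDiscAlgebra.toTorus {Φ : (ℕ → ℂ) → ℂ} (h : IsDiscAlgebra Φ) : C(Torus, ℂ) :=
  ⟨fun w => Φ (torusPoint w), h.continuous_torus⟩

/-- The Fourier coefficients of a function of the disc algebra vanish at the exponents with a
negative coordinate, by the mean value property in that coordinate. -/
lemma IsDiscAlgebra.repr_eq_zero {Φ : (ℕ → ℂ) → ℂ} (h : IsDiscAlgebra Φ) {α : ℕ →₀ ℤ} {n : ℕ}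
    (hn : α n < 0) :
    torusBasis.repr (ContinuousMap.toLp 2 torusMeasure ℂ h.toTorus) α = 0 := by
  rw [HilbertBasis.repr_apply_apply, coe_torusBasis, torusCharL2, ContinuousMap.inner_toLp]
  set f : Torus → ℂ := fun w => h.toTorus w * (starRingEnd ℂ) (torusCharC α w) with hf
  have hfc : Continuous f := by
    exact h.toTorus.continuous.mul (Complex.continuous_conj.comp (torusCharC α).continuous)
  obtain ⟨m, hm⟩ := Int.eq_ofNat_of_zero_le (neg_nonneg.2 hn.le)
  have hm0 : m ≠ 0 := by omega
  have h1 : ∀ v : Circle, ∫ w, f ((Pi.mulSingle n v : Torus) * w) ∂torusMeasure = ∫ w, f w ∂torusMeasure :=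
    fun v => (measurePreserving_torus_mul (Pi.mulSingle n v)).integral_comp
      (MeasurableEquiv.mulLeft _).measurableEmbedding f
  have h2 : ∀ w, ∫ v : Circle, f ((Pi.mulSingle n v : Torus) * w) ∂circleMeasure = 0 := fun w => by
    have hg : DiffContOnCl ℂ (fun z => z ^ m * Φ (Function.update (torusPoint w) n (z * w n)))
        (Metric.ball 0 1) := by
      have hin : DiffContOnCl ℂ (fun z : ℂ => z * (w n : ℂ)) (Metric.ball 0 1) :=
        (differentiable_id.mul_const _).diffContOnCl
      have h3 := (h.diffContOnCl_coord (torusPoint_mem w) n).comp hin (fun z hz => by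
        simpa [Circle.norm_coe] using hz)
      exact (differentiable_pow m).diffContOnCl.smul h3
    have h4 := integral_poisson_smul hg (z := 0) (by simp)
    rw [zero_pow hm0, zero_mul] at h4
    have h5 : ∀ v : Circle, f ((Pi.mulSingle n v : Torus) * w) = (starRingEnd ℂ) (torusCharC α w) *
        ((poisson 0 v : ℂ) * ((v : ℂ) ^ m * Φ (Function.update (torusPoint w) n (v * w n)))) :=
      fun v => by
        have e1 : torusPoint (Pi.mulSingle n v * w) =
            Function.update (torusPoint w) n ((v : ℂ) * w n) := by
          funext k
          rcases eq_or_ne k n with rfl | hk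
          · simp [torusPoint]
          · simp [torusPoint, hk]
        have e2 : (starRingEnd ℂ) (torusCharC α (Pi.mulSingle n v * w)) =
            (v : ℂ) ^ m * (starRingEnd ℂ) (torusCharC α w) := by
          have e3 : (v ^ α n)⁻¹ = v ^ m := by rw [← zpow_neg, hm]; simp
          rw [torusCharC_apply, torusCharC_apply, torusChar_mul, torusChar_mulSingle,
            Circle.coe_mul, map_mul, ← Circle.coe_inv_eq_conj, e3, Circle.coe_pow]
        have e4 : poisson 0 v = 1 := by simp [poisson_eq, Circle.norm_coe]
        simp only [hf]
        rw [e2, e4]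
        change Φ (torusPoint _) * _ = _
        rw [e1]
        push_cast
        ring
    simp only [h5]
    rw [integral_const_mul, h4, mul_zero]
  have hi : Integrable (Function.uncurry fun (w : Torus) (v : Circle) => f ((Pi.mulSingle n v : Torus) * w))
      (torusMeasure.prod circleMeasure) := by
    have hc : Continuous (Function.uncurry fun (w : Torus) (v : Circle) =>
        f ((Pi.mulSingle n v : Torus) * w)) :=
      hfc.comp (((continuous_mulSingle n).comp continuous_snd).mul continuous_fst)
    exact hc.integrable_of_hasCompactSupport (HasCompactSupport.of_compactSpace _)
  have h6 := integral_integral_swap hi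
  simp only [h1, h2] at h6
  simpa using h6.symm

/-- The analytic monomial of exponent `α`; the coordinates of `α` that are negative are replaced
by `0`. -/
def charMonomial (α : ℕ →₀ ℤ) (c : ℂ) : MvPolynomial ℕ ℂ :=
  MvPolynomial.monomial (α.mapRange Int.toNat rfl) c

lemma eval_charMonomial {α : ℕ →₀ ℤ} (hα : ∀ n, 0 ≤ α n) (c : ℂ) (w : Torus) :
    MvPolynomial.eval (torusPoint w) (charMonomial α c) = c * torusCharC α w := by
  rw [charMonomial, MvPolynomial.eval_monomial, Finsupp.prod_mapRange_index (by simp),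
    torusCharC_apply, torusChar]
  congr 1
  refine Eq.trans (Finset.prod_congr rfl fun n _ => ?_)
    (map_prod Circle.coeHom (fun n => w n ^ α n) α.support).symm
  change (w n : ℂ) ^ (α n).toNat = ((w n ^ α n : Circle) : ℂ)
  conv_rhs => rw [← Int.toNat_of_nonneg (hα n), zpow_natCast, Circle.coe_pow]

/-- The disc algebra is contained in the Smirnov class: the Fourier series of its functions consist
of analytic monomials, and converge in `L²`. -/
lemma IsDiscAlgebra.toL0_mem {Φ : (ℕ → ℂ) → ℂ} (h : IsDiscAlgebra Φ) : h.toL0 ∈ smirnovTorus := by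
  set x := ContinuousMap.toLp 2 torusMeasure ℂ h.toTorus with hx
  set q : Finset (ℕ →₀ ℤ) → MvPolynomial ℕ ℂ := fun s => ∑ α ∈ s, charMonomial α (torusBasis.repr x α)
  have hq : ∀ s w, MvPolynomial.eval (torusPoint w) (q s) =
      (∑ α ∈ s, torusBasis.repr x α • torusCharC α) w := fun s w => by
    rw [map_sum, ContinuousMap.sum_apply]
    refine Finset.sum_congr rfl fun α _ => ?_
    by_cases hα : ∀ n, 0 ≤ α n
    · rw [eval_charMonomial hα]; rfl
    · obtain ⟨n, hn⟩ := not_forall.1 hα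
      rw [h.repr_eq_zero (not_le.1 hn)]
      simp [charMonomial]
  have hsum := torusBasis.hasSum_repr x
  rw [coe_torusBasis] at hsum
  have hlim : Tendsto (fun s => edist (∑ α ∈ s, torusBasis.repr x α • torusCharL2 α) x) atTop
      (𝓝 0) := tendsto_iff_edist_tendsto_0.1 hsum
  refine mem_closure_of_tendsto (f := fun s => polyTorus (q s)) (b := atTop)
    (tendsto_iff_edist_tendsto_0.2 ?_) (Eventually.of_forall fun s => ⟨q s, rfl⟩)
  refine tendsto_of_tendsto_of_tendsto_of_le_of_le tendsto_const_nhds hlim (fun _ => zero_le)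
    fun s => ?_
  have e : ∑ α ∈ s, torusBasis.repr x α • torusCharL2 α =
      ContinuousMap.toLp 2 torusMeasure ℂ (∑ α ∈ s, torusBasis.repr x α • torusCharC α) := by
    simp only [map_sum, map_smul, torusCharL2]
  have e' : edist (polyTorus (q s)) h.toL0 =
      logNorm fun w => MvPolynomial.eval (torusPoint w) (q s) - Φ (torusPoint w) :=
    L0_edist_of_ae (coeFn_polyTorus (q s)) (coeFn_continuousL0 _ h.continuous_torus)
  rw [e, e', hx, Lp.edist_def, eLpNorm_congr_ae ((ContinuousMap.coeFn_toLp torusMeasure _).sub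
      (ContinuousMap.coeFn_toLp torusMeasure _))]
  refine le_trans ?_ (eLpNorm_le_eLpNorm_of_exponent_le (p := 1) (by norm_num)
    (((ContinuousMap.continuous _).sub (ContinuousMap.continuous _)).aestronglyMeasurable))
  rw [eLpNorm_one_eq_lintegral_enorm, logNorm_eq_lintegral]
  refine lintegral_mono fun w => ?_
  rw [hq, Pi.sub_apply]
  exact (logSize_le_norm _).trans_eq (ofReal_norm _)

/-! ### The energy of the dilations of a holomorphic function -/

/-- The square of the distance of the stereographic images of two points. -/
def sphDistSq (x y : ℂ) : ℝ≥0∞ := ENNReal.ofReal (‖stereo x - stereo y‖ ^ 2)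

lemma continuous_sphDistSq : Continuous fun p : ℂ × ℂ => sphDistSq p.1 p.2 :=
  ENNReal.continuous_ofReal.comp (((continuous_stereo.comp continuous_fst).sub
    (continuous_stereo.comp continuous_snd)).norm.pow 2)

lemma sphDistSq_le (x y z : ℂ) : sphDistSq x z ≤ 2 * (sphDistSq x y + sphDistSq y z) := by
  unfold sphDistSq
  rw [← ENNReal.ofReal_add (by positivity) (by positivity),
    ← ENNReal.ofReal_ofNat 2, ← ENNReal.ofReal_mul (by norm_num)]
  refine ENNReal.ofReal_le_ofReal ?_
  have h := norm_add_le (stereo x - stereo y) (stereo y - stereo z)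
  rw [sub_add_sub_cancel] at h
  nlinarith [sq_nonneg (‖stereo x - stereo y‖ - ‖stereo y - stereo z‖), norm_nonneg (stereo x - stereo z)]

/-- `log (1 + |x|²)`, with values in `[0, ∞]`. -/
def sphSize (x : ℂ) : ℝ≥0∞ := ENNReal.ofReal (sphLog x)

lemma continuous_sphSize : Continuous sphSize :=
  ENNReal.continuous_ofReal.comp continuous_sphLog

/-- The energy inequality along the curves `z ↦ (z w₁, z² w₂, …)`. -/
lemma IsDiscAlgebra.lintegral_sphDistSq_add_le {Φ : (ℕ → ℂ) → ℂ} (h : IsDiscAlgebra Φ) (w : Torus)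
    {z : ℂ} (hz : ‖z‖ < 1) :
    ∫⁻ u : Circle, ENNReal.ofReal (poisson z u) *
        sphDistSq (Φ (torusPoint (weighted u * w))) (Φ (curve w z)) ∂circleMeasure +
      sphSize (Φ (curve w z)) ≤
    ∫⁻ u : Circle, ENNReal.ofReal (poisson z u) *
        sphSize (Φ (torusPoint (weighted u * w))) ∂circleMeasure := by
  have h1 := integral_poisson_stereo_le (h.diffContOnCl_radial w) hz
  have hc : Continuous fun u : Circle => Φ (torusPoint (weighted u * w)) :=
    h.continuous_torus.comp (continuous_weighted.mul continuous_const)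
  simp only [curve_circle] at h1
  have hd : Continuous fun u : Circle => poisson z u *
      ‖stereo (Φ (torusPoint (weighted u * w))) - stereo (Φ (curve w z))‖ ^ 2 :=
    (continuous_poisson hz).mul
      (((continuous_stereo.comp hc).sub continuous_const).norm.pow 2)
  have hs : Continuous fun u : Circle => poisson z u * sphLog (Φ (torusPoint (weighted u * w))) :=
    (continuous_poisson hz).mul (continuous_sphLog.comp hc)
  have hd0 : ∀ u : Circle, 0 ≤ poisson z u *
      ‖stereo (Φ (torusPoint (weighted u * w))) - stereo (Φ (curve w z))‖ ^ 2 := fun u =>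
    mul_nonneg (poisson_nonneg hz u) (by positivity)
  have h2 := ENNReal.ofReal_le_ofReal h1
  rw [ENNReal.ofReal_add (integral_nonneg hd0) (sphLog_nonneg _),
    ofReal_integral_eq_lintegral_ofReal (integrable_circle hd) (ae_of_all _ hd0),
    ofReal_integral_eq_lintegral_ofReal (integrable_circle hs) (ae_of_all _ fun u =>
      mul_nonneg (poisson_nonneg hz u) (sphLog_nonneg _))] at h2
  simp only [ENNReal.ofReal_mul (poisson_nonneg hz _)] at h2
  exact h2

/-- The energy `∫ log (1 + |F_[r]|²)` of a dilation. -/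
def energy (F : polydisc → ℂ) (r : Ioo (0 : ℝ) 1) : ℝ≥0∞ :=
  ∫⁻ w, sphSize (dilate F r w) ∂torusMeasure

/-- The product of two radii. -/
def mulRadius (s r : Ioo (0 : ℝ) 1) : Ioo (0 : ℝ) 1 :=
  ⟨s * r, mul_pos s.2.1 r.2.1, mul_lt_one_of_nonneg_of_lt_one_left s.2.1.le s.2.2 r.2.2.le⟩

lemma dilate_mulRadius (F : polydisc → ℂ) (s r : Ioo (0 : ℝ) 1) (w : Torus) :
    dilate F (mulRadius s r) w = scaled F r (curve w ((s : ℝ) : ℂ)) := by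
  rw [dilate_eq_scaled_curve F _ r]
  congr 3
  exact mul_div_cancel_right₀ _ r.2.1.ne'

/-- The energy inequality, integrated over the torus. -/
lemma IsHolomorphic.lintegral_sphDistSq_add_energy_le {F : polydisc → ℂ} (h : IsHolomorphic F)
    (s r : Ioo (0 : ℝ) 1) :
    ∫⁻ w, ∫⁻ u, ENNReal.ofReal (poisson ((s : ℝ) : ℂ) u) *
        sphDistSq (dilate F r (weighted u * w)) (dilate F (mulRadius s r) w)
        ∂circleMeasure ∂torusMeasure + energy F (mulRadius s r) ≤ energy F r := by
  have hs := norm_radius_lt s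
  have hP : Measurable fun u => ENNReal.ofReal (poisson ((s : ℝ) : ℂ) u) :=
    (continuous_poisson hs).measurable.ennreal_ofReal
  have hrot := lintegral_rotation continuous_weighted.measurable hP
    (continuous_sphSize.comp (h.continuous_dilate r)).measurable
  rw [lintegral_poisson hs, one_mul] at hrot
  rw [energy, energy, ← lintegral_add_right _ (show Measurable fun w =>
    sphSize (dilate F (mulRadius s r) w) from
      (continuous_sphSize.comp (h.continuous_dilate (mulRadius s r))).measurable)]
  refine (lintegral_mono fun w => ?_).trans_eq hrot
  have h1 := (h.isDiscAlgebra_scaled r).lintegral_sphDistSq_add_le w hs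
  simp only [← dilate_eq_scaled, ← dilate_mulRadius] at h1
  exact h1

lemma poisson_real_inv (s : ℝ) (u : Circle) : poisson (s : ℂ) u⁻¹ = poisson (s : ℂ) u := by
  rw [poisson_eq, poisson_eq, Circle.coe_inv_eq_conj]
  have e : (starRingEnd ℂ) (u : ℂ) - (s : ℂ) = (starRingEnd ℂ) ((u : ℂ) - s) := by simp
  rw [e, Complex.norm_conj]

lemma measurable_poisson_mul_sphDistSq {X : Type*} [MeasurableSpace X] {z : ℂ} (hz : ‖z‖ < 1)
    {c : X → Circle} {a b : X → ℂ} (hc : Measurable c) (ha : Measurable a) (hb : Measurable b) :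
    Measurable fun x => ENNReal.ofReal (poisson z (c x)) * sphDistSq (a x) (b x) := by
  have h1 : Measurable fun x => poisson z (c x) := (continuous_poisson hz).measurable.comp hc
  have h2 := continuous_sphDistSq.measurable.comp (ha.prodMk hb)
  exact h1.ennreal_ofReal.mul h2

/-- By the symmetry of the Poisson kernel of a real point, the rotation can be moved from one
function to the other. -/
lemma lintegral_poisson_rotation_swap (s : Ioo (0 : ℝ) 1) {A B : Torus → ℂ} (hA : Continuous A)
    (hB : Continuous B) :
    ∫⁻ w, ∫⁻ u, ENNReal.ofReal (poisson ((s : ℝ) : ℂ) u) * sphDistSq (A w) (B (weighted u * w))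
        ∂circleMeasure ∂torusMeasure =
      ∫⁻ w, ∫⁻ u, ENNReal.ofReal (poisson ((s : ℝ) : ℂ) u) * sphDistSq (A (weighted u * w)) (B w)
        ∂circleMeasure ∂torusMeasure := by
  have hs := norm_radius_lt s
  have hrot : Continuous fun p : Torus × Circle => weighted p.2 * p.1 :=
    (continuous_weighted.comp continuous_snd).mul continuous_fst
  have hm1 : Measurable fun p : Torus × Circle => ENNReal.ofReal (poisson ((s : ℝ) : ℂ) p.2) *
      sphDistSq (A p.1) (B (weighted p.2 * p.1)) :=
    measurable_poisson_mul_sphDistSq hs measurable_snd (hA.comp continuous_fst).measurable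
      (hB.comp hrot).measurable
  have hm2 : Measurable fun p : Torus × Circle => ENNReal.ofReal (poisson ((s : ℝ) : ℂ) p.2) *
      sphDistSq (A (weighted p.2 * p.1)) (B p.1) :=
    measurable_poisson_mul_sphDistSq hs measurable_snd (hA.comp hrot).measurable
      (hB.comp continuous_fst).measurable
  rw [lintegral_lintegral_swap (f := fun w u => ENNReal.ofReal (poisson ((s : ℝ) : ℂ) u) *
      sphDistSq (A w) (B (weighted u * w))) hm1.aemeasurable,
    lintegral_lintegral_swap (f := fun w u => ENNReal.ofReal (poisson ((s : ℝ) : ℂ) u) *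
      sphDistSq (A (weighted u * w)) (B w)) hm2.aemeasurable,
    ← measurePreserving_circle_inv.lintegral_comp hm1.lintegral_prod_left']
  refine lintegral_congr fun u => ?_
  have hmu : Measurable fun w : Torus => ENNReal.ofReal (poisson ((s : ℝ) : ℂ) u⁻¹) *
      sphDistSq (A w) (B (weighted u⁻¹ * w)) :=
    measurable_poisson_mul_sphDistSq hs measurable_const hA.measurable
      (hB.comp (continuous_const_mul _)).measurable
  rw [← (measurePreserving_torus_mul (weighted u)).lintegral_comp hmu]
  refine lintegral_congr fun w => ?_
  rw [poisson_real_inv, weighted_inv, inv_mul_cancel_left]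

lemma lintegral_const_mul_poisson (s : Ioo (0 : ℝ) 1) (c : ℝ≥0∞) :
    ∫⁻ u, ENNReal.ofReal (poisson ((s : ℝ) : ℂ) u) * c ∂circleMeasure = c := by
  rw [lintegral_mul_const _ (continuous_poisson (norm_radius_lt s)).measurable.ennreal_ofReal,
    lintegral_poisson (norm_radius_lt s), one_mul]

lemma IsHolomorphic.lintegral_sphDistSq_le {F : polydisc → ℂ} (h : IsHolomorphic F)
    (s ρ : Ioo (0 : ℝ) 1) :
    ∫⁻ w, sphDistSq (dilate F ρ w) (dilate F (mulRadius s (mulRadius s ρ)) w) ∂torusMeasure +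
      2 * energy F (mulRadius s (mulRadius s ρ)) ≤ 2 * energy F ρ := by
  set A := dilate F ρ
  set B := dilate F (mulRadius s ρ)
  set C := dilate F (mulRadius s (mulRadius s ρ))
  have hA : Continuous A := h.continuous_dilate _
  have hB : Continuous B := h.continuous_dilate _
  have hC : Continuous C := h.continuous_dilate _
  have hs := norm_radius_lt s
  have hrot : Continuous fun p : Torus × Circle => weighted p.2 * p.1 :=
    (continuous_weighted.comp continuous_snd).mul continuous_fst
  have hm : Measurable fun p : Torus × Circle => ENNReal.ofReal (poisson ((s : ℝ) : ℂ) p.2) *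
      sphDistSq (A p.1) (B (weighted p.2 * p.1)) :=
    measurable_poisson_mul_sphDistSq hs measurable_snd (hA.comp continuous_fst).measurable
      (hB.comp hrot).measurable
  set X := ∫⁻ w, ∫⁻ u, ENNReal.ofReal (poisson ((s : ℝ) : ℂ) u) *
    sphDistSq (A w) (B (weighted u * w)) ∂circleMeasure ∂torusMeasure with hX
  set Y := ∫⁻ w, ∫⁻ u, ENNReal.ofReal (poisson ((s : ℝ) : ℂ) u) *
    sphDistSq (B (weighted u * w)) (C w) ∂circleMeasure ∂torusMeasure with hY
  have h1 : X + energy F (mulRadius s ρ) ≤ energy F ρ := by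
    rw [hX, lintegral_poisson_rotation_swap s hA hB]
    exact h.lintegral_sphDistSq_add_energy_le s ρ
  have h2 : Y + energy F (mulRadius s (mulRadius s ρ)) ≤ energy F (mulRadius s ρ) :=
    h.lintegral_sphDistSq_add_energy_le s (mulRadius s ρ)
  have h3 : ∫⁻ w, sphDistSq (A w) (C w) ∂torusMeasure ≤ 2 * (X + Y) := by
    rw [hX, hY, ← lintegral_add_left hm.lintegral_prod_right',
      ← lintegral_const_mul' _ _ (by simp)]
    refine lintegral_mono fun w => ?_
    rw [← lintegral_add_left (show Measurable fun u => ENNReal.ofReal (poisson ((s : ℝ) : ℂ) u) *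
        sphDistSq (A w) (B (weighted u * w)) from
      measurable_poisson_mul_sphDistSq hs measurable_id measurable_const
        (hB.comp (continuous_weighted.mul continuous_const)).measurable),
      ← lintegral_const_mul' _ _ (by simp), ← lintegral_const_mul_poisson s (sphDistSq (A w) (C w))]
    refine lintegral_mono fun u => ?_
    rw [← mul_add, mul_left_comm]
    exact mul_le_mul_right (sphDistSq_le _ _ _) _
  calc _ ≤ 2 * (X + Y) + 2 * energy F (mulRadius s (mulRadius s ρ)) := add_le_add_left h3 _
    _ = 2 * (X + (Y + energy F (mulRadius s (mulRadius s ρ)))) := by rw [← mul_add, add_assoc]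
    _ ≤ 2 * energy F ρ := mul_le_mul_right ((add_le_add_right h2 X).trans h1) 2

/-- The stereographic images of the dilations of `F` are as close in `L²` as their energies. -/
lemma IsHolomorphic.lintegral_sphDistSq_add_le {F : polydisc → ℂ} (h : IsHolomorphic F)
    {r ρ : Ioo (0 : ℝ) 1} (hr : r ≤ ρ) :
    ∫⁻ w, sphDistSq (dilate F ρ w) (dilate F r w) ∂torusMeasure + 2 * energy F r ≤
      2 * energy F ρ := by
  rcases eq_or_lt_of_le hr with rfl | hlt
  · simp [sphDistSq]
  have h0 : (0 : ℝ) < r / ρ := div_pos r.2.1 ρ.2.1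
  let s : Ioo (0 : ℝ) 1 := ⟨√(r / ρ), Real.sqrt_pos.2 h0, by
    rw [Real.sqrt_lt' one_pos, one_pow, div_lt_one ρ.2.1]
    exact hlt⟩
  have e : mulRadius s (mulRadius s ρ) = r := by
    refine Subtype.ext ?_
    change √(r / ρ) * (√(r / ρ) * ρ) = (r : ℝ)
    rw [← mul_assoc, Real.mul_self_sqrt h0.le, div_mul_cancel₀ _ ρ.2.1.ne']
  have h1 := h.lintegral_sphDistSq_le s ρ
  rwa [e] at h1

lemma sphSize_le (x : ℂ) :
    sphSize x ≤ ENNReal.ofReal (Real.log 2) + 2 * ENNReal.ofReal (Real.posLog ‖x‖) := by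
  rw [← ENNReal.ofReal_ofNat 2, ← ENNReal.ofReal_mul (by norm_num),
    ← ENNReal.ofReal_add (Real.log_nonneg (by norm_num)) (mul_nonneg (by norm_num)
      Real.posLog_nonneg)]
  refine ENNReal.ofReal_le_ofReal ?_
  have hm : (0 : ℝ) < max 1 ‖x‖ := one_pos.trans_le (le_max_left _ _)
  rw [Real.posLog_eq_log_max_one (norm_nonneg x), sphLog,
    show (2 : ℝ) * Real.log (max 1 ‖x‖) = Real.log (max 1 ‖x‖ ^ 2) by rw [Real.log_pow]; norm_num,
    ← Real.log_mul (by norm_num) (by positivity)]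
  refine Real.log_le_log (by positivity) ?_
  have h1 : (1 : ℝ) ≤ max 1 ‖x‖ ^ 2 := one_le_pow₀ (le_max_left _ _)
  have h2 : ‖x‖ ^ 2 ≤ max 1 ‖x‖ ^ 2 := pow_le_pow_left₀ (norm_nonneg x) (le_max_right _ _) 2
  linarith

lemma iSup_energy_lt_top {F : polydisc → ℂ} (h : F ∈ nevanlinnaDisc) : ⨆ r, energy F r < ∞ := by
  set M := ⨆ r : Ioo (0 : ℝ) 1, ∫⁻ w, ENNReal.ofReal (Real.posLog ‖dilate F r w‖) ∂torusMeasure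
    with hM
  have h1 : ⨆ r, energy F r ≤ ENNReal.ofReal (Real.log 2) + 2 * M := by
    refine iSup_le fun r => (lintegral_mono fun w => sphSize_le _).trans ?_
    rw [lintegral_add_left measurable_const, lintegral_const, measure_univ, mul_one,
      lintegral_const_mul' _ _ (by simp)]
    exact add_le_add_right (mul_le_mul_right (le_iSup (fun r : Ioo (0 : ℝ) 1 =>
      ∫⁻ w, ENNReal.ofReal (Real.posLog ‖dilate F r w‖) ∂torusMeasure) r) _) _
  exact h1.trans_lt (ENNReal.add_lt_top.2 ⟨ENNReal.ofReal_lt_top,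
    ENNReal.mul_lt_top (by simp) h.2⟩)

/-! ### Boundary values of the functions of the Smirnov class of `ℓ¹ ∩ 𝔻^∞` -/

lemma energy_mono {F : polydisc → ℂ} (h : IsHolomorphic F) : Monotone (energy F) := fun r ρ hr => by
  have h1 := (le_add_self (a := 2 * energy F r)).trans (h.lintegral_sphDistSq_add_le hr)
  exact (ENNReal.mul_le_mul_iff_right (by simp) (by simp)).1 h1

/-- The stereographic images of the dilations converge almost everywhere along a sequence of radii,
since the energies increase to a finite limit. -/
lemma exists_seq_ae_tendsto_stereo {F : polydisc → ℂ} (hF : F ∈ nevanlinnaDisc) :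
    ∃ r : ℕ → Ioo (0 : ℝ) 1, Tendsto r atTop nearOne ∧
      ∀ᵐ w ∂torusMeasure, ∃ l, Tendsto (fun k => stereo (dilate F (r k) w)) atTop (𝓝 l) := by
  have h := hF.1
  obtain ⟨r, hr, hlim⟩ := exists_seq_nearOne
  set L := ⨆ k, energy F (r k) with hL
  have hLtop : L ≠ ∞ := ((iSup_le fun k => le_iSup (energy F) (r k)).trans_lt
    (iSup_energy_lt_top hF)).ne
  have hEL : Tendsto (fun k => energy F (r k)) atTop (𝓝 L) :=
    tendsto_atTop_iSup ((energy_mono h).comp hr.monotone)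
  set B : ℕ → ℝ≥0∞ := fun N => 2⁻¹ ^ N with hB
  have hB0 : ∀ N, 0 < B N := fun N => ENNReal.pow_pos (by simp) N
  -- after the index `φ N` the energies differ from their limit by less than `B N ^ 2 / 4`
  obtain ⟨φ, hφ, hφL⟩ := extraction_forall_of_eventually (P := fun N k =>
      L < energy F (r k) + B N ^ 2 / 4) fun N => by
    have h1 := hEL.add_const (B N ^ 2 / 4)
    refine h1.eventually (lt_mem_nhds (ENNReal.lt_add_right hLtop ?_))
    exact (ENNReal.div_pos (pow_ne_zero 2 (hB0 N).ne') (by simp)).ne'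
  refine ⟨r ∘ φ, hlim.comp hφ.tendsto_atTop, ?_⟩
  have hmain : ∀ N n m, N ≤ n → n ≤ m →
      ∫⁻ w, sphDistSq (dilate F (r (φ m)) w) (dilate F (r (φ n)) w) ∂torusMeasure < B N ^ 2 := by
    intro N n m hNn hnm
    have h1 := h.lintegral_sphDistSq_add_le (hr.monotone (hφ.monotone hnm))
    set D := ∫⁻ w, sphDistSq (dilate F (r (φ m)) w) (dilate F (r (φ n)) w) ∂torusMeasure
    set e := energy F (r (φ n)) with he
    have heL : e ≤ L := le_iSup (fun k => energy F (r k)) (φ n)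
    have h2 : D + 2 * e ≤ 2 * (e + B N ^ 2 / 4) := by
      refine h1.trans (mul_le_mul_right ?_ 2)
      refine (le_iSup (fun k => energy F (r k)) (φ m)).trans ((hφL N).le.trans ?_)
      exact add_le_add_left ((energy_mono h) (hr.monotone (hφ.monotone hNn))) _
    rw [mul_add, add_comm] at h2
    have h3 := (ENNReal.add_le_add_iff_left
      (ENNReal.mul_ne_top (by simp) (ne_top_of_le_ne_top hLtop heL))).1 h2
    refine h3.trans_lt ?_
    have hBt : B N ^ 2 ≠ ∞ := by simp [hB]
    have hB2 : B N ^ 2 ≠ 0 := pow_ne_zero 2 (hB0 N).ne'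
    have e1 : 2 * (B N ^ 2 / 4) = B N ^ 2 / 2 := by
      rw [show (4 : ℝ≥0∞) = 2 * 2 by norm_num, ← mul_div_assoc,
        ENNReal.mul_div_mul_left _ _ (by simp) (by simp)]
    rw [e1]
    exact ENNReal.half_lt_self hB2 hBt
  refine Lp.ae_tendsto_of_cauchy_eLpNorm' (p := 2) (B := B) (fun n =>
    (continuous_stereo.comp (h.continuous_dilate _)).aestronglyMeasurable) (by norm_num) ?_ ?_
  · simp [hB, ENNReal.tsum_geometric]
  · have key : ∀ N n m, N ≤ n → n ≤ m →
        eLpNorm' ((fun w => stereo (dilate F ((r ∘ φ) m) w)) - fun w =>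
          stereo (dilate F ((r ∘ φ) n) w)) 2 torusMeasure < B N := by
      intro N n m hNn hnm
      have e1 : B N = (B N ^ 2) ^ (1 / 2 : ℝ) := by
        rw [← ENNReal.rpow_two, ← ENNReal.rpow_mul]
        norm_num
      rw [eLpNorm', e1]
      refine ENNReal.rpow_lt_rpow ((lintegral_congr fun w => ?_).trans_lt (hmain N n m hNn hnm))
        (by norm_num)
      rw [ENNReal.rpow_two, sphDistSq, ← ofReal_norm, ENNReal.ofReal_pow (norm_nonneg _)]
      rfl
    intro N n m hn hm
    rcases le_total n m with hnm | hnm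
    · rw [← eLpNorm'_neg, neg_sub]
      exact key N n m hn hnm
    · exact key N m n hm hnm

lemma tendsto_of_tendsto_stereo {ι : Type*} {l : Filter ι} {x : ι → ℂ} {a : ℂ × ℝ}
    (h : Tendsto (fun i => stereo (x i)) l (𝓝 a)) (ha : a.2 ≠ 0) :
    ∃ y, Tendsto x l (𝓝 y) := by
  have h1 : Tendsto (fun i => (stereo (x i)).1) l (𝓝 a.1) :=
    (continuous_fst.tendsto a).comp h
  have h2 : Tendsto (fun i => (((stereo (x i)).2 : ℝ) : ℂ)) l (𝓝 (a.2 : ℂ)) :=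
    ((Complex.continuous_ofReal.comp continuous_snd).tendsto a).comp h
  refine ⟨_, (h1.div h2 (Complex.ofReal_ne_zero.2 ha)).congr fun i => ?_⟩
  have h3 : ((1 + ‖x i‖ ^ 2 : ℝ) : ℂ) ≠ 0 :=
    Complex.ofReal_ne_zero.2 (by positivity)
  rw [Pi.div_apply]
  simp only [stereo]
  push_cast at h3 ⊢
  field_simp

/-- The dilations converge almost everywhere along a sequence of radii: by Fatou's lemma the limits
of their stereographic images are almost nowhere the point at infinity. -/
lemma exists_seq_ae_tendsto_dilate {F : polydisc → ℂ} (hF : F ∈ nevanlinnaDisc) :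
    ∃ r : ℕ → Ioo (0 : ℝ) 1, Tendsto r atTop nearOne ∧
      ∀ᵐ w ∂torusMeasure, ∃ l, Tendsto (fun k => dilate F (r k) w) atTop (𝓝 l) := by
  obtain ⟨r, hr, hae⟩ := exists_seq_ae_tendsto_stereo hF
  refine ⟨r, hr, ?_⟩
  have hm : ∀ k, Measurable fun w => sphSize (dilate F (r k) w) := fun k =>
    (continuous_sphSize.comp (hF.1.continuous_dilate (r k))).measurable
  have h1 : ∫⁻ w, liminf (fun k => sphSize (dilate F (r k) w)) atTop ∂torusMeasure ≠ ∞ := by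
    refine ((lintegral_liminf_le hm).trans_lt ((?_ : _ ≤ ⨆ r, energy F r).trans_lt
      (iSup_energy_lt_top hF))).ne
    exact liminf_le_of_frequently_le' (Frequently.of_forall fun k => le_iSup (energy F) (r k))
  filter_upwards [hae, ae_lt_top (Measurable.liminf hm) h1] with w ⟨l, hl⟩ hw
  refine tendsto_of_tendsto_stereo hl fun h0 => hw.ne ?_
  have h2 : Tendsto (fun k => (stereo (dilate F (r k) w)).2) atTop (𝓝[>] 0) := by
    refine tendsto_nhdsWithin_iff.2 ⟨h0 ▸ (continuous_snd.tendsto l).comp hl,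
      Eventually.of_forall fun k => ?_⟩
    simp only [stereo, mem_Ioi]
    positivity
  have h3 : Tendsto (fun k => sphLog (dilate F (r k) w)) atTop atTop := by
    refine (tendsto_neg_atBot_atTop.comp (Real.tendsto_log_nhdsGT_zero.comp h2)).congr fun k => ?_
    simp only [Function.comp_apply, stereo, sphLog]
    rw [one_div, Real.log_inv, neg_neg]
  exact (ENNReal.tendsto_ofReal_atTop.comp h3).liminf_eq

lemma log_one_add_le_posLog (x : ℂ) :
    Real.log (1 + ‖x‖) ≤ Real.log 2 + Real.posLog ‖x‖ := by
  have hm : (0 : ℝ) < max 1 ‖x‖ := one_pos.trans_le (le_max_left _ _)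
  rw [Real.posLog_eq_log_max_one (norm_nonneg x), ← Real.log_mul (by norm_num) hm.ne']
  refine Real.log_le_log (by positivity) ?_
  linarith [le_max_left 1 ‖x‖, le_max_right 1 ‖x‖]

/-- The dilations of a function of the Smirnov class converge in `L⁰` along a sequence of radii. -/
lemma exists_seq_tendsto_toL0 {F : polydisc → ℂ} (hF : F ∈ smirnovDisc) :
    ∃ (r : ℕ → Ioo (0 : ℝ) 1) (f : L0), Tendsto r atTop nearOne ∧
      Tendsto (fun k => (hF.1.1.isDiscAlgebra_scaled (r k)).toL0) atTop (𝓝 f) := by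
  obtain ⟨hN, -, hUI, -⟩ := hF
  have h := hN.1
  obtain ⟨r, hr, hae⟩ := exists_seq_ae_tendsto_dilate hN
  obtain ⟨g, hgm, hg⟩ := measurable_limit_of_tendsto_metrizable_ae
    (fun k => (h.continuous_dilate (r k)).measurable.aemeasurable) hae
  -- the limit belongs to `L⁰`, by Fatou's lemma
  have hgfin : logNorm g < ∞ := by
    have h1 : ∀ᵐ w ∂torusMeasure, logSize (g w) =
        liminf (fun k => logSize (dilate F (r k) w)) atTop := by
      filter_upwards [hg] with w hw
      exact ((continuous_logSize.tendsto _).comp hw).liminf_eq.symm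
    rw [logNorm_eq_lintegral, lintegral_congr_ae h1]
    have h2 : ∀ k, ∫⁻ w, logSize (dilate F (r k) w) ∂torusMeasure ≤
        ENNReal.ofReal (Real.log 2) + ⨆ r : Ioo (0 : ℝ) 1,
          ∫⁻ w, ENNReal.ofReal (Real.posLog ‖dilate F r w‖) ∂torusMeasure := fun k => by
      have h3 : ∫⁻ w, logSize (dilate F (r k) w) ∂torusMeasure ≤
          ∫⁻ w, (ENNReal.ofReal (Real.log 2) + ENNReal.ofReal (Real.posLog ‖dilate F (r k) w‖))
            ∂torusMeasure := by
        refine lintegral_mono fun w => ?_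
        rw [← ENNReal.ofReal_add (Real.log_nonneg (by norm_num)) Real.posLog_nonneg]
        exact ENNReal.ofReal_le_ofReal (log_one_add_le_posLog _)
      refine h3.trans ?_
      rw [lintegral_add_left measurable_const, lintegral_const, measure_univ, mul_one]
      exact add_le_add_right (le_iSup (fun r : Ioo (0 : ℝ) 1 =>
        ∫⁻ w, ENNReal.ofReal (Real.posLog ‖dilate F r w‖) ∂torusMeasure) (r k)) _
    refine ((lintegral_liminf_le fun k => measurable_logSize.comp
      (h.continuous_dilate (r k)).measurable).trans
      (liminf_le_of_frequently_le' (Frequently.of_forall h2))).trans_lt ?_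
    exact ENNReal.add_lt_top.2 ⟨ENNReal.ofReal_lt_top, hN.2⟩
  have hcoe : (AEEqFun.mk g hgm.aestronglyMeasurable : MeasFun) =ᵐ[torusMeasure] g :=
    AEEqFun.coeFn_mk _ _
  obtain ⟨f, hf⟩ : ∃ f : L0, (f : MeasFun) =ᵐ[torusMeasure] g :=
    ⟨⟨AEEqFun.mk g hgm.aestronglyMeasurable, (logNorm_congr hcoe).trans_lt hgfin⟩, hcoe⟩
  refine ⟨r, f, hr, ?_⟩
  -- convergence in mean, by Vitali's theorem
  set H : ℕ → Torus → ℝ := fun k w => Real.log (1 + ‖dilate F (r k) w - g w‖) with hH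
  have hHm : ∀ k, AEStronglyMeasurable (H k) torusMeasure := fun k => by
    have h1 : Measurable fun w => dilate F (r k) w - g w :=
      (h.continuous_dilate (r k)).measurable.sub hgm
    have h2 := continuous_log_one_add_norm.measurable.comp h1
    exact h2.aestronglyMeasurable
  set G : Torus → ℝ := fun w => Real.log 2 + Real.log (1 + ‖g w‖) with hG
  have hGm : MemLp G 1 torusMeasure := by
    have h1 : MemLp (fun _ : Torus => Real.log 2) 1 torusMeasure := memLp_const _
    have h2 : MemLp (fun w => Real.log (1 + ‖g w‖)) 1 torusMeasure := by
      have h3 := continuous_log_one_add_norm.measurable.comp hgm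
      refine ⟨h3.aestronglyMeasurable, ?_⟩
      rw [eLpNorm_one_eq_lintegral_enorm]
      refine lt_of_eq_of_lt (lintegral_congr fun w => ?_) hgfin
      exact Real.enorm_of_nonneg (log_one_add_norm_nonneg _)
    exact h1.add h2
  have hposm : ∀ k, AEStronglyMeasurable (fun w => Real.posLog ‖dilate F (r k) w‖) torusMeasure :=
    fun k => (Real.continuous_posLog.comp
      (h.continuous_dilate (r k)).norm).aestronglyMeasurable
  have hUI' : UnifIntegrable (fun k w => Real.posLog ‖dilate F (r k) w‖) 1 torusMeasure :=
    fun ε hε => (hUI hε).imp fun δ hδ => ⟨hδ.1, fun k => hδ.2 (r k)⟩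
  have hUI2 := hUI'.add (unifIntegrable_const (ι := ℕ) (p := 1) le_rfl (by simp) hGm) le_rfl hposm
    fun _ => hGm.1
  have hHle : ∀ k w, ‖H k w‖ ≤ ‖Real.posLog ‖dilate F (r k) w‖ + G w‖ := fun k w => by
    have h1 : H k w ≤ Real.posLog ‖dilate F (r k) w‖ + G w := by
      have h2 := log_one_add_norm_add_le (dilate F (r k) w) (-g w)
      rw [norm_neg, ← sub_eq_add_neg] at h2
      have h3 := log_one_add_le_posLog (dilate F (r k) w)
      simp only [hH, hG]
      linarith
    have h0 : 0 ≤ H k w := log_one_add_norm_nonneg _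
    rw [Real.norm_of_nonneg h0, Real.norm_of_nonneg (h0.trans h1)]
    exact h1
  have hUI3 : UnifIntegrable H 1 torusMeasure := fun ε hε => by
    obtain ⟨δ, hδ, H1⟩ := hUI2 hε
    refine ⟨δ, hδ, fun k s hs hμ => le_trans (eLpNorm_mono fun w => ?_) (H1 k s hs hμ)⟩
    by_cases hw : w ∈ s
    · simp only [indicator_of_mem hw]
      exact hHle k w
    · simp only [indicator_of_notMem hw, le_refl]
  have hlim := tendsto_Lp_finite_of_tendsto_ae (p := 1) le_rfl (by simp) hHm
    (MemLp.zero (p := 1) (μ := torusMeasure) (ε := ℝ)) hUI3 (by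
      filter_upwards [hg] with w hw
      have h1 := (continuous_log_one_add_norm.tendsto 0).comp (tendsto_sub_nhds_zero_iff.2 hw)
      rw [norm_zero, add_zero, Real.log_one] at h1
      exact h1)
  refine tendsto_iff_edist_tendsto_0.2 (hlim.congr fun k => ?_)
  have e : edist (h.isDiscAlgebra_scaled (r k)).toL0 f =
      logNorm fun w => scaled F (r k) (torusPoint w) - g w :=
    L0_edist_of_ae (coeFn_continuousL0 _ (h.isDiscAlgebra_scaled (r k)).continuous_torus) hf
  rw [e, sub_zero, eLpNorm_one_eq_lintegral_enorm]
  refine lintegral_congr fun w => ?_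
  simp only [← dilate_eq_scaled]
  exact Real.enorm_of_nonneg (log_one_add_norm_nonneg _)

/-- Every function of the Smirnov class of `ℓ¹ ∩ 𝔻^∞` is of the form `f̃`. -/
lemma exists_tilde_eq {F : polydisc → ℂ} (hF : F ∈ smirnovDisc) :
    ∃ f ∈ smirnovTorus, tilde f = F := by
  obtain ⟨r, f, hr, hlim⟩ := exists_seq_tendsto_toL0 hF
  have hmem : ∀ k, (hF.1.1.isDiscAlgebra_scaled (r k)).toL0 ∈ smirnovTorus := fun k =>
    (hF.1.1.isDiscAlgebra_scaled (r k)).toL0_mem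
  have hf : f ∈ smirnovTorus := isClosed_closure.mem_of_tendsto hlim (Eventually.of_forall hmem)
  refine ⟨f, hf, funext fun ζ => ?_⟩
  have h1 := tendsto_pointEval_of_tendsto ζ hmem hf hlim
  simp only [fun k => pointEval_toL0 ζ (hF.1.1.isDiscAlgebra_scaled (r k)) (hmem k)] at h1
  exact tendsto_nhds_unique h1 ((hF.1.1.tendsto_scaled ζ).comp (tendsto_coe_nearOne.comp hr))

/-! ### The isomorphism -/

lemma tildeHom_injective : Function.Injective tildeHom := fun f g h => by
  have h1 := discNorm_tilde_sub (mem_smirnovTorusAlgebra.1 f.2) (mem_smirnovTorusAlgebra.1 g.2)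
  rw [← tildeHom_apply, ← tildeHom_apply, h, sub_self] at h1
  have h2 : discNorm (0 : polydisc → ℂ) = 0 := by simp [discNorm, logNorm, dilate]
  rw [h2] at h1
  exact Subtype.ext (edist_eq_zero.1 h1.symm)

lemma coe_range_tildeHom : (tildeHom.range : Set (polydisc → ℂ)) = smirnovDisc := by
  ext F
  constructor
  · rintro ⟨f, rfl⟩
    exact tilde_mem_smirnovDisc (mem_smirnovTorusAlgebra.1 f.2)
  · intro hF
    obtain ⟨f, hf, rfl⟩ := exists_tilde_eq hF
    exact ⟨⟨f, mem_smirnovTorusAlgebra.2 hf⟩, rfl⟩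

end

end SmirnovClass

open SmirnovClass
theorem theorem2p12 :
    -- the point evaluations extend continuously from the polynomials to the torus class
    (∀ ζ : polydisc, ContinuousOn (pointEval ζ) smirnovTorus ∧
      ∀ q : MvPolynomial ℕ ℂ, pointEval ζ (polyTorus q) = polyEval ζ q) ∧
    -- both Smirnov classes are algebras, and `F ↦ F^*` is an isometric algebra isomorphism
    -- between them, with inverse `f ↦ f̃`
    ∃ (A : Subalgebra ℂ (polydisc → ℂ)) (B : Subalgebra ℂ L0) (Λ : A ≃ₐ[ℂ] B),
      (A : Set (polydisc → ℂ)) = smirnovDisc ∧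
      (B : Set L0) = smirnovTorus ∧
      (∀ F : A, IsBoundaryValue (F : polydisc → ℂ) ((Λ F : L0) : MeasFun)) ∧
      (∀ F G : A, discNorm ((F : polydisc → ℂ) - (G : polydisc → ℂ)) = edist (Λ F : L0) (Λ G : L0)) ∧
      (∀ f : B, ((Λ.symm f : A) : polydisc → ℂ) = tilde (f : L0)) := by
  refine ⟨fun ζ => ⟨continuousOn_pointEval ζ, pointEval_polyTorus ζ⟩, tildeHom.range,
    smirnovTorusAlgebra, (AlgEquiv.ofInjective tildeHom tildeHom_injective).symm,
    coe_range_tildeHom, coe_smirnovTorusAlgebra, fun F => ?_, fun F G => ?_, fun f => rfl⟩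
  · obtain ⟨f, rfl⟩ := (AlgEquiv.ofInjective tildeHom tildeHom_injective).surjective F
    rw [AlgEquiv.symm_apply_apply]
    exact isBoundaryValue_tilde (mem_smirnovTorusAlgebra.1 f.2)
  · obtain ⟨f, rfl⟩ := (AlgEquiv.ofInjective tildeHom tildeHom_injective).surjective F
    obtain ⟨g, rfl⟩ := (AlgEquiv.ofInjective tildeHom tildeHom_injective).surjective G
    rw [AlgEquiv.symm_apply_apply, AlgEquiv.symm_apply_apply]
    exact discNorm_tilde_sub (mem_smirnovTorusAlgebra.1 f.2) (mem_smirnovTorusAlgebra.1 g.2)
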